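/- A \emph{Cantor group} is a totally disconnected compact Abelian topological group with no isolated points. A \emph{translation} of a Cantor group $\Omega$ is a map $T:\Omega\to\Omega$ of the form $T\omega=\omega+\alpha$ for some $\alpha\in\Omega$; it is \emph{minimal} if the orbit $\{T^n\omega : n\in\mathbb{Z}\}$ of every $\omega\in\Omega$ is dense in $\Omega$. A \emph{Cantor set} is a closed subset of $\mathbb{R}$ with empty interior and no isolated points. For $f\in C(\Omega,\mathbb{R})$ and $\omega\in\Omega$, let $H_\omega$ be the bounded self-adjoint operator on $\ell^2(\mathbb{Z})$ given by $$[H_\omega\psi](n)=\psi(n+1)+\psi(n-1)+f(T^n\omega)\,\psi(n),\qquad n\in\mathbb{Z}.$$ The operator $H_\omega$ has \emph{purely absolutely continuous} (respectively, \emph{purely singular continuous}) spectrum if for every $\psi\in\ell^2(\mathbb{Z})$ the spectral measure of $H_\omega$ and $\psi$ is absolutely continuous with respect to Lebesgue measure (respectively, is singular with respect to Lebesgue measure and has no atoms). \textbf{Theorem.} Suppose $\Omega$ is a Cantor group and $T:\Omega\to\Omega$ is a minimal translation. Equip $C(\Omega,\mathbb{R})$ with the topology of uniform convergence. (a) There is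 a dense set of $f\in C(\Omega,\mathbb{R})$ such that, for every $f$ in this set and every $\omega\in\Omega$, the spectrum of $H_\omega$ is a Cantor set of positive Lebesgue measure and $H_\omega$ has purely absolutely continuous spectrum. (b) There is a dense $G_\delta$ set of $f\in C(\Omega,\mathbb{R})$ such that, for every $f$ in this set and every $\omega\in\Omega$, the spectrum of $H_\omega$ is a Cantor set of zero Lebesgue measure and $H_\omega$ has purely singular continuous spectrum. -/

import Mathlib

open scoped lp ENNReal CompactlySupported InnerProductSpace
open MeasureTheory

/-- A Cantor group: a totally disconnected compact Abelian topological group without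
isolated points. (The Hausdorff property is a consequence.) -/
class IsCantorGroup (Ω : Type*) [AddCommGroup Ω] [TopologicalSpace Ω] : Prop extends
    IsTopologicalAddGroup Ω, CompactSpace Ω, TotallyDisconnectedSpace Ω, PerfectSpace Ω

/-- A translation is a map of the form `T ω = ω + α`. -/
def IsTranslation {Ω : Type*} [AddCommGroup Ω] [TopologicalSpace Ω] (T : Ω ≃ₜ Ω) : Prop :=
  ∃ α : Ω, ∀ ω : Ω, T ω = ω + α

/-- Minimality: all two-sided orbits are dense. Here `T ^ n` is the iterate of the
homeomorphism `T`, with `n` possibly negative. -/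
def IsMinimalHomeo {Ω : Type*} [TopologicalSpace Ω] (T : Ω ≃ₜ Ω) : Prop :=
  ∀ ω : Ω, Dense (Set.range fun n : ℤ => (T ^ n) ω)

/-- A Cantor set of real numbers: closed, with empty interior and no isolated points
(`Perfect` means closed and without isolated points). -/
def IsCantorSet (K : Set ℝ) : Prop :=
  Perfect K ∧ interior K = ∅

section Schrodinger

/-- Translation by `m` on square-summable sequences preserves square-summability. -/
lemma memℓp_comp_add_right (ψ : ℓ^2(ℤ, ℂ)) (m : ℤ) :
    Memℓp (fun n : ℤ => ψ (n + m)) 2 := by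
  have h := (memℓp_gen_iff (p := 2) (by norm_num)).1 (lp.memℓp ψ)
  exact memℓp_gen ((Equiv.addRight m).summable_iff.2 h)

/-- The shift `(shift m ψ)(n) = ψ (n + m)` on `ℓ²(ℤ)`. -/
noncomputable def lpShift (m : ℤ) : ℓ^2(ℤ, ℂ) →L[ℂ] ℓ^2(ℤ, ℂ) :=
  LinearMap.mkContinuous
    { toFun := fun ψ => ⟨fun n => ψ (n + m), memℓp_comp_add_right ψ m⟩
      map_add' := fun _ _ => rfl
      map_smul' := fun _ _ => rfl } 1 (by
    intro ψ
    rw [one_mul, lp.norm_eq_tsum_rpow (by norm_num), lp.norm_eq_tsum_rpow (by norm_num)]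
    exact le_of_eq (congrArg (· ^ _)
      ((Equiv.addRight m).tsum_eq fun n => ‖ψ n‖ ^ (2 : ℝ≥0∞).toReal)))

lemma norm_potential_mul_le (V : ℓ^∞(ℤ, ℝ)) (ψ : ℓ^2(ℤ, ℂ)) (n : ℤ) :
    ‖(V n : ℂ) * ψ n‖ ≤ ‖((‖V‖ : ℂ) • ψ) n‖ := by
  rw [lp.coeFn_smul, Pi.smul_apply, norm_mul, smul_eq_mul, norm_mul, Complex.norm_real,
    Complex.norm_real, norm_norm]
  exact mul_le_mul_of_nonneg_right (lp.norm_apply_le_norm (by simp) V n) (norm_nonneg _)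

/-- Multiplication by a bounded real sequence on `ℓ²(ℤ)`. -/
noncomputable def lpMultiplication (V : ℓ^∞(ℤ, ℝ)) : ℓ^2(ℤ, ℂ) →L[ℂ] ℓ^2(ℤ, ℂ) :=
  LinearMap.mkContinuous
    { toFun := fun ψ => ⟨fun n => (V n : ℂ) * ψ n,
        Memℓp.mono' (lp.memℓp ((‖V‖ : ℂ) • ψ)) (norm_potential_mul_le V ψ)⟩
      map_add' := fun _ _ => by ext n; exact mul_add _ _ _
      map_smul' := fun _ _ => by ext n; exact mul_left_comm _ _ _ } ‖V‖ (by
    intro ψ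
    refine (lp.norm_mono (by norm_num) (norm_potential_mul_le V ψ)).trans ?_
    rw [norm_smul, Complex.norm_real, norm_norm])

/-- The discrete Schrödinger operator with bounded real potential `V` on `ℓ²(ℤ)`,
`(H ψ)(n) = ψ (n + 1) + ψ (n - 1) + V n * ψ n`. -/
noncomputable def schrodinger (V : ℓ^∞(ℤ, ℝ)) : ℓ^2(ℤ, ℂ) →L[ℂ] ℓ^2(ℤ, ℂ) :=
  lpShift 1 + lpShift (-1) + lpMultiplication V

lemma schrodinger_apply (V : ℓ^∞(ℤ, ℝ)) (ψ : ℓ^2(ℤ, ℂ)) (n : ℤ) :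
    schrodinger V ψ n = ψ (n + 1) + ψ (n - 1) + (V n : ℂ) * ψ n := rfl

lemma inner_lpShift_left (m : ℤ) (φ ψ : ℓ^2(ℤ, ℂ)) :
    ⟪lpShift m φ, ψ⟫_ℂ = ⟪φ, lpShift (-m) ψ⟫_ℂ := by
  rw [lp.inner_eq_tsum, lp.inner_eq_tsum, ← (Equiv.addRight m).tsum_eq
    fun n => ⟪φ n, lpShift (-m) ψ n⟫_ℂ]
  refine tsum_congr fun n => ?_
  change ⟪φ (n + m), ψ n⟫_ℂ = ⟪φ (n + m), ψ (n + m + -m)⟫_ℂ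
  rw [add_neg_cancel_right]

lemma inner_lpMultiplication_left (V : ℓ^∞(ℤ, ℝ)) (φ ψ : ℓ^2(ℤ, ℂ)) :
    ⟪lpMultiplication V φ, ψ⟫_ℂ = ⟪φ, lpMultiplication V ψ⟫_ℂ := by
  rw [lp.inner_eq_tsum, lp.inner_eq_tsum]
  refine tsum_congr fun n => ?_
  change ⟪(V n : ℂ) * φ n, ψ n⟫_ℂ = ⟪φ n, (V n : ℂ) * ψ n⟫_ℂ
  simp only [RCLike.inner_apply, map_mul, Complex.conj_ofReal]
  ring

lemma isSelfAdjoint_schrodinger (V : ℓ^∞(ℤ, ℝ)) : IsSelfAdjoint (schrodinger V) := by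
  rw [ContinuousLinearMap.isSelfAdjoint_iff_isSymmetric]
  intro φ ψ
  have h1 := inner_lpShift_left 1 φ ψ
  have h2 := inner_lpShift_left (-1) φ ψ
  have h3 := inner_lpMultiplication_left V φ ψ
  rw [neg_neg] at h2
  change ⟪lpShift 1 φ + lpShift (-1) φ + lpMultiplication V φ, ψ⟫_ℂ =
    ⟪φ, lpShift 1 ψ + lpShift (-1) ψ + lpMultiplication V ψ⟫_ℂ
  simp only [inner_add_left, inner_add_right, h1, h2, h3]
  ring

end Schrodinger

section SpectralMeasure

variable {H : Type*} [NormedAddCommGroup H] [InnerProductSpace ℂ H] [CompleteSpace H]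

/-- The positive functional `g ↦ ⟪ψ, g(A) ψ⟫` on compactly supported continuous functions, for a
bounded self-adjoint operator `A`, where `g(A)` is the continuous functional calculus. -/
noncomputable def spectralFunctional (A : H →L[ℂ] H) (_hA : IsSelfAdjoint A) (ψ : H) :
    C_c(ℝ, ℝ) →ₚ[ℝ] ℝ :=
  PositiveLinearMap.mk₀
    { toFun := fun g => (⟪ψ, cfc (g : ℝ → ℝ) A ψ⟫_ℂ).re
      map_add' := fun g h => by
        have := cfc_add (a := A) (g : ℝ → ℝ) (h : ℝ → ℝ)
          g.continuous.continuousOn h.continuous.continuousOn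
        change (⟪ψ, cfc (fun x => g x + h x) A ψ⟫_ℂ).re = _
        rw [this, add_apply, inner_add_right, Complex.add_re]
      map_smul' := fun c g => by
        have := cfc_smul c (g : ℝ → ℝ) A g.continuous.continuousOn
        change (⟪ψ, cfc (fun x => c • g x) A ψ⟫_ℂ).re = _
        rw [this, smul_apply, inner_smul_right_eq_smul, Complex.smul_re]
        rfl }
    (fun g hg => by
      have h : (0 : H →L[ℂ] H) ≤ cfc (g : ℝ → ℝ) A := cfc_nonneg fun x _ => hg x
      rw [ContinuousLinearMap.nonneg_iff_isPositive] at h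
      exact h.re_inner_nonneg_right ψ)

/-- The spectral measure of a bounded self-adjoint operator `A` at the vector `ψ`: the Borel measure
`μ` on the real line with `∫ g dμ = ⟪ψ, g(A) ψ⟫` for every `g` continuous with compact support. -/
noncomputable def spectralMeasure (A : H →L[ℂ] H) (hA : IsSelfAdjoint A) (ψ : H) : Measure ℝ :=
  RealRMK.rieszMeasure (spectralFunctional A hA ψ)

lemma integral_spectralMeasure (A : H →L[ℂ] H) (hA : IsSelfAdjoint A) (ψ : H) (g : C_c(ℝ, ℝ)) :
    ∫ x, g x ∂(spectralMeasure A hA ψ) = (⟪ψ, cfc (g : ℝ → ℝ) A ψ⟫_ℂ).re :=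
  RealRMK.integral_rieszMeasure _ g

/-- All spectral measures are absolutely continuous with respect to Lebesgue measure. -/
def HasPurelyACSpectrum (A : H →L[ℂ] H) (hA : IsSelfAdjoint A) : Prop :=
  ∀ ψ : H, spectralMeasure A hA ψ ≪ volume

/-- All spectral measures are singular continuous: singular with respect to Lebesgue measure, and
without atoms. -/
def HasPurelySCSpectrum (A : H →L[ℂ] H) (hA : IsSelfAdjoint A) : Prop :=
  ∀ ψ : H, spectralMeasure A hA ψ ⟂ₘ volume ∧ ∀ E : ℝ, spectralMeasure A hA ψ {E} = 0

end SpectralMeasure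

section Family

variable {Ω : Type*} [TopologicalSpace Ω] [CompactSpace Ω]

/-- The bounded potential `V_ω(n) = f (T ^ n ω)`. -/
noncomputable def dynPotential (T : Ω ≃ₜ Ω) (f : C(Ω, ℝ)) (ω : Ω) : ℓ^∞(ℤ, ℝ) :=
  ⟨fun n => f ((T ^ n) ω), memℓp_infty ⟨‖f‖, by
    rintro _ ⟨n, rfl⟩
    exact f.norm_coe_le_norm _⟩⟩

/-- The Schrödinger operator `H_ω` with potential `V_ω(n) = f (T ^ n ω)`. -/
noncomputable def dynSchrodinger (T : Ω ≃ₜ Ω) (f : C(Ω, ℝ)) (ω : Ω) :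
    ℓ^2(ℤ, ℂ) →L[ℂ] ℓ^2(ℤ, ℂ) :=
  schrodinger (dynPotential T f ω)

lemma isSelfAdjoint_dynSchrodinger (T : Ω ≃ₜ Ω) (f : C(Ω, ℝ)) (ω : Ω) :
    IsSelfAdjoint (dynSchrodinger T f ω) :=
  isSelfAdjoint_schrodinger _

lemma dynSchrodinger_apply (T : Ω ≃ₜ Ω) (f : C(Ω, ℝ)) (ω : Ω) (ψ : ℓ^2(ℤ, ℂ)) (n : ℤ) :
    dynSchrodinger T f ω ψ n = ψ (n + 1) + ψ (n - 1) + (f ((T ^ n) ω) : ℂ) * ψ n := rfl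

end Family

/-! ### Spectral measures of bounded self-adjoint operators. -/

section SpectralTheory

open Filter Topology

/-! Functions that factor through a finite quotient of `Ω` are dense in `C(Ω, ℝ)`, and along an
orbit they are periodic potentials. Such a potential, of period `N`, is controlled by its
discriminant `Δ`, the trace of the monodromy matrix: since `Δ(H) = S^N + S^(-N)` with `S` the shift,
the spectrum lies in `{|Δ| ≤ 2}`. Minimality and the absence of isolated points supply arbitrarily
large multiples of any period, and this leaves room for perturbing. Where `|Δ| < 2`, write `Δ = 2
cos θ`. For a large multiple of the period, some energy near a prescribed one has monodromy `±1`,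
and an arbitrarily small change at two adjacent sites makes `|Δ| > 2` there
(`exists_gap_perturbation`).

Zero measure (`exists_small_bands`): by compactness, finitely many nearby periodic potentials have
gaps covering a given energy interval. Put them side by side in one long period. At each energy some
block has hyperbolic, hence growing, transfer matrices. Growth forces `|Δ'|` to be large compared
with `√(4 - Δ²)` (`growth_le_derivative`), so `θ` moves fast and the bands are short. Spectra move
by at most the size of a perturbation, so small measure persists on a ball. The very precise
almost-periods required by Gordon's lemma also persist on balls. Baire's theorem yields a dense
`G_δ` with null spectrum and no eigenvalues; since an isolated spectral point is an eigenvalue, the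
spectrum is a Cantor set.

Absolute continuity: the squared diagonal Green function of a periodic operator is a rational
expression in `Δ` and a polynomial numerator (`sq_green_mul`), so the spectral measure of the site
vector has an explicit density, depending continuously in `L¹` on the potential at a fixed period
(`exists_siteMeasure_le_add`). Opening gaps near all rationals, with perturbations so small that the
spectral measures change by summable amounts, gives a limit whose spectrum has empty interior and
whose spectral measures remain absolutely continuous. Unit mass then forces positive Lebesgue
measure. -/

lemma measure_open_le_of_forall_lintegral_le_const {m : Measure ℝ} {O : Set ℝ} (hO : IsOpen O)
    {c : ℝ≥0∞} (h : ∀ g : C_c(ℝ, ℝ), (∀ x, 0 ≤ g x) → (∀ x, g x ≤ 1) → tsupport g ⊆ O →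
      ∫⁻ x, ENNReal.ofReal (g x) ∂m ≤ c) : m O ≤ c := by
  -- Exhausting `O` by compact sets and using continuity from below requires no regularity of `m`.
  obtain ⟨F, hFc, hFO, hFU, hFm⟩ := hO.exists_iUnion_isClosed
  have hK : ⋃ n : ℕ, F n ∩ Metric.closedBall 0 (n : ℝ) = O := by
    rw [← hFU]
    ext x
    simp only [Set.mem_iUnion, Set.mem_inter_iff]
    constructor
    · rintro ⟨n, h, -⟩
      exact ⟨n, h⟩
    · rintro ⟨n, h⟩
      obtain ⟨k, hk⟩ := exists_nat_ge ‖x‖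
      refine ⟨max n k, hFm (le_max_left _ _) h, ?_⟩
      rw [mem_closedBall_zero_iff]
      exact hk.trans (by exact_mod_cast le_max_right _ _)
  have hmono : Monotone fun n : ℕ => F n ∩ Metric.closedBall (0 : ℝ) n := by
    intro a b hab
    exact Set.inter_subset_inter (hFm hab) (Metric.closedBall_subset_closedBall (by exact_mod_cast hab))
  rw [← hK, hmono.measure_iUnion]
  refine iSup_le fun n => ?_
  have hcomp : IsCompact (F n ∩ Metric.closedBall (0 : ℝ) n) :=
    (isCompact_closedBall _ _).inter_left (hFc n)
  obtain ⟨W, hWo, hKW, hWO, hWc⟩ := exists_open_between_and_isCompact_closure hcomp hO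
    (Set.inter_subset_left.trans (hFO n))
  obtain ⟨f, hf1, hf0, hfc, hf⟩ := exists_continuous_one_zero_of_isCompact hcomp hWo.isClosed_compl
    (Set.disjoint_compl_right_iff_subset.2 hKW)
  have hts : tsupport f ⊆ O := by
    refine (closure_mono fun x hx => ?_).trans hWO
    by_contra hxW
    exact hx (hf0 hxW)
  refine le_trans ?_ (h ⟨f, hfc⟩ (fun x => (hf x).1) (fun x => (hf x).2) hts)
  rw [← lintegral_indicator_one hcomp.measurableSet]
  refine lintegral_mono fun x => ?_
  by_cases hx : x ∈ F n ∩ Metric.closedBall (0 : ℝ) n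
  · rw [Set.indicator_of_mem hx]
    change 1 ≤ ENNReal.ofReal (f x)
    rw [hf1 hx]
    simp
  · rw [Set.indicator_of_notMem hx]
    exact zero_le

lemma lintegral_le_measure_of_tsupport_subset (m : Measure ℝ) {O : Set ℝ} (hO : IsOpen O)
    (g : C_c(ℝ, ℝ)) (hg1 : ∀ x, g x ≤ 1) (hts : tsupport g ⊆ O) :
    ∫⁻ x, ENNReal.ofReal (g x) ∂m ≤ m O := by
  rw [← lintegral_indicator_one hO.measurableSet]
  refine lintegral_mono fun x => ?_
  by_cases hx : x ∈ O
  · rw [Set.indicator_of_mem hx]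
    exact ENNReal.ofReal_le_one.2 (hg1 x)
  · rw [Set.indicator_of_notMem hx, image_eq_zero_of_notMem_tsupport fun h => hx (hts h)]
    simp

lemma measure_open_le_of_forall_lintegral_le {m₁ m₂ : Measure ℝ} {O : Set ℝ} (hO : IsOpen O)
    (h : ∀ g : C_c(ℝ, ℝ), (∀ x, 0 ≤ g x) → (∀ x, g x ≤ 1) → tsupport g ⊆ O →
      ∫⁻ x, ENNReal.ofReal (g x) ∂m₁ ≤ ∫⁻ x, ENNReal.ofReal (g x) ∂m₂) : m₁ O ≤ m₂ O :=
  measure_open_le_of_forall_lintegral_le_const hO fun g h0 h1 hs =>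
    (h g h0 h1 hs).trans (lintegral_le_measure_of_tsupport_subset m₂ hO g h1 hs)

variable {H : Type*} [NormedAddCommGroup H] [InnerProductSpace ℂ H] [CompleteSpace H]

instance regular_spectralMeasure (A : H →L[ℂ] H) (hA : IsSelfAdjoint A) (ψ : H) :
    (spectralMeasure A hA ψ).Regular :=
  inferInstanceAs (RealRMK.rieszMeasure _).Regular

lemma lintegral_compactlySupported (m : Measure ℝ) [IsFiniteMeasureOnCompacts m] (g : C_c(ℝ, ℝ))
    (hg : ∀ x, 0 ≤ g x) :
    ∫⁻ x, ENNReal.ofReal (g x) ∂m = ENNReal.ofReal (∫ x, g x ∂m) :=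
  (ofReal_integral_eq_lintegral_ofReal
    (g.continuous.integrable_of_hasCompactSupport g.hasCompactSupport)
    (Eventually.of_forall hg)).symm

lemma spectralMeasure_compl_spectrum (A : H →L[ℂ] H) (hA : IsSelfAdjoint A) (ψ : H) :
    spectralMeasure A hA ψ (spectrum ℝ A)ᶜ = 0 := by
  have hcl : IsClosed (spectrum ℝ A) := spectrum.isClosed A
  refine le_antisymm ?_ zero_le
  refine (measure_open_le_of_forall_lintegral_le (m₂ := 0) hcl.isOpen_compl ?_).trans (by simp)
  intro g hg0 _ hgs
  rw [lintegral_compactlySupported _ _ hg0, integral_spectralMeasure]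
  have : cfc (g : ℝ → ℝ) A = 0 := by
    rw [← cfc_zero ℝ A]
    refine cfc_congr fun x hx => ?_
    exact image_eq_zero_of_notMem_tsupport fun h => hgs h hx
  simp [this]

lemma isCompact_spectrum_real (A : H →L[ℂ] H) : IsCompact (spectrum ℝ A) :=
  spectrum.isCompact A

instance isFiniteMeasure_spectralMeasure (A : H →L[ℂ] H) (hA : IsSelfAdjoint A) (ψ : H) :
    IsFiniteMeasure (spectralMeasure A hA ψ) := by
  refine ⟨?_⟩
  rw [← Set.union_compl_self (spectrum ℝ A)]
  refine (measure_union_le _ _).trans_lt ?_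
  rw [spectralMeasure_compl_spectrum, add_zero]
  exact (isCompact_spectrum_real A).measure_lt_top

/-- A cutoff equal to `1` on the compact spectrum changes neither side, so compact support of the
test function can be dropped. -/
lemma integral_spectralMeasure_of_continuous (A : H →L[ℂ] H) (hA : IsSelfAdjoint A) (ψ : H)
    {g : ℝ → ℝ} (hg : Continuous g) :
    ∫ x, g x ∂(spectralMeasure A hA ψ) = (⟪ψ, cfc g A ψ⟫_ℂ).re := by
  obtain ⟨f, hf1, -, hfc, -⟩ := exists_continuous_one_zero_of_isCompact (isCompact_spectrum_real A)
    isClosed_empty (Set.disjoint_empty _)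
  let G : C_c(ℝ, ℝ) := ⟨⟨fun x => f x * g x, f.continuous.mul hg⟩, hfc.mul_right⟩
  have hGg : Set.EqOn g G (spectrum ℝ A) := fun x hx => by
    change g x = f x * g x
    rw [hf1 hx]
    simp
  rw [cfc_congr hGg, ← integral_spectralMeasure A hA ψ G]
  refine integral_congr_ae ?_
  have : ∀ᵐ x ∂(spectralMeasure A hA ψ), x ∈ spectrum ℝ A :=
    mem_ae_iff.2 (spectralMeasure_compl_spectrum A hA ψ)
  filter_upwards [this] with x hx using hGg hx

/-- Self-adjointness of `g(A)` moves one factor of `g(A)²` across the inner product. Applied to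
`√g`, this turns norm inequalities into inequalities between measures. -/
lemma norm_sq_cfc_apply (A : H →L[ℂ] H) (hA : IsSelfAdjoint A) (ψ : H)
    {g : ℝ → ℝ} (hg : Continuous g) :
    ‖cfc g A ψ‖ ^ 2 = ∫ x, g x ^ 2 ∂(spectralMeasure A hA ψ) := by
  rw [integral_spectralMeasure_of_continuous A hA ψ (g := fun x => g x ^ 2) (hg.pow 2)]
  have h1 : cfc (fun x => g x ^ 2) A = cfc g A * cfc g A := by
    rw [← cfc_mul g g A hg.continuousOn hg.continuousOn]
    simp only [sq]
  have h2 : IsSelfAdjoint (cfc g A) := cfc_predicate g A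
  rw [ContinuousLinearMap.isSelfAdjoint_iff_isSymmetric] at h2
  rw [h1]
  change _ = (⟪ψ, cfc g A (cfc g A ψ)⟫_ℂ).re
  have h3 := h2 ψ (cfc g A ψ)
  change ⟪cfc g A ψ, cfc g A ψ⟫_ℂ = ⟪ψ, cfc g A (cfc g A ψ)⟫_ℂ at h3
  rw [← h3, inner_self_eq_norm_sq_to_K]
  norm_cast

lemma spectralMeasure_real_univ (A : H →L[ℂ] H) (hA : IsSelfAdjoint A) (ψ : H) :
    (spectralMeasure A hA ψ).real Set.univ = ‖ψ‖ ^ 2 := by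
  have h := norm_sq_cfc_apply A hA ψ (g := fun _ => 1) continuous_const
  rw [cfc_const_one ℝ A] at h
  simpa using h.symm

lemma measure_le_of_forall_isOpen {m₁ m₂ : Measure ℝ} [m₂.OuterRegular]
    (h : ∀ O, IsOpen O → m₁ O ≤ m₂ O) : m₁ ≤ m₂ := by
  refine Measure.le_iff.2 fun S _ => ?_
  rw [Set.measure_eq_iInf_isOpen S m₂]
  exact le_iInf₂ fun O hSO => le_iInf fun hO => (measure_mono hSO).trans (h O hO)

/-- This is `‖x + y‖² ≤ 2‖x‖² + 2‖y‖²` for the images of `φ` and `ψ` under `√g(A)`, with `g` an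
arbitrary test function. -/
lemma spectralMeasure_add_le (A : H →L[ℂ] H) (hA : IsSelfAdjoint A) (φ ψ : H) (S : Set ℝ) :
    spectralMeasure A hA (φ + ψ) S ≤
      2 * spectralMeasure A hA φ S + 2 * spectralMeasure A hA ψ S := by
  have key : spectralMeasure A hA (φ + ψ) ≤
      (2 : ℝ≥0∞) • spectralMeasure A hA φ + (2 : ℝ≥0∞) • spectralMeasure A hA ψ := by
    have : IsFiniteMeasure ((2 : ℝ≥0∞) • spectralMeasure A hA φ) :=
      Measure.smul_finite _ (by simp)
    have : IsFiniteMeasure ((2 : ℝ≥0∞) • spectralMeasure A hA ψ) :=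
      Measure.smul_finite _ (by simp)
    refine measure_le_of_forall_isOpen fun O hO =>
      measure_open_le_of_forall_lintegral_le hO fun g hg0 _ _ => ?_
    rw [lintegral_add_measure, lintegral_smul_measure, lintegral_smul_measure]
    simp only [lintegral_compactlySupported _ g hg0, smul_eq_mul]
    have h2 : (2 : ℝ≥0∞) = ENNReal.ofReal 2 := by simp
    rw [h2, ← ENNReal.ofReal_mul (by norm_num), ← ENNReal.ofReal_mul (by norm_num),
      ← ENNReal.ofReal_add]
    rotate_left
    · exact mul_nonneg (by norm_num) (integral_nonneg hg0)
    · exact mul_nonneg (by norm_num) (integral_nonneg hg0)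
    refine ENNReal.ofReal_le_ofReal ?_
    have hc : Continuous fun x => Real.sqrt (g x) := g.continuous.sqrt
    have e : ∀ χ : H, ∫ x, g x ∂(spectralMeasure A hA χ) =
        ‖cfc (fun x => Real.sqrt (g x)) A χ‖ ^ 2 := fun χ => by
      rw [norm_sq_cfc_apply A hA χ hc]
      simp only [Real.sq_sqrt (hg0 _)]
    rw [e, e, e, map_add]
    have h3 := norm_add_le (cfc (fun x => Real.sqrt (g x)) A φ) (cfc (fun x => Real.sqrt (g x)) A ψ)
    have h4 := norm_nonneg (cfc (fun x => Real.sqrt (g x)) A φ + cfc (fun x => Real.sqrt (g x)) A ψ)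
    nlinarith [sq_nonneg (‖cfc (fun x => Real.sqrt (g x)) A φ‖ -
      ‖cfc (fun x => Real.sqrt (g x)) A ψ‖)]
  simpa using Measure.le_iff'.1 key S

lemma spectralMeasure_smul_le (A : H →L[ℂ] H) (hA : IsSelfAdjoint A) (c : ℂ) (ψ : H) (S : Set ℝ) :
    spectralMeasure A hA (c • ψ) S ≤ ENNReal.ofReal (‖c‖ ^ 2) * spectralMeasure A hA ψ S := by
  have key : spectralMeasure A hA (c • ψ) ≤
      (ENNReal.ofReal (‖c‖ ^ 2)) • spectralMeasure A hA ψ := by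
    have : IsFiniteMeasure (ENNReal.ofReal (‖c‖ ^ 2) • spectralMeasure A hA ψ) :=
      Measure.smul_finite _ (by simp)
    refine measure_le_of_forall_isOpen fun O hO =>
      measure_open_le_of_forall_lintegral_le hO fun g hg0 _ _ => ?_
    rw [lintegral_smul_measure]
    simp only [lintegral_compactlySupported _ g hg0, smul_eq_mul]
    rw [← ENNReal.ofReal_mul (by positivity)]
    refine ENNReal.ofReal_le_ofReal (le_of_eq ?_)
    have hc : Continuous fun x => Real.sqrt (g x) := g.continuous.sqrt
    have e : ∀ χ : H, ∫ x, g x ∂(spectralMeasure A hA χ) =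
        ‖cfc (fun x => Real.sqrt (g x)) A χ‖ ^ 2 := fun χ => by
      rw [norm_sq_cfc_apply A hA χ hc]
      simp only [Real.sq_sqrt (hg0 _)]
    rw [e, e, map_smul, norm_smul, mul_pow]
  simpa using Measure.le_iff'.1 key S

/-- The vectors with absolutely continuous spectral measure form a closed subspace. -/
noncomputable def acSubmodule (A : H →L[ℂ] H) (hA : IsSelfAdjoint A) : Submodule ℂ H where
  carrier := {ψ | spectralMeasure A hA ψ ≪ volume}
  add_mem' := fun {φ ψ} hφ hψ => Measure.AbsolutelyContinuous.mk fun S _ hS => by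
    refine le_antisymm ((spectralMeasure_add_le A hA φ ψ S).trans ?_) zero_le
    simp [hφ hS, hψ hS]
  zero_mem' := Measure.AbsolutelyContinuous.mk fun S _ _ => by
    refine le_antisymm ?_ zero_le
    have := spectralMeasure_smul_le A hA 0 (0 : H) S
    simpa using this
  smul_mem' := fun c ψ hψ => Measure.AbsolutelyContinuous.mk fun S _ hS => by
    refine le_antisymm ((spectralMeasure_smul_le A hA c ψ S).trans ?_) zero_le
    simp [hψ hS]

lemma spectralMeasure_le_norm_sq (A : H →L[ℂ] H) (hA : IsSelfAdjoint A) (ψ : H) (S : Set ℝ) :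
    spectralMeasure A hA ψ S ≤ ENNReal.ofReal (‖ψ‖ ^ 2) := by
  rw [← spectralMeasure_real_univ A hA ψ, ofReal_measureReal]
  exact measure_mono (Set.subset_univ _)

/-- The error vector `ψ - φ` contributes at most twice its total mass `‖ψ - φ‖²`. -/
lemma measure_eq_zero_of_approx (A : H →L[ℂ] H) (hA : IsSelfAdjoint A) (ψ : H) (S : Set ℝ)
    (h : ∀ ε > 0, ∃ φ : H, ‖ψ - φ‖ < ε ∧ spectralMeasure A hA φ S = 0) :
    spectralMeasure A hA ψ S = 0 := by
  refine le_antisymm (ENNReal.le_of_forall_pos_le_add fun ε hε _ => ?_) zero_le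
  rw [zero_add]
  obtain ⟨φ, hφ, h0⟩ := h (Real.sqrt (ε / 2)) (Real.sqrt_pos.2 (by positivity))
  have h1 := spectralMeasure_add_le A hA φ (ψ - φ) S
  rw [add_sub_cancel, h0, mul_zero, zero_add] at h1
  refine h1.trans ((mul_le_mul_right (spectralMeasure_le_norm_sq A hA (ψ - φ) S) 2).trans ?_)
  have h2 : (2 : ℝ≥0∞) = ENNReal.ofReal 2 := by simp
  rw [h2, ← ENNReal.ofReal_mul (by norm_num), ← ENNReal.ofReal_coe_nnreal]
  refine ENNReal.ofReal_le_ofReal ?_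
  have h3 : ‖ψ - φ‖ ^ 2 ≤ ε / 2 := by
    rw [← Real.sq_sqrt (show (0 : ℝ) ≤ ε / 2 by positivity)]
    exact pow_le_pow_left₀ (norm_nonneg _) hφ.le 2
  change 2 * ‖ψ - φ‖ ^ 2 ≤ (ε : ℝ)
  linarith

lemma isClosed_acSubmodule (A : H →L[ℂ] H) (hA : IsSelfAdjoint A) :
    IsClosed (acSubmodule A hA : Set H) := by
  refine isClosed_of_closure_subset fun ψ hψ => Measure.AbsolutelyContinuous.mk fun S _ hS => ?_
  refine measure_eq_zero_of_approx A hA ψ S fun ε hε => ?_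
  obtain ⟨φ, hφ, hd⟩ := Metric.mem_closure_iff.1 hψ ε hε
  exact ⟨φ, by rwa [← dist_eq_norm], hφ hS⟩

/-- An atom of a spectral measure is an eigenvalue. -/
lemma spectralMeasure_singleton_eq_zero (A : H →L[ℂ] H) (hA : IsSelfAdjoint A) (E : ℝ)
    (hE : ∀ φ : H, A φ = (E : ℂ) • φ → φ = 0) (ψ : H) : spectralMeasure A hA ψ {E} = 0 := by
  set B : H →L[ℂ] H := A - (E : ℂ) • 1 with hB
  have hBs : IsSelfAdjoint B := by
    refine hA.sub (IsSelfAdjoint.smul ?_ (IsSelfAdjoint.one _))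
    rw [isSelfAdjoint_iff, Complex.star_def, Complex.conj_ofReal]
  have hcfc : B = cfc (fun x : ℝ => x - E) A := by
    rw [cfc_sub (fun x : ℝ => x) (fun _ => E) A, cfc_id' ℝ A, cfc_const E A, hB]
    congr 1
  have hker : LinearMap.ker B.toLinearMap = ⊥ := by
    refine LinearMap.ker_eq_bot'.2 fun φ hφ => hE φ ?_
    have : A φ - (E : ℂ) • φ = 0 := hφ
    exact sub_eq_zero.1 this
  -- An injective self-adjoint operator has dense range, so it suffices to treat vectors `B χ`.
  have hdense : Dense (LinearMap.range B.toLinearMap : Set H) := by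
    refine (Submodule.dense_iff_topologicalClosure_eq_top).2 ?_
    rw [Submodule.topologicalClosure_eq_top_iff]
    have h1 := ContinuousLinearMap.orthogonal_range B
    rw [hBs.adjoint_eq] at h1
    exact h1.trans hker
  refine measure_eq_zero_of_approx A hA ψ _ fun ε hε => ?_
  obtain ⟨φ, hφ, hd⟩ := Metric.mem_closure_iff.1 (hdense ψ) ε hε
  obtain ⟨χ, rfl⟩ := hφ
  refine ⟨_, by rwa [← dist_eq_norm], ?_⟩
  have hbound : ∀ δ : ℝ, 0 < δ →
      spectralMeasure A hA (B χ) {E} ≤ ENNReal.ofReal ((δ * ‖χ‖) ^ 2) := by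
    intro δ hδ
    -- A hat of height one and width `δ` at `E`: it dominates the indicator of `{E}`, while `|g x *
    -- (x - E)| ≤ δ` makes `g(A) B` small.
    set g : ℝ → ℝ := fun x => max 0 (1 - |x - E| / δ) with hgdef
    have hg : Continuous g := by fun_prop
    have hg1 : ∀ x, |g x| ≤ 1 := fun x => by
      rw [abs_of_nonneg (le_max_left _ _)]
      exact max_le zero_le_one (by linarith [div_nonneg (abs_nonneg (x - E)) hδ.le])
    have h1 : spectralMeasure A hA (B χ) {E} ≤
        ENNReal.ofReal (∫ x, g x ^ 2 ∂(spectralMeasure A hA (B χ))) := by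
      rw [ofReal_integral_eq_lintegral_ofReal _ (Eventually.of_forall fun x => sq_nonneg _),
        ← lintegral_indicator_one (measurableSet_singleton E)]
      · refine lintegral_mono fun x => ?_
        by_cases hx : x = E
        · subst hx
          simp [hgdef]
        · rw [Set.indicator_of_notMem (by simpa using hx)]
          exact zero_le
      · refine Integrable.of_bound (hg.pow 2).aestronglyMeasurable 1 (Eventually.of_forall fun x => ?_)
        rw [Real.norm_eq_abs, abs_pow]
        exact pow_le_one₀ (abs_nonneg _) (hg1 x)
    refine h1.trans (ENNReal.ofReal_le_ofReal ?_)
    rw [← norm_sq_cfc_apply A hA _ hg]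
    refine pow_le_pow_left₀ (norm_nonneg _) ?_ 2
    have h2 : cfc g A (B χ) = cfc (fun x => g x * (x - E)) A χ := by
      rw [cfc_mul g (fun x => x - E) A, ← hcfc]
      rfl
    rw [h2]
    refine (ContinuousLinearMap.le_opNorm _ _).trans
      (mul_le_mul_of_nonneg_right (norm_cfc_le hδ.le fun x _ => ?_) (norm_nonneg _))
    rw [norm_mul, Real.norm_eq_abs, Real.norm_eq_abs]
    by_cases hx : |x - E| ≤ δ
    · calc |g x| * |x - E| ≤ 1 * δ := mul_le_mul (hg1 x) hx (abs_nonneg _) zero_le_one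
        _ = δ := one_mul δ
    · push Not at hx
      have : g x = 0 := max_eq_left (by linarith [(one_lt_div hδ).2 hx])
      rw [this, abs_zero, zero_mul]
      exact hδ.le
  have hlim : Tendsto (fun δ : ℝ => ENNReal.ofReal ((δ * ‖χ‖) ^ 2)) (𝓝[>] 0) (𝓝 0) := by
    have : Continuous fun δ : ℝ => ENNReal.ofReal ((δ * ‖χ‖) ^ 2) :=
      ENNReal.continuous_ofReal.comp (by fun_prop)
    have h3 := (this.tendsto 0).mono_left (nhdsWithin_le_nhds (s := Set.Ioi 0))
    simpa using h3
  refine le_antisymm (ge_of_tendsto hlim ?_) zero_le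
  filter_upwards [self_mem_nhdsWithin] with δ hδ using hbound δ hδ

/-- A hat function `g` seeing only the isolated point `E` of the spectrum satisfies `(A - E) g(A) =
0`, and `g(A) ≠ 0` because `g E = 1` lies in its spectrum. The range of `g(A)` therefore consists of
solutions of the eigenvalue equation. -/
lemma exists_eigenvector_of_not_accPt (A : H →L[ℂ] H) (hA : IsSelfAdjoint A) (E : ℝ)
    (hE : E ∈ spectrum ℝ A) (hacc : ¬ AccPt E (𝓟 (spectrum ℝ A))) :
    ∃ φ : H, φ ≠ 0 ∧ A φ = (E : ℂ) • φ := by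
  rw [accPt_iff_nhds] at hacc
  push Not at hacc
  obtain ⟨U, hU, hUE⟩ := hacc
  obtain ⟨ε, hε, hball⟩ := Metric.mem_nhds_iff.1 hU
  set g : ℝ → ℝ := fun x => max 0 (1 - |x - E| / ε) with hgdef
  have hg : Continuous g := by fun_prop
  have hgE : g E = 1 := by simp [hgdef]
  have hg0 : ∀ x ∈ spectrum ℝ A, (x - E) * g x = 0 := by
    intro x hx
    by_cases hxE : x = E
    · simp [hxE]
    · have : ε ≤ |x - E| := by
        by_contra hlt
        push Not at hlt
        exact hxE (hUE x ⟨hball (by rwa [Metric.mem_ball, Real.dist_eq]), hx⟩)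
      have h1 : 1 ≤ |x - E| / ε := (one_le_div hε).2 this
      have : g x = 0 := max_eq_left (by linarith)
      rw [this, mul_zero]
  have hne : cfc g A ≠ 0 := by
    intro h0
    have h1 := cfc_map_spectrum g A
    have h2 : (1 : ℝ) ∈ spectrum ℝ (cfc g A) := by
      rw [h1]
      exact ⟨E, hE, hgE⟩
    have : Nontrivial (H →L[ℂ] H) := by
      by_contra hn
      rw [not_nontrivial_iff_subsingleton] at hn
      simp [spectrum.of_subsingleton] at hE
    rw [h0, spectrum.zero_eq] at h2
    simp at h2
  obtain ⟨ψ, hψ⟩ : ∃ ψ, cfc g A ψ ≠ 0 := by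
    by_contra hall
    push Not at hall
    exact hne (ContinuousLinearMap.ext hall)
  refine ⟨cfc g A ψ, hψ, ?_⟩
  have h1 : cfc (fun x : ℝ => (x - E) * g x) A = 0 := by
    rw [← cfc_zero ℝ A]
    exact cfc_congr hg0
  rw [cfc_mul (fun x : ℝ => x - E) g A, cfc_sub (fun x : ℝ => x) (fun _ => E) A, cfc_id' ℝ A,
    cfc_const E A, Algebra.algebraMap_eq_smul_one] at h1
  have h2 := congrArg (fun B : H →L[ℂ] H => B ψ) h1
  simp only [mul_apply_eq_comp, sub_apply] at h2
  have := sub_eq_zero.1 h2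
  rw [this]
  simp

/-- Otherwise the resolvent `R` of `B` at `E` has norm below `‖A - B‖⁻¹`, and `E - A = (E - B)(1 -
R(A - B))` is invertible by a Neumann series. -/
lemma exists_spectrum_near (A B : H →L[ℂ] H) (hB : IsSelfAdjoint B) {E : ℝ}
    (hE : E ∈ spectrum ℝ A) : ∃ E' ∈ spectrum ℝ B, |E - E'| ≤ ‖A - B‖ := by
  by_contra hcon
  push Not at hcon
  have hEB : E ∉ spectrum ℝ B := fun h => by
    have := hcon E h
    simp only [sub_self, abs_zero] at this
    exact absurd this (not_lt.2 (norm_nonneg _))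
  by_cases hd : ‖A - B‖ = 0
  · rw [norm_eq_zero, sub_eq_zero] at hd
    exact hEB (hd ▸ hE)
  have hd0 : 0 < ‖A - B‖ := lt_of_le_of_ne (norm_nonneg _) (Ne.symm hd)
  have hne : ∀ x ∈ spectrum ℝ B, E - x ≠ 0 := fun x hx h => by
    rw [sub_eq_zero] at h
    exact hEB (h ▸ hx)
  have hco : ContinuousOn (fun x : ℝ => (E - x)⁻¹) (spectrum ℝ B) :=
    ContinuousOn.inv₀ (by fun_prop) hne
  set R := cfc (fun x : ℝ => (E - x)⁻¹) B with hR
  have hRn : ‖R‖ < ‖A - B‖⁻¹ := by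
    refine norm_cfc_lt (by positivity) fun x hx => ?_
    rw [norm_inv, Real.norm_eq_abs]
    exact inv_strictAnti₀ hd0 (hcon x hx)
  have hEBc : algebraMap ℝ (H →L[ℂ] H) E - B = cfc (fun x : ℝ => E - x) B := by
    rw [cfc_sub (fun _ : ℝ => E) (fun x : ℝ => x) B, cfc_id' ℝ B, cfc_const E B]
  have h1 : (algebraMap ℝ (H →L[ℂ] H) E - B) * R = 1 := by
    rw [hEBc, hR, ← cfc_mul (fun x : ℝ => E - x) _ B (by fun_prop) hco, ← cfc_const_one ℝ B]
    exact cfc_congr fun x hx => mul_inv_cancel₀ (hne x hx)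
  have hu1 : IsUnit (algebraMap ℝ (H →L[ℂ] H) E - B) := by
    rw [hEBc]
    exact isUnit_cfc (fun x : ℝ => E - x) B (by fun_prop) hB hne
  have hu2 : IsUnit (1 - R * (A - B)) := by
    refine isUnit_one_sub_of_norm_lt_one ?_
    refine (norm_mul_le _ _).trans_lt ?_
    have := mul_lt_mul_of_pos_right hRn hd0
    rwa [inv_mul_cancel₀ hd] at this
  refine hE ?_
  rw [spectrum.mem_resolventSet_iff]
  have : algebraMap ℝ (H →L[ℂ] H) E - A =
      (algebraMap ℝ (H →L[ℂ] H) E - B) * (1 - R * (A - B)) := by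
    rw [mul_sub, ← mul_assoc, h1, mul_one, one_mul]
    abel
  rw [this]
  exact hu1.mul hu2

/-- Norm convergence of operators passes to `g(A j)`, hence to integrals of test functions; mass of
open sets is lower semicontinuous under such convergence. -/
lemma spectralMeasure_open_le_of_tendsto {A : ℕ → H →L[ℂ] H} {B : H →L[ℂ] H}
    (hA : ∀ j, IsSelfAdjoint (A j)) (hB : IsSelfAdjoint B) (hlim : Tendsto A atTop (𝓝 B)) (ψ : H)
    {O : Set ℝ} (hO : IsOpen O) {c : ℝ≥0∞}
    (hc : ∀ᶠ j in atTop, spectralMeasure (A j) (hA j) ψ O ≤ c) : spectralMeasure B hB ψ O ≤ c := by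
  refine measure_open_le_of_forall_lintegral_le_const hO fun g hg0 hg1 hs => ?_
  have hn : ‖(1 : H →L[ℂ] H)‖ ≤ 1 := ContinuousLinearMap.norm_id_le
  have hcfc : Tendsto (fun j => cfc (g : ℝ → ℝ) (A j)) atTop (𝓝 (cfc (g : ℝ → ℝ) B)) := by
    refine Filter.Tendsto.cfc (s := Metric.closedBall 0 (‖B‖ + 1)) (isCompact_closedBall _ _)
      (g : ℝ → ℝ) hlim ?_ (Eventually.of_forall hA) ?_ hB g.continuous.continuousOn
    · filter_upwards [hlim.norm.eventually (gt_mem_nhds (lt_add_one ‖B‖))] with j hj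
      exact (spectrum.subset_closedBall_norm_mul (A j)).trans
        (Metric.closedBall_subset_closedBall (by nlinarith [norm_nonneg (A j), hn]))
    · exact (spectrum.subset_closedBall_norm_mul B).trans
        (Metric.closedBall_subset_closedBall (by nlinarith [norm_nonneg B, hn]))
  have hint : Tendsto (fun j => ∫⁻ x, ENNReal.ofReal (g x) ∂(spectralMeasure (A j) (hA j) ψ)) atTop
      (𝓝 (∫⁻ x, ENNReal.ofReal (g x) ∂(spectralMeasure B hB ψ))) := by
    simp only [lintegral_compactlySupported _ g hg0, integral_spectralMeasure]
    refine (ENNReal.continuous_ofReal.tendsto _).comp ?_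
    have hc : Continuous fun D : H →L[ℂ] H => (⟪ψ, D ψ⟫_ℂ).re := by fun_prop
    exact (hc.tendsto _).comp hcfc
  refine le_of_tendsto hint ?_
  filter_upwards [hc] with j hj
  exact (lintegral_le_measure_of_tsupport_subset _ hO g hg1 hs).trans hj

end SpectralTheory

/-! ### Transfer matrices and the discriminant. -/

section TransferMatrix

open Polynomial Matrix

/-- One-step transfer matrix of a second order difference equation. -/
def stepMatrix {R : Type*} [CommRing R] (x : R) : Matrix (Fin 2) (Fin 2) R := !![x, -1; 1, 0]

/-- The transfer matrix across the `n` sites `m, …, m + n - 1`. -/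
def transfer {R : Type*} [CommRing R] (w : ℤ → R) (m : ℤ) : ℕ → Matrix (Fin 2) (Fin 2) R
  | 0 => 1
  | n + 1 => stepMatrix (w (m + n)) * transfer w m n

section Algebra

variable {R : Type*} [CommRing R] (w : ℤ → R) (m : ℤ)

@[simp] lemma transfer_zero : transfer w m 0 = 1 := rfl

lemma transfer_succ (n : ℕ) :
    transfer w m (n + 1) = stepMatrix (w (m + n)) * transfer w m n := rfl

lemma det_stepMatrix (x : R) : (stepMatrix x).det = 1 := by
  simp [stepMatrix, Matrix.det_fin_two]

lemma det_transfer (n : ℕ) : (transfer w m n).det = 1 := by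
  induction n with
  | zero => simp
  | succ n ih => rw [transfer_succ, Matrix.det_mul, det_stepMatrix, ih, one_mul]

lemma transfer_add (a b : ℕ) :
    transfer w m (a + b) = transfer w (m + a) b * transfer w m a := by
  induction b with
  | zero => simp
  | succ b ih =>
    rw [← add_assoc, transfer_succ, ih, transfer_succ, ← mul_assoc]
    push_cast
    rw [add_assoc]

variable {w m} in
lemma transfer_congr {w' : ℤ → R} {m' : ℤ} {n : ℕ} (h : ∀ k : ℕ, k < n → w (m + k) = w' (m' + k)) :
    transfer w m n = transfer w' m' n := by
  induction n with
  | zero => simp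
  | succ n ih =>
    rw [transfer_succ, transfer_succ, h n (Nat.lt_succ_self n),
      ih fun k hk => h k (hk.trans (Nat.lt_succ_self n))]

lemma transfer_map {R' : Type*} [CommRing R'] (f : R →+* R') (n : ℕ) :
    (transfer w m n).map f = transfer (fun k => f (w k)) m n := by
  induction n with
  | zero => simp
  | succ n ih =>
    rw [transfer_succ, transfer_succ, Matrix.map_mul, ih]
    congr 1
    ext i j
    fin_cases i <;> fin_cases j <;> simp [stepMatrix]

variable {w}

lemma transfer_add_period {N : ℕ} (hw : ∀ k, w (k + N) = w k) (n : ℕ) :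
    transfer w (m + N) n = transfer w m n :=
  transfer_congr fun k _ => by rw [add_right_comm, hw]

lemma transfer_conj {N : ℕ} (hw : ∀ k, w (k + N) = w k) (k : ℕ) :
    transfer w (m + k) N * transfer w m k = transfer w m k * transfer w m N := by
  rw [← transfer_add, add_comm, transfer_add, transfer_add_period m hw]

lemma transfer_period_eq {N : ℕ} (hw : ∀ k, w (k + N) = w k) (k : ℕ) :
    transfer w (m + k) N = transfer w m k * transfer w m N * (transfer w m k).adjugate := by
  rw [← transfer_conj m hw, mul_assoc, Matrix.mul_adjugate, det_transfer, one_smul, mul_one]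

lemma trace_transfer_add {N : ℕ} (hw : ∀ k, w (k + N) = w k) (k : ℕ) :
    (transfer w (m + k) N).trace = (transfer w m N).trace := by
  rw [transfer_period_eq m hw, Matrix.trace_mul_comm, ← mul_assoc, Matrix.adjugate_mul,
    det_transfer, one_smul, one_mul]

/-- Monodromy matrices with different base points are conjugate. -/
lemma trace_transfer {N : ℕ} (hw : ∀ k, w (k + N) = w k) :
    (transfer w m N).trace = (transfer w 0 N).trace := by
  rcases le_total 0 m with h | h
  · lift m to ℕ using h
    simpa using trace_transfer_add 0 hw m
  · obtain ⟨k, hk⟩ := Int.exists_eq_neg_ofNat h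
    have := trace_transfer_add m hw k
    rw [← this, hk]
    simp

lemma transfer_mul_period {N : ℕ} (hw : ∀ k, w (k + N) = w k) (t : ℕ) :
    transfer w m (N * t) = transfer w m N ^ t := by
  induction t with
  | zero => simp
  | succ t ih =>
    rw [mul_add, mul_one, add_comm, transfer_add, transfer_add_period m hw, ih, pow_succ]

lemma sq_eq_of_det_eq_one (M : Matrix (Fin 2) (Fin 2) R) (h : M.det = 1) :
    M * M = M.trace • M - 1 := by
  rw [Matrix.det_fin_two] at h
  ext i j
  fin_cases i <;> fin_cases j <;>
    simp [Matrix.mul_apply, Fin.sum_univ_two, Matrix.trace_fin_two] <;>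
    first | ring1 | linear_combination -h

end Algebra

/-- The discriminant of an `N`-periodic potential, as a polynomial in the energy. -/
noncomputable def discriminant (v : ℤ → ℝ) (N : ℕ) : ℝ[X] :=
  (transfer (fun k => (X : ℝ[X]) - C (v k)) 0 N).trace

lemma trace_map_transfer {R R' : Type*} [CommRing R] [CommRing R'] (w : ℤ → R) (m : ℤ)
    (f : R →+* R') (n : ℕ) :
    f (transfer w m n).trace = (transfer (fun k => f (w k)) m n).trace := by
  rw [← transfer_map, AddMonoidHom.map_trace]

lemma eval_discriminant (v : ℤ → ℝ) (N : ℕ) (E : ℝ) :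
    (discriminant v N).eval E = (transfer (fun k => E - v k) 0 N).trace := by
  rw [discriminant, ← Polynomial.coe_evalRingHom, trace_map_transfer]
  simp

/-- A real potential acts on the coefficients of an operator polynomial. -/
lemma transfer_aeval_apply (V : ℓ^∞(ℤ, ℝ)) (m : ℤ) (n : ℕ) (ψ : ℓ^2(ℤ, ℂ)) :
    let T := transfer (fun k => (X : ℝ[X]) - C (V k)) m n
    ψ (m + n) = aeval (schrodinger V) (T 0 0) ψ m + aeval (schrodinger V) (T 0 1) ψ (m - 1) ∧
    ψ (m + n - 1) = aeval (schrodinger V) (T 1 0) ψ m + aeval (schrodinger V) (T 1 1) ψ (m - 1) := by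
  intro T
  -- The identity `ψ (n + 1) = (Hψ) n - V n * ψ n - ψ (n - 1)` is the eigenvalue recursion with the
  -- energy replaced by `H`. A factor `X` replaces `ψ` by `Hψ`, so the induction must range over all
  -- `ψ`.
  induction n generalizing ψ with
  | zero => simp [T]
  | succ n ih =>
    set T₀ := transfer (fun k => (X : ℝ[X]) - C (V k)) m n with hT₀
    have e : T = stepMatrix (X - C (V (m + n))) * T₀ := rfl
    have e0 : ∀ j, T 0 j = (X - C (V (m + n))) * T₀ 0 j - T₀ 1 j := fun j => by
      rw [e]
      simp [stepMatrix, Matrix.mul_apply, Fin.sum_univ_two, sub_eq_add_neg]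
    have e1 : ∀ j, T 1 j = T₀ 0 j := fun j => by
      rw [e]
      simp [stepMatrix, Matrix.mul_apply, Fin.sum_univ_two]
    constructor
    · obtain ⟨h1, h2⟩ := ih ψ
      obtain ⟨h3, -⟩ := ih (schrodinger V ψ)
      have h4 := schrodinger_apply V ψ (m + n)
      have key : ∀ j k, aeval (schrodinger V) (T 0 j) ψ k =
          aeval (schrodinger V) (T₀ 0 j) (schrodinger V ψ) k
          - V (m + n) * aeval (schrodinger V) (T₀ 0 j) ψ k
          - aeval (schrodinger V) (T₀ 1 j) ψ k := by
        intro j k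
        rw [e0, sub_mul, mul_comm X]
        simp only [map_sub, map_mul, aeval_X, aeval_C]
        simp
        rfl
      rw [key, key]
      have h5 : ψ (m + ((n + 1 : ℕ) : ℤ)) = schrodinger V ψ (m + n) - V (m + n) * ψ (m + n)
          - ψ (m + n - 1) := by
        rw [h4]
        push_cast
        rw [← add_assoc]
        ring
      rw [h5, h3, h1, h2]
      ring
    · have h3 : m + ((n + 1 : ℕ) : ℤ) - 1 = m + n := by
        push_cast
        ring
      rw [e1, e1, ← (ih ψ).1, h3]

/-- The discriminant of a periodic Schrödinger operator, evaluated at the operator. -/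
lemma aeval_discriminant (V : ℓ^∞(ℤ, ℝ)) {N : ℕ} (hV : ∀ k, V (k + N) = V k) :
    aeval (schrodinger V) (discriminant V N) = lpShift N + lpShift (-N) := by
  have hw : ∀ k, (fun k => (X : ℝ[X]) - C (V k)) (k + N) = (fun k => (X : ℝ[X]) - C (V k)) k := by
    intro k
    simp only [hV]
  ext ψ m
  set w := fun k => (X : ℝ[X]) - C (V k) with hwdef
  set T := transfer w (m - N) N with hT
  have htr : T.trace = discriminant V N := trace_transfer _ hw
  -- Cayley–Hamilton over two periods: crossing from `m - N` to `m + N` is `Δ T - 1`. The term `Δ T`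
  -- applied to `ψ` is the crossing from `m - N` to `m` applied to `Δ(H)ψ`, which yields
  -- `(Δ(H)ψ)(m)`.
  have hTT : transfer w (m - N) (N + N) = discriminant V N • T - 1 := by
    rw [transfer_add, transfer_add_period _ hw, ← hT, sq_eq_of_det_eq_one _ (det_transfer _ _ _), htr]
  have h1 := (transfer_aeval_apply V (m - N) (N + N) ψ).1
  have h2 := (transfer_aeval_apply V (m - N) N (aeval (schrodinger V) (discriminant V N) ψ)).1
  simp only [← hwdef, hTT, ← hT] at h1 h2
  have e : ∀ P : ℝ[X], aeval (schrodinger V) (discriminant V N * P) ψ =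
      aeval (schrodinger V) P (aeval (schrodinger V) (discriminant V N) ψ) := fun P => by
    rw [mul_comm, map_mul]
    rfl
  simp only [Matrix.sub_apply, Matrix.smul_apply, smul_eq_mul, map_sub, Matrix.one_apply_eq,
    Matrix.one_apply_ne (show (0 : Fin 2) ≠ 1 by decide), map_one, sub_zero,
    _root_.sub_apply, e, lp.coeFn_sub, Pi.sub_apply] at h1
  change _ = ψ (m + N) + ψ (m + -N)
  have h3 : m - N + ((N + N : ℕ) : ℤ) = m + N := by push_cast; ring
  rw [h3] at h1
  rw [sub_add_cancel] at h2
  rw [h2, h1, ← sub_eq_add_neg]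
  change _ = _ - ψ (m - N) + _ + ψ (m - N)
  ring

lemma norm_lpShift_le (m : ℤ) : ‖lpShift m‖ ≤ 1 :=
  LinearMap.mkContinuous_norm_le _ zero_le_one _

/-- Spectral mapping sends `E` into the spectrum of a sum of two contractions. -/
lemma abs_eval_discriminant_le (V : ℓ^∞(ℤ, ℝ)) {N : ℕ} (hV : ∀ k, V (k + N) = V k) {E : ℝ}
    (hE : E ∈ spectrum ℝ (schrodinger V)) : |(discriminant V N).eval E| ≤ 2 := by
  have h1 := spectrum.subset_polynomial_aeval (schrodinger V) (discriminant V N) ⟨E, hE, rfl⟩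
  rw [aeval_discriminant V hV] at h1
  have h2 := spectrum.subset_closedBall_norm_mul _ h1
  rw [mem_closedBall_zero_iff, Real.norm_eq_abs] at h2
  refine h2.trans ?_
  have h3 : ‖lpShift N + lpShift (-N)‖ ≤ 2 :=
    (norm_add_le _ _).trans (by linarith [norm_lpShift_le N, norm_lpShift_le (-N)])
  have h4 : ‖(1 : ℓ^2(ℤ, ℂ) →L[ℂ] ℓ^2(ℤ, ℂ))‖ ≤ 1 := ContinuousLinearMap.norm_id_le
  calc _ ≤ (2 : ℝ) * 1 := mul_le_mul h3 h4 (norm_nonneg _) (by norm_num)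
    _ = 2 := by norm_num

end TransferMatrix

/-! ### Gordon's criterion for absence of eigenvalues. -/

section Gordon

open Matrix Filter Topology
open scoped Matrix.Norms.Operator

/-- A sequence with arbitrarily long almost-periods of superexponential precision. -/
def IsGordon (v : ℤ → ℝ) : Prop :=
  ∀ k : ℕ, ∃ q : ℕ, k ≤ q ∧ ∀ n : ℤ, |v (n + q) - v n| ≤ ((k : ℝ) + 1)⁻¹ ^ q

lemma norm_fin_two_le (M : Matrix (Fin 2) (Fin 2) ℂ) {c : ℝ}
    (h0 : ‖M 0 0‖ + ‖M 0 1‖ ≤ c) (h1 : ‖M 1 0‖ + ‖M 1 1‖ ≤ c) : ‖M‖ ≤ c := by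
  have hc : 0 ≤ c := le_trans (by positivity) h0
  rw [Matrix.linfty_opNorm_def]
  lift c to NNReal using hc
  norm_cast
  refine Finset.sup_le fun i _ => ?_
  fin_cases i
  · simpa [Fin.sum_univ_two, ← NNReal.coe_le_coe] using h0
  · simpa [Fin.sum_univ_two, ← NNReal.coe_le_coe] using h1

lemma norm_stepMatrix_le (x : ℂ) : ‖stepMatrix x‖ ≤ ‖x‖ + 1 :=
  norm_fin_two_le _ (by simp [stepMatrix]) (by simp [stepMatrix])

lemma norm_stepMatrix_sub_le (x y : ℂ) : ‖stepMatrix x - stepMatrix y‖ ≤ ‖x - y‖ :=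
  norm_fin_two_le _ (by simp [stepMatrix]) (by simp [stepMatrix])

lemma norm_transfer_le {w : ℤ → ℂ} {c : ℝ} (hc : ∀ k, ‖w k‖ + 1 ≤ c) (m : ℤ) (n : ℕ) :
    ‖transfer w m n‖ ≤ c ^ n := by
  induction n with
  | zero => exact norm_fin_two_le _ (by simp) (by simp)
  | succ n ih =>
    rw [transfer_succ, pow_succ']
    exact (norm_mul_le _ _).trans (mul_le_mul ((norm_stepMatrix_le _).trans (hc _)) ih
      (norm_nonneg _) (le_trans (by positivity) (hc 0)))

lemma norm_transfer_sub_le {w : ℤ → ℂ} {c δ : ℝ} (hc : ∀ k, ‖w k‖ + 1 ≤ c) (m m' : ℤ) (n : ℕ)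
    (hδ : ∀ k : ℕ, ‖w (m + k) - w (m' + k)‖ ≤ δ) :
    ‖transfer w m n - transfer w m' n‖ ≤ n * c ^ n * δ := by
  have hc1 : 1 ≤ c := le_trans (by simp) (hc 0)
  have hδ0 : 0 ≤ δ := (norm_nonneg _).trans (hδ 0)
  induction n with
  | zero => simp
  | succ n ih =>
    have e : transfer w m (n + 1) - transfer w m' (n + 1) =
        (stepMatrix (w (m + n)) - stepMatrix (w (m' + n))) * transfer w m n +
        stepMatrix (w (m' + n)) * (transfer w m n - transfer w m' n) := by
      rw [transfer_succ, transfer_succ]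
      noncomm_ring
    rw [e]
    have h1 : ‖(stepMatrix (w (m + n)) - stepMatrix (w (m' + n))) * transfer w m n‖ ≤ δ * c ^ n :=
      (norm_mul_le _ _).trans (mul_le_mul ((norm_stepMatrix_sub_le _ _).trans (hδ n))
        (norm_transfer_le hc m n) (norm_nonneg _) hδ0)
    have h2 : ‖stepMatrix (w (m' + n)) * (transfer w m n - transfer w m' n)‖ ≤
        c * (n * c ^ n * δ) :=
      (norm_mul_le _ _).trans (mul_le_mul ((norm_stepMatrix_le _).trans (hc _)) ih
        (norm_nonneg _) (by linarith))
    refine (norm_add_le _ _).trans ((add_le_add h1 h2).trans ?_)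
    have h3 : δ * c ^ n ≤ c * (c ^ n * δ) := by
      have : 0 ≤ c ^ n * δ := by positivity
      nlinarith
    push_cast
    rw [pow_succ]
    nlinarith

lemma vec_eq_transfer_mulVec {w φ : ℤ → ℂ} (h : ∀ n, φ (n + 1) + φ (n - 1) = w n * φ n) (m : ℤ)
    (n : ℕ) : ![φ (m + n), φ (m + n - 1)] = transfer w m n *ᵥ ![φ m, φ (m - 1)] := by
  induction n with
  | zero => simp
  | succ n ih =>
    rw [transfer_succ, ← Matrix.mulVec_mulVec, ← ih]
    have h1 := h (m + n)
    have h2 : φ (m + ((n + 1 : ℕ) : ℤ)) = w (m + n) * φ (m + n) - φ (m + n - 1) := by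
      rw [← h1]
      push_cast
      rw [← add_assoc]
      ring
    have h3 : m + ((n + 1 : ℕ) : ℤ) - 1 = m + n := by
      push_cast
      ring
    rw [h2, h3]
    ext i
    fin_cases i <;> simp [stepMatrix, Matrix.mulVec, dotProduct, Fin.sum_univ_two, sub_eq_add_neg]

lemma tendsto_lp_cofinite (ψ : ℓ^2(ℤ, ℂ)) : Tendsto (fun n => ‖ψ n‖) cofinite (𝓝 0) := by
  have h := (memℓp_gen_iff (p := 2) (by norm_num)).1 (lp.memℓp ψ)
  have h1 := h.tendsto_cofinite_zero
  simp only [ENNReal.toReal_ofNat, Real.rpow_ofNat] at h1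
  have h2 := h1.sqrt
  simpa [Real.sqrt_sq] using h2

lemma exists_forall_norm_le (ψ : ℓ^2(ℤ, ℂ)) {η : ℝ} (hη : 0 < η) :
    ∃ K : ℕ, ∀ n : ℤ, K ≤ n.natAbs → ‖ψ n‖ ≤ η := by
  have h := (tendsto_lp_cofinite ψ).eventually (ge_mem_nhds hη)
  rw [Filter.eventually_cofinite] at h
  obtain ⟨K, hK⟩ := (h.image Int.natAbs).bddAbove
  refine ⟨K + 1, fun n hn => ?_⟩
  by_contra hcon
  have := hK ⟨n, hcon, rfl⟩
  omega

/-- Gordon's lemma: such potentials have no eigenvalues. -/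
lemma IsGordon.eq_zero_of_eigenvector {V : ℓ^∞(ℤ, ℝ)} (hV : IsGordon V) (E : ℝ) (ψ : ℓ^2(ℤ, ℂ))
    (hψ : schrodinger V ψ = (E : ℂ) • ψ) : ψ = 0 := by
  set w : ℤ → ℂ := fun k => (E : ℂ) - V k with hw
  have hsol : ∀ n, ψ (n + 1) + ψ (n - 1) = w n * ψ n := fun n => by
    have h1 := schrodinger_apply V ψ n
    rw [hψ] at h1
    change (E : ℂ) * ψ n = _ at h1
    rw [hw, sub_mul, h1]
    ring
  set c : ℝ := |E| + ‖V‖ + 1 with hcdef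
  have hc : ∀ k, ‖w k‖ + 1 ≤ c := fun k => by
    have h1 := norm_sub_le (E : ℂ) (V k : ℂ)
    have h2 := lp.norm_apply_le_norm (by simp) V k
    rw [Complex.norm_real, Complex.norm_real, Real.norm_eq_abs] at h1
    linarith
  have hc1 : 1 ≤ c := le_trans (by simp) (hc 0)
  set Ψ : ℤ → Fin 2 → ℂ := fun n => ![ψ n, ψ (n - 1)] with hΨ
  have htr : ∀ (m : ℤ) (n : ℕ), Ψ (m + n) = transfer w m n *ᵥ Ψ m := fun m n =>
    vec_eq_transfer_mulVec hsol m n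
  have hzero : ∀ m, Ψ m = 0 := by
    intro m
    rw [← norm_le_zero_iff]
    refine le_of_forall_pos_le_add fun η hη => ?_
    rw [zero_add]
    obtain ⟨K, hK⟩ := exists_forall_norm_le ψ (show 0 < η / 4 by positivity)
    have hΨK : ∀ n : ℤ, K + 1 ≤ n.natAbs → ‖Ψ n‖ ≤ η / 4 := fun n hn => by
      rw [pi_norm_le_iff_of_nonneg (by positivity)]
      intro i
      fin_cases i
      · exact hK n (by omega)
      · exact hK (n - 1) (by omega)
    -- Since `q ≤ 2 ^ q`, this size of `k` absorbs both the factor `q c ^ q` in the comparison of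
    -- transfer matrices and one further factor `c ^ q`. The other bound on `k` puts `m ± q` and `m
    -- + 2q` where `Ψ` is at most `η / 4`.
    obtain ⟨k₁, hk₁⟩ := exists_nat_ge (2 * c ^ 2)
    obtain ⟨q, hkq, hq⟩ := hV (max k₁ (K + 1 + m.natAbs))
    set k := max k₁ (K + 1 + m.natAbs) with hk
    have hd : (q * c ^ q * ((k : ℝ) + 1)⁻¹ ^ q) * c ^ q ≤ 1 := by
      have h1 : 2 * c ^ 2 ≤ (k : ℝ) + 1 := hk₁.trans (by
        have : k₁ ≤ k := le_max_left _ _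
        have : (k₁ : ℝ) ≤ k := by exact_mod_cast this
        linarith)
      have h2 : (q : ℝ) ≤ 2 ^ q := by exact_mod_cast Nat.lt_two_pow_self.le
      calc (q * c ^ q * ((k : ℝ) + 1)⁻¹ ^ q) * c ^ q
          ≤ (2 ^ q * c ^ q * ((k : ℝ) + 1)⁻¹ ^ q) * c ^ q := by gcongr
        _ = (2 * c ^ 2 * ((k : ℝ) + 1)⁻¹) ^ q := by
          rw [mul_pow, mul_pow, ← pow_mul, mul_comm 2 q, pow_mul, sq (c ^ q)]
          ring
        _ ≤ 1 := by
          refine pow_le_one₀ (by positivity) ?_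
          rw [← div_eq_mul_inv]
          exact div_le_one_of_le₀ h1 (by positivity)
    set d := (q * c ^ q * ((k : ℝ) + 1)⁻¹ ^ q) with hddef
    have hd0 : 0 ≤ d := by positivity
    have hcq : 1 ≤ c ^ q := one_le_pow₀ hc1
    have hd1 : d ≤ 1 := by nlinarith
    set M := transfer w m q
    set M' := transfer w (m + q) q
    set M'' := transfer w (m - q) q
    have hMn : ‖M‖ ≤ c ^ q := norm_transfer_le hc _ _
    have hwq : ∀ n, ‖w (n + q) - w n‖ ≤ ((k : ℝ) + 1)⁻¹ ^ q := fun n => by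
      have h1 : w (n + q) - w n = ((-(V (n + q) - V n) : ℝ) : ℂ) := by
        rw [hw]
        push_cast
        ring
      rw [h1, Complex.norm_real, norm_neg]
      exact hq n
    have hM' : ‖M' - M‖ ≤ d := norm_transfer_sub_le hc _ _ _ fun j => by
      rw [add_right_comm]
      exact hwq _
    have hM'' : ‖M - M''‖ ≤ d := norm_transfer_sub_le hc _ _ _ fun j => by
      have := hwq (m - q + j)
      rwa [show m - (q : ℤ) + j + q = m + j by ring] at this
    have e1 : Ψ (m + q) = M *ᵥ Ψ m := htr m q
    have e2 : Ψ (m + q + q) = M' *ᵥ Ψ (m + q) := htr (m + q) q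
    have e3 : Ψ m = M'' *ᵥ Ψ (m - q) := by
      have := htr (m - q) q
      rwa [sub_add_cancel] at this
    have n1 : ‖Ψ (m + q)‖ ≤ η / 4 := hΨK _ (by omega)
    have n2 : ‖Ψ (m - q)‖ ≤ η / 4 := hΨK _ (by omega)
    have n3 : ‖Ψ (m + q + q)‖ ≤ η / 4 := hΨK _ (by omega)
    have hCH := sq_eq_of_det_eq_one M (det_transfer w m q)
    have hCHv : ∀ x, M *ᵥ (M *ᵥ x) = M.trace • (M *ᵥ x) - x := fun x => by
      rw [Matrix.mulVec_mulVec, hCH, Matrix.sub_mulVec, Matrix.one_mulVec, Matrix.smul_mulVec]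
    -- Cayley–Hamilton reads `M² x = tr(M) M x - x`. With small trace it bounds `Ψ m` by the values
    -- at `m + q` and `m + 2q`; with large trace, applied at `m - q`, it allows division by the
    -- trace and bounds `Ψ m` by the values at `m ± q`.
    by_cases hτ : ‖M.trace‖ ≤ 1
    · have e4 : Ψ m = M.trace • Ψ (m + q) - Ψ (m + q + q) + (M' - M) *ᵥ Ψ (m + q) := by
        have h1 := hCHv (Ψ m)
        rw [← e1] at h1
        rw [Matrix.sub_mulVec, ← e2, h1]
        abel
      have h2 : ‖(M' - M) *ᵥ Ψ (m + q)‖ ≤ 1 * (η / 4) :=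
        (Matrix.linfty_opNorm_mulVec _ _).trans
          (mul_le_mul (hM'.trans hd1) n1 (norm_nonneg _) zero_le_one)
      have h3 : ‖M.trace • Ψ (m + q)‖ ≤ 1 * (η / 4) := by
        rw [norm_smul]
        exact mul_le_mul hτ n1 (norm_nonneg _) zero_le_one
      rw [e4]
      refine (norm_add_le _ _).trans ?_
      have h4 := norm_sub_le (M.trace • Ψ (m + q)) (Ψ (m + q + q))
      linarith
    · push Not at hτ
      set e := (M - M'') *ᵥ Ψ (m - q) with he
      have h1 : M *ᵥ Ψ (m - q) = Ψ m + e := by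
        rw [he, Matrix.sub_mulVec, ← e3]
        abel
      have h2 := hCHv (Ψ (m - q))
      rw [h1, Matrix.mulVec_add, ← e1, smul_add] at h2
      have h3 : M.trace • Ψ m = Ψ (m + q) + M *ᵥ e - M.trace • e + Ψ (m - q) := by
        rw [h2]
        abel
      have hen : ‖e‖ ≤ d * (η / 4) :=
        (Matrix.linfty_opNorm_mulVec _ _).trans
          (mul_le_mul hM'' n2 (norm_nonneg _) hd0)
      have hMe : ‖M *ᵥ e‖ ≤ η / 4 := by
        refine (Matrix.linfty_opNorm_mulVec _ _).trans ?_
        calc ‖M‖ * ‖e‖ ≤ c ^ q * (d * (η / 4)) :=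
              mul_le_mul hMn hen (norm_nonneg _) (by positivity)
          _ = d * c ^ q * (η / 4) := by ring
          _ ≤ 1 * (η / 4) := by gcongr
          _ = η / 4 := one_mul _
      have hen' : ‖e‖ ≤ η / 4 := hen.trans (by nlinarith)
      have h4 : ‖M.trace‖ * ‖Ψ m‖ ≤ η / 4 + η / 4 + ‖M.trace‖ * (η / 4) + η / 4 := by
        rw [← norm_smul, h3]
        refine (norm_add_le _ _).trans (add_le_add ((norm_sub_le _ _).trans
          (add_le_add ((norm_add_le _ _).trans (add_le_add n1 hMe)) ?_)) n2)
        rw [norm_smul]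
        gcongr
      nlinarith [norm_nonneg (Ψ m)]
  ext n
  have := congrFun (hzero n) 0
  simpa [hΨ] using this

end Gordon

/-! ### The derivative of the discriminant inside the bands. -/

section BandEstimate

open Polynomial Matrix

/-- Product rule: differentiating one step matrix `S` gives the matrix unit in the upper left
corner, and `S⁻¹` times that unit is minus the lower left one. Adjugates serve as inverses because
all determinants are `1`. -/
lemma transfer_derivative {R : Type*} [CommRing R] (w : ℤ → R[X]) (hw : ∀ k, derivative (w k) = 1)
    (n : ℕ) :
    (transfer w 0 n).adjugate * (transfer w 0 n).map derivative =
      -∑ k ∈ Finset.range n, (transfer w 0 k).adjugate * !![0, 0; 1, 0] * transfer w 0 k := by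
  induction n with
  | zero =>
    ext i j
    fin_cases i <;> fin_cases j <;> simp
  | succ n ih =>
    have e : (transfer w 0 (n + 1)).map derivative = !![1, 0; 0, 0] * transfer w 0 n +
        stepMatrix (w (0 + n)) * (transfer w 0 n).map derivative := by
      rw [transfer_succ]
      generalize transfer w 0 n = A
      refine Matrix.ext fun i j => ?_
      simp only [Matrix.map_apply, Matrix.add_apply, Matrix.mul_apply, Fin.sum_univ_two]
      fin_cases i
      · simp [stepMatrix, hw, add_assoc]
      · simp [stepMatrix]
    have e2 : (stepMatrix (w (0 + n))).adjugate * !![1, 0; 0, 0] = -!![0, 0; 1, 0] := by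
      refine Matrix.ext fun i j => ?_
      fin_cases i <;> fin_cases j <;>
        simp [stepMatrix, Matrix.mul_apply, Fin.sum_univ_two, Matrix.adjugate_fin_two]
    rw [e, transfer_succ, Matrix.adjugate_mul_distrib, mul_add, Finset.sum_range_succ, neg_add, ← ih]
    have e3 : (stepMatrix (w (0 + n))).adjugate * stepMatrix (w (0 + n)) = 1 := by
      rw [Matrix.adjugate_mul, det_stepMatrix, one_smul]
    have e4 : ∀ A B C : Matrix (Fin 2) (Fin 2) R[X], A * (stepMatrix (w (0 + n))).adjugate *
        (!![1, 0; 0, 0] * B) + A * (stepMatrix (w (0 + n))).adjugate *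
        (stepMatrix (w (0 + n)) * C) = A * C + -(A * !![0, 0; 1, 0] * B) := fun A B C => by
      calc _ = A * ((stepMatrix (w (0 + n))).adjugate * !![1, 0; 0, 0]) * B +
            A * ((stepMatrix (w (0 + n))).adjugate * stepMatrix (w (0 + n))) * C := by
              simp only [mul_assoc]
        _ = _ := by
              rw [e2, e3, mul_one, add_comm, mul_neg, neg_mul]
    exact e4 _ _ _

/-- The derivative of the discriminant is minus the sum of the upper right entries of the
monodromy matrices over one period. -/
lemma eval_derivative_discriminant (v : ℤ → ℝ) (N : ℕ) (hv : ∀ k, v (k + N) = v k) (E : ℝ) :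
    (derivative (discriminant v N)).eval E =
      -∑ k ∈ Finset.range N, transfer (fun j => E - v j) k N 0 1 := by
  set w := fun k => (X : ℝ[X]) - C (v k) with hw
  have hwp : ∀ k, w (k + N) = w k := fun k => by simp only [hw, hv]
  have h1 := transfer_derivative w (fun k => by simp [hw]) N
  have h2 : (transfer w 0 N).map derivative = -∑ k ∈ Finset.range N,
      transfer w 0 N * ((transfer w 0 k).adjugate * !![0, 0; 1, 0] * transfer w 0 k) := by
    rw [← Finset.mul_sum, ← mul_neg, ← h1, ← mul_assoc, Matrix.mul_adjugate, det_transfer, one_smul,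
      one_mul]
  have h3 : derivative (discriminant v N) = ((transfer w 0 N).map derivative).trace := by
    simp [discriminant, Matrix.trace_fin_two, ← hw]
  -- Cyclicity of the trace turns each summand into the monodromy matrix based at `k`, paired with a
  -- matrix unit.
  have h4 : ∀ k : ℕ, (transfer w 0 N * ((transfer w 0 k).adjugate * !![0, 0; 1, 0] *
      transfer w 0 k)).trace = transfer w k N 0 1 := fun k => by
    have e := transfer_period_eq 0 hwp k
    rw [zero_add] at e
    rw [e, ← mul_assoc, Matrix.trace_mul_comm, ← mul_assoc, ← mul_assoc]
    generalize transfer w 0 k * transfer w 0 N * (transfer w 0 k).adjugate = A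
    simp [Matrix.trace_fin_two, Matrix.mul_apply, Fin.sum_univ_two]
  rw [h3, h2, Matrix.trace_neg, Matrix.trace_sum, eval_neg, eval_finsetSum]
  congr 1
  refine Finset.sum_congr rfl fun k _ => ?_
  rw [h4]
  have h5 := congrFun (congrFun (transfer_map w k (evalRingHom E) N) 0) 1
  simp only [Matrix.map_apply, coe_evalRingHom] at h5
  rw [h5]
  simp [hw]

section RealMatrix

variable {w : ℤ → ℝ} {N : ℕ}

/-- For entries `a, b, c, d` with determinant `1`, one has `4bc = (tr² - 4) - (a - d)²`. -/
lemma offDiag_mul_neg {M : Matrix (Fin 2) (Fin 2) ℝ} (hM : M.det = 1) (htr : M.trace ^ 2 < 4) :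
    M 0 1 * M 1 0 < 0 := by
  rw [Matrix.det_fin_two] at hM
  rw [Matrix.trace_fin_two] at htr
  nlinarith [sq_nonneg (M 0 0 - M 1 1)]

lemma transfer_succ_lower_left (hw : ∀ k, w (k + N) = w k) (m : ℤ) :
    transfer w (m + 1) N 1 0 = -transfer w m N 0 1 := by
  have h := transfer_period_eq m hw 1
  rw [Nat.cast_one] at h
  rw [h, transfer_succ, transfer_zero, mul_one]
  generalize transfer w m N = A
  simp only [stepMatrix, Matrix.mul_apply, Fin.sum_univ_two, Matrix.adjugate_fin_two]
  simp

/-- The off-diagonal entries at `m + 1` have opposite signs, and the lower left one is minus the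
upper right entry at `m`. So consecutive upper right entries share their sign and the sum for `Δ'`
has no cancellation. -/
lemma sum_abs_upper_right (hw : ∀ k, w (k + N) = w k)
    (htr : (transfer w 0 N).trace ^ 2 < 4) :
    ∑ k ∈ Finset.range N, |transfer w k N 0 1| = |∑ k ∈ Finset.range N, transfer w k N 0 1| := by
  have hb : ∀ m : ℤ, 0 < transfer w (m + 1) N 0 1 * transfer w m N 0 1 := fun m => by
    have h1 := offDiag_mul_neg (det_transfer w (m + 1) N) (by rwa [trace_transfer _ hw])
    rw [transfer_succ_lower_left hw] at h1
    linarith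
  have hsign : ∀ k : ℕ, 0 < transfer w k N 0 1 * transfer w 0 N 0 1 := by
    intro k
    induction k with
    | zero =>
      have h0 : transfer w 0 N 0 1 ≠ 0 := fun h => by
        have := hb 0
        rw [h, mul_zero] at this
        exact lt_irrefl _ this
      exact mul_self_pos.2 h0
    | succ k ih =>
      have h1 := hb k
      push_cast
      have h2 : 0 < transfer w k N 0 1 * transfer w k N 0 1 :=
        mul_self_pos.2 fun h => by simp [h] at ih
      have h3 := mul_pos h1 ih
      by_contra hcon
      push Not at hcon
      nlinarith
  rcases lt_trichotomy (transfer w 0 N 0 1) 0 with h | h | h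
  · have hneg : ∀ k : ℕ, transfer w k N 0 1 < 0 := fun k => by
      by_contra hcon
      push Not at hcon
      nlinarith [hsign k]
    rw [abs_of_nonpos (Finset.sum_nonpos fun k _ => (hneg k).le), ← Finset.sum_neg_distrib]
    exact Finset.sum_congr rfl fun k _ => abs_of_neg (hneg k)
  · have := hsign 0
    simp [h] at this
  · have hpos : ∀ k : ℕ, 0 < transfer w k N 0 1 := fun k => by
      by_contra hcon
      push Not at hcon
      nlinarith [hsign k]
    rw [abs_of_nonneg (Finset.sum_nonneg fun k _ => (hpos k).le)]
    exact Finset.sum_congr rfl fun k _ => abs_of_pos (hpos k)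

/-- Size of the off-diagonal part. -/
def offDiagSize (M : Matrix (Fin 2) (Fin 2) ℝ) : ℝ := |M 0 1| + |M 1 0|

/-- If two conjugate elliptic matrices both have small off-diagonal part, then the conjugating
matrix is small. -/
lemma mul_trace_le_offDiagSize {A M M' : Matrix (Fin 2) (Fin 2) ℝ} (hA : A.det = 1)
    (hM' : M' * A = A * M) (hM'd : M'.det = 1) {s : ℝ}
    (hs2 : 4 * s ^ 2 = 4 - M'.trace ^ 2) :
    s * |A.trace| ≤ offDiagSize M + offDiagSize M' := by
  rw [Matrix.det_fin_two] at hA hM'd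
  rw [Matrix.trace_fin_two] at hs2 ⊢
  have e := fun i j => congrFun (congrFun hM' i) j
  have e00 := e 0 0
  have e01 := e 0 1
  have e10 := e 1 0
  have e11 := e 1 1
  simp only [Matrix.mul_apply, Fin.sum_univ_two] at e00 e01 e10 e11
  unfold offDiagSize
  generalize A 0 0 = p at *
  generalize A 0 1 = q at *
  generalize A 1 0 = r at *
  generalize A 1 1 = t at *
  generalize M' 0 0 = a' at *
  generalize M' 0 1 = b' at *
  generalize M' 1 0 = c' at *
  generalize M' 1 1 = d' at *
  generalize M 0 0 = a at *
  generalize M 0 1 = b at *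
  generalize M 1 0 = c at *
  generalize M 1 1 = d at *
  -- As `M = A⁻¹ M' A`, the entries `c` and `-b` are the values at the two columns of `A` of the
  -- quadratic form `Q` with coefficients `c'`, `d' - a'`, `-b'`. This form has trace `c' - b'` and
  -- determinant `s²`.
  have hc : c = c' * p ^ 2 + (d' - a') * p * r - b' * r ^ 2 := by
    linear_combination (-c) * hA + r * e00 - p * e10
  have hb : -b = c' * q ^ 2 + (d' - a') * q * t - b' * t ^ 2 := by
    linear_combination b * hA + t * e01 - q * e11
  -- Cayley–Hamilton for `Q`: `|Qx|² = tr(Q) ⟨x, Qx⟩ - det(Q) |x|²`, and the left side is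
  -- nonnegative.
  have h1 : s ^ 2 * (p ^ 2 + r ^ 2) ≤ (c' - b') * c := by
    have : (c' - b') * c - s ^ 2 * (p ^ 2 + r ^ 2) = (c' * p + (d' - a') / 2 * r) ^ 2 +
        ((d' - a') / 2 * p - b' * r) ^ 2 := by
      rw [hc]
      linear_combination (- (p ^ 2 + r ^ 2)) * (hs2 / 4 - hM'd)
    nlinarith [sq_nonneg (c' * p + (d' - a') / 2 * r), sq_nonneg ((d' - a') / 2 * p - b' * r)]
  have h2 : s ^ 2 * (q ^ 2 + t ^ 2) ≤ (c' - b') * (-b) := by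
    have : (c' - b') * (-b) - s ^ 2 * (q ^ 2 + t ^ 2) = (c' * q + (d' - a') / 2 * t) ^ 2 +
        ((d' - a') / 2 * q - b' * t) ^ 2 := by
      rw [hb]
      linear_combination (- (q ^ 2 + t ^ 2)) * (hs2 / 4 - hM'd)
    nlinarith [sq_nonneg (c' * q + (d' - a') / 2 * t), sq_nonneg ((d' - a') / 2 * q - b' * t)]
  have h3 : (c' - b') * c + (c' - b') * (-b) ≤ (|b'| + |c'|) * (|b| + |c|) := by
    have h4 : |c' - b'| ≤ |b'| + |c'| := by
      rw [add_comm]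
      exact abs_sub _ _
    have h5 : |c - b| ≤ |b| + |c| := by
      rw [add_comm]
      exact abs_sub _ _
    calc (c' - b') * c + (c' - b') * (-b) = (c' - b') * (c - b) := by ring
      _ ≤ |(c' - b') * (c - b)| := le_abs_self _
      _ = |c' - b'| * |c - b| := abs_mul _ _
      _ ≤ _ := mul_le_mul h4 h5 (abs_nonneg _) (by positivity)
  refine abs_le_of_sq_le_sq' ?_ (by positivity) |>.2
  rw [mul_pow, sq_abs]
  have h6 : (p + t) ^ 2 ≤ 2 * (p ^ 2 + q ^ 2 + r ^ 2 + t ^ 2) := by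
    nlinarith [sq_nonneg (p - t), sq_nonneg q, sq_nonneg r]
  have h7 := mul_le_mul_of_nonneg_left h6 (sq_nonneg s)
  nlinarith [sq_nonneg (|b| + |c| - (|b'| + |c'|)), sq_nonneg (|b| + |c|), sq_nonneg (|b'| + |c'|)]

/-- Growth of the transfer matrices forces the discriminant to vary quickly on the bands. -/
lemma growth_le_derivative (hw : ∀ k, w (k + N) = w k) {s : ℝ} (hs : 0 ≤ s)
    (hspos : (transfer w 0 N).trace ^ 2 < 4)
    (hs2 : 4 * s ^ 2 = 4 - (transfer w 0 N).trace ^ 2) {a r L : ℕ} (haL : a + L + r ≤ N) {K : ℝ}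
    (hK : ∀ k : ℕ, a ≤ k → k < a + L → K ≤ |(transfer w k r).trace|) :
    s * K * L ≤ 4 * |∑ k ∈ Finset.range N, transfer w k N 0 1| := by
  set τ : ℕ → ℝ := fun k => offDiagSize (transfer w k N) with hτ
  have hτ0 : ∀ k, 0 ≤ τ k := fun k => by
    simp only [hτ, offDiagSize]
    positivity
  have h1 : ∀ k : ℕ, a ≤ k → k < a + L → s * K ≤ τ k + τ (k + r) := fun k h1 h2 => by
    have h3 : s * |(transfer w k r).trace| ≤ τ k + τ (k + r) := by
      refine mul_trace_le_offDiagSize (det_transfer w k r) ?_ (det_transfer _ _ _) ?_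
      · push_cast
        exact transfer_conj k hw r
      · rw [trace_transfer _ hw, hs2]
    exact (mul_le_mul_of_nonneg_left (hK k h1 h2) hs).trans h3
  -- Summing over the block produces two windows, one shifted by `r`; both stay inside one period.
  have h2 : ∑ k ∈ Finset.Ico a (a + L), s * K ≤ ∑ k ∈ Finset.Ico a (a + L), (τ k + τ (k + r)) :=
    Finset.sum_le_sum fun k hk => h1 k (Finset.mem_Ico.1 hk).1 (Finset.mem_Ico.1 hk).2
  rw [Finset.sum_const, Nat.card_Ico, add_tsub_cancel_left, nsmul_eq_mul, Finset.sum_add_distrib,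
    Finset.sum_Ico_add' τ] at h2
  have h3 : ∀ b c, c ≤ N → ∑ k ∈ Finset.Ico b c, τ k ≤ ∑ k ∈ Finset.range N, τ k :=
    fun b c hc => Finset.sum_le_sum_of_subset_of_nonneg
      (fun k hk => Finset.mem_range.2 ((Finset.mem_Ico.1 hk).2.trans_le hc)) fun k _ _ => hτ0 k
  -- Over a full period the lower left entries are a cyclic shift of the upper right ones, up to
  -- sign. Each window thus costs `2 Σ |b_k|`, whence the constant `4`.
  have h4 : ∑ k ∈ Finset.range N, τ k = 2 * ∑ k ∈ Finset.range N, |transfer w k N 0 1| := by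
    simp only [hτ, offDiagSize, Finset.sum_add_distrib, two_mul]
    congr 1
    have h5 := Finset.sum_range_succ (fun k : ℕ => |transfer w k N 1 0|) N
    rw [Finset.sum_range_succ'] at h5
    have h6 : transfer w (N : ℤ) N = transfer w 0 N := by
      have := transfer_add_period 0 hw N
      rwa [zero_add] at this
    rw [h6] at h5
    have h7 : ∑ k ∈ Finset.range N, |transfer w ((k + 1 : ℕ) : ℤ) N 1 0| =
        ∑ k ∈ Finset.range N, |transfer w k N 0 1| :=
      Finset.sum_congr rfl fun k _ => by
        push_cast
        rw [transfer_succ_lower_left hw, abs_neg]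
    rw [h7] at h5
    simpa using h5.symm
  rw [← sum_abs_upper_right hw hspos]
  have h8 := h3 a (a + L) (by omega)
  have h9 := h3 (a + r) (a + L + r) haL
  rw [h4] at h8 h9
  linarith [h2, h8, h9]

end RealMatrix

end BandEstimate

/-! ### Lebesgue measure of the bands. -/

section BandMeasure

open Polynomial Matrix

/-- Only the degree of the trace is needed later, but the recursion mixes rows, so degree bounds for
all four entries are carried along. -/
lemma coeff_transfer (v : ℤ → ℝ) (m : ℤ) (n : ℕ) :
    let T := transfer (fun k => (X : ℝ[X]) - C (v k)) m n
    (T 0 0).coeff n = 1 ∧ (∀ k, n < k → (T 0 0).coeff k = 0) ∧ (∀ k, n ≤ k → (T 0 1).coeff k = 0) ∧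
      (∀ k, n ≤ k → (T 1 0).coeff k = 0) ∧ ∀ k, n < k → (T 1 1).coeff k = 0 := by
  induction n with
  | zero =>
    refine ⟨by simp, fun k hk => ?_, fun k _ => by simp, fun k _ => by simp, fun k hk => ?_⟩ <;>
    simp [Polynomial.coeff_one, hk.ne']
  | succ n ih =>
    intro T
    have h := transfer_succ (fun k => (X : ℝ[X]) - C (v k)) m n
    simp only at ih
    obtain ⟨h1, h2, h3, h4, h5⟩ := ih
    have e0 : ∀ j, T 0 j = (X - C (v (m + n))) *
        transfer (fun k => (X : ℝ[X]) - C (v k)) m n 0 j -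
        transfer (fun k => (X : ℝ[X]) - C (v k)) m n 1 j := fun j => by
      simp only [T, h, stepMatrix, Matrix.mul_apply, Fin.sum_univ_two]
      simp [sub_eq_add_neg]
    have e1 : ∀ j, T 1 j = transfer (fun k => (X : ℝ[X]) - C (v k)) m n 0 j := fun j => by
      simp only [T, h, stepMatrix, Matrix.mul_apply, Fin.sum_univ_two]
      simp
    simp only [e0, e1, sub_mul, coeff_sub, coeff_C_mul]
    refine ⟨?_, fun k hk => ?_, fun k hk => ?_, fun k hk => ?_, fun k hk => ?_⟩
    · rw [coeff_X_mul, h1, h2 _ (by omega), h4 _ (by omega)]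
      ring
    · obtain ⟨k, rfl⟩ := Nat.exists_eq_add_of_lt hk
      rw [coeff_X_mul, h2 _ (by omega), h2 _ (by omega), h4 _ (by omega)]
      ring
    · obtain ⟨k, rfl⟩ := Nat.exists_eq_add_of_le hk
      rw [add_right_comm, coeff_X_mul, h3 _ (by omega), h3 _ (by omega), h5 _ (by omega)]
      ring
    · exact h2 k (by omega)
    · exact h3 k (by omega)

lemma natDegree_discriminant (v : ℤ → ℝ) {N : ℕ} (hN : 0 < N) :
    (discriminant v N).natDegree = N := by
  obtain ⟨n, rfl⟩ := Nat.exists_eq_succ_of_ne_zero hN.ne'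
  obtain ⟨h1, h2, -, -, h5⟩ := coeff_transfer v 0 (n + 1)
  have h6 := (coeff_transfer v 0 n).2.2.1
  have e1 : transfer (fun k => (X : ℝ[X]) - C (v k)) 0 (n + 1) 1 1 =
      transfer (fun k => (X : ℝ[X]) - C (v k)) 0 n 0 1 := by
    rw [transfer_succ]
    simp only [stepMatrix, Matrix.mul_apply, Fin.sum_univ_two]
    simp
  refine natDegree_eq_of_le_of_coeff_ne_zero ?_ ?_
  · rw [natDegree_le_iff_coeff_eq_zero]
    intro k hk
    rw [discriminant, Matrix.trace_fin_two, coeff_add, h2 k hk, h5 k hk, add_zero]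
  · rw [discriminant, Matrix.trace_fin_two, coeff_add, h1, e1, h6 _ (by omega)]
    simp

/-- A quantitative bound for the measure of a set on which `arccos (P / 2)` moves quickly. -/
lemma volume_le_of_derivative_ge (P : ℝ[X]) (hP : 0 < P.natDegree) {S : Set ℝ}
    (hS : MeasurableSet S) (h2 : ∀ E ∈ S, |P.eval E| < 2) {c : ℝ} (hc : 0 < c)
    (hder : ∀ E ∈ S, c * √(4 - P.eval E ^ 2) ≤ |(derivative P).eval E|) :
    volume S ≤ ENNReal.ofReal (P.natDegree * (Real.pi / c)) := by
  classical
  have hPd : derivative P ≠ 0 := fun h => hP.ne' (derivative_eq_zero.1 h)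
  set R := (derivative P).roots.toFinset with hR
  have hRmem : ∀ x, x ∈ R ↔ (derivative P).eval x = 0 := fun x => by
    rw [hR, Multiset.mem_toFinset, mem_roots hPd, IsRoot.def]
  have hRcard : R.card < P.natDegree := by
    have h := (Multiset.toFinset_card_le _).trans (card_roots' (derivative P))
    have := natDegree_derivative_le P
    rw [← hR] at h
    omega
  -- Counting critical points to the left of `E` splits `S` into at most `natDegree P` pieces. By
  -- Rolle, `P` is injective on each.
  set cnt : ℝ → ℕ := fun E => (R.filter (· < E)).card with hcnt
  have hcntm : Measurable cnt := by
    refine Monotone.measurable fun x y hxy => Finset.card_le_card fun z hz => ?_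
    rw [Finset.mem_filter] at hz ⊢
    exact ⟨hz.1, hz.2.trans_le hxy⟩
  have hSi : ∀ i, volume (S ∩ cnt ⁻¹' {i}) ≤ ENNReal.ofReal (Real.pi / c) := by
    intro i
    set s := S ∩ cnt ⁻¹' {i} with hs
    have hsm : MeasurableSet s := hS.inter (hcntm (measurableSet_singleton i))
    set φ : ℝ → ℝ := fun E => Real.arccos (P.eval E / 2) with hφ
    set φ' : ℝ → ℝ := fun E =>
      -(1 / √(1 - (P.eval E / 2) ^ 2)) * ((derivative P).eval E / 2) with hφ'
    have hlt : ∀ E ∈ s, -1 < P.eval E / 2 ∧ P.eval E / 2 < 1 := fun E hE => by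
      have := abs_lt.1 (h2 E hE.1)
      constructor <;> linarith
    have hd : ∀ E ∈ s, HasDerivWithinAt φ (φ' E) s E := fun E hE => by
      obtain ⟨h3, h4⟩ := hlt E hE
      exact ((Real.hasDerivAt_arccos h3.ne' h4.ne).comp E
        ((P.hasDerivAt E).div_const 2)).hasDerivWithinAt
    have hinj : Set.InjOn φ s := by
      have key : ∀ x ∈ s, ∀ y ∈ s, x < y → φ x ≠ φ y := by
        intro x hx y hy hxy heq
        have h3 := Real.arccos_injOn ⟨(hlt x hx).1.le, (hlt x hx).2.le⟩
          ⟨(hlt y hy).1.le, (hlt y hy).2.le⟩ heq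
        have h4 : P.eval x = P.eval y := by linarith
        obtain ⟨z, hz, hz0⟩ := exists_hasDerivAt_eq_zero hxy P.continuous.continuousOn h4
          fun z _ => P.hasDerivAt z
        have h5 : cnt x < cnt y := by
          refine Finset.card_lt_card ⟨fun u hu => ?_, fun hsub => ?_⟩
          · rw [Finset.mem_filter] at hu ⊢
            exact ⟨hu.1, hu.2.trans hxy⟩
          · have h6 := hsub (Finset.mem_filter.2 ⟨(hRmem z).2 hz0, hz.2⟩)
            exact (Finset.mem_filter.1 h6).2.not_gt hz.1
        rw [hx.2, hy.2] at h5
        exact lt_irrefl _ h5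
      intro x hx y hy hxy
      by_contra hne
      rcases lt_or_gt_of_ne hne with h | h
      · exact key x hx y hy h hxy
      · exact key y hy x hx h hxy.symm
    -- Change of variables: the integral of `|φ'| ≥ c` over a piece is the length of its image in
    -- `[0, π]`.
    have hchange := lintegral_image_eq_lintegral_abs_deriv_mul hsm hd hinj (fun _ => 1)
    simp only [mul_one, setLIntegral_one] at hchange
    have himg : volume (φ '' s) ≤ ENNReal.ofReal Real.pi := by
      refine (measure_mono (?_ : φ '' s ⊆ Set.Icc 0 Real.pi)).trans (by simp)
      rintro _ ⟨x, -, rfl⟩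
      exact ⟨Real.arccos_nonneg _, Real.arccos_le_pi _⟩
    have hlow : ENNReal.ofReal c * volume s ≤ ENNReal.ofReal Real.pi := by
      refine le_trans ?_ himg
      rw [hchange, ← setLIntegral_const]
      refine setLIntegral_mono' hsm fun E hE => ENNReal.ofReal_le_ofReal ?_
      have h3 := hder E hE.1
      have h4 : 0 < 4 - P.eval E ^ 2 := by
        have := abs_lt.1 (h2 E hE.1)
        nlinarith
      have h5 : √(1 - (P.eval E / 2) ^ 2) = √(4 - P.eval E ^ 2) / 2 := by
        rw [show 1 - (P.eval E / 2) ^ 2 = (4 - P.eval E ^ 2) / 2 ^ 2 by ring,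
          Real.sqrt_div h4.le, Real.sqrt_sq (by norm_num)]
      have h6 : 0 < √(4 - P.eval E ^ 2) := Real.sqrt_pos.2 h4
      have h7 : |φ' E| = |(derivative P).eval E| / √(4 - P.eval E ^ 2) := by
        simp only [hφ', h5]
        rw [abs_mul, abs_neg, abs_div, abs_div, abs_div, abs_one, abs_of_pos h6, abs_two]
        field_simp
      rw [h7, le_div_iff₀ h6]
      exact h3
    rw [ENNReal.ofReal_div_of_pos hc, ENNReal.le_div_iff_mul_le
      (Or.inl (by simpa using hc)) (Or.inl ENNReal.ofReal_ne_top), mul_comm]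
    exact hlow
  have hcover : S ⊆ ⋃ i ∈ Finset.range P.natDegree, S ∩ cnt ⁻¹' {i} := by
    intro E hE
    simp only [Set.mem_iUnion]
    refine ⟨cnt E, Finset.mem_range.2 ?_, hE, rfl⟩
    exact (Finset.card_filter_le _ _).trans_lt hRcard
  refine (measure_mono hcover).trans ((measure_biUnion_finset_le _ _).trans ?_)
  refine (Finset.sum_le_sum fun i _ => hSi i).trans ?_
  rw [Finset.sum_const, Finset.card_range, nsmul_eq_mul, ENNReal.ofReal_mul (by positivity),
    ENNReal.ofReal_natCast]

lemma finite_abs_eval_discriminant_eq_two (v : ℤ → ℝ) {N : ℕ} (hN : 0 < N) :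
    {E : ℝ | |(discriminant v N).eval E| = 2}.Finite := by
  have hne : ∀ a : ℝ, discriminant v N - C a ≠ 0 := fun a h => by
    have h1 := natDegree_discriminant v hN
    rw [sub_eq_zero.1 h, natDegree_C] at h1
    omega
  refine Set.Finite.subset (((discriminant v N - C 2).roots.toFinset ∪
    (discriminant v N - C (-2)).roots.toFinset).finite_toSet) fun E hE => ?_
  simp only [Finset.coe_union, Set.mem_union, Finset.mem_coe, Multiset.mem_toFinset,
    mem_roots (hne _), IsRoot.def, eval_sub, eval_C]
  rcases eq_or_eq_neg_of_abs_eq hE with h | h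
  · left; linarith
  · right; linarith

/-- Growth of the transfer matrices over a long block at each energy of `B` makes the part of the
bands in `B` small. -/
lemma volume_bands_le (v : ℤ → ℝ) {N : ℕ} (hN : 0 < N) (hv : ∀ k, v (k + N) = v k) {B : Set ℝ}
    (hB : MeasurableSet B) {K L : ℝ} (hK : 0 < K) (hL : 0 < L)
    (hgrow : ∀ E ∈ B, ∃ a r l : ℕ, L ≤ l ∧ a + l + r ≤ N ∧ ∀ k : ℕ, a ≤ k → k < a + l →
      K ≤ |(transfer (fun j => E - v j) k r).trace|) :
    volume {E ∈ B | |(discriminant v N).eval E| ≤ 2} ≤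
      ENNReal.ofReal (8 * Real.pi * N / (K * L)) := by
  set S : Set ℝ := B ∩ {E | |(discriminant v N).eval E| < 2} with hS
  have hSm : MeasurableSet S :=
    hB.inter (isOpen_lt (discriminant v N).continuous.abs continuous_const).measurableSet
  have hsub : {E ∈ B | |(discriminant v N).eval E| ≤ 2} ⊆
      S ∪ {E | |(discriminant v N).eval E| = 2} := by
    rintro E ⟨hE, h⟩
    rcases h.lt_or_eq with h | h
    · exact Or.inl ⟨hE, h⟩
    · exact Or.inr h
  refine (measure_mono hsub).trans ((measure_union_le _ _).trans ?_)
  rw [(finite_abs_eval_discriminant_eq_two v hN).measure_zero, add_zero]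
  -- The growth estimate with `s = √(4 - Δ²) / 2` gives `s K L ≤ 4 |Δ'|`, hence the constant `K L /
  -- 8`.
  have hmain := volume_le_of_derivative_ge (discriminant v N)
    (by rwa [natDegree_discriminant v hN]) hSm (fun E hE => hE.2) (c := K * L / 8) (by positivity) ?_
  · rw [natDegree_discriminant v hN] at hmain
    refine hmain.trans (le_of_eq ?_)
    congr 1
    field_simp
  · rintro E ⟨hE, h2⟩
    obtain ⟨a, r, l, hLl, harl, hg⟩ := hgrow E hE
    have hwp : ∀ k, (fun j => E - v j) (k + N) = (fun j => E - v j) k := fun k => by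
      simp only [hv]
    have h4 : 0 < 4 - (discriminant v N).eval E ^ 2 := by
      have := abs_lt.1 (show |(discriminant v N).eval E| < 2 from h2)
      nlinarith
    have h5 := growth_le_derivative hwp (s := √(4 - (discriminant v N).eval E ^ 2) / 2)
      (by positivity) (by rw [← eval_discriminant]; linarith)
      (by rw [← eval_discriminant, div_pow, Real.sq_sqrt h4.le]; ring) harl hg
    rw [eval_derivative_discriminant v N hv, abs_neg]
    have h6 : √(4 - (discriminant v N).eval E ^ 2) / 2 * K * L ≤
        √(4 - (discriminant v N).eval E ^ 2) / 2 * K * l := by gcongr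
    linarith

end BandMeasure

/-! ### Opening gaps by small perturbations. -/

section Gaps

open Polynomial Matrix

/-- The Chebyshev recursion for powers of a unimodular matrix, multiplied through by `sin θ` to
avoid division. -/
lemma sin_smul_pow (M : Matrix (Fin 2) (Fin 2) ℝ) (hM : M.det = 1) {θ : ℝ}
    (hθ : M.trace = 2 * Real.cos θ) (n : ℕ) :
    Real.sin θ • M ^ (n + 1) = Real.sin ((n + 1) * θ) • M - Real.sin (n * θ) • 1 := by
  induction n with
  | zero => simp
  | succ n ih =>
    have h1 := sq_eq_of_det_eq_one M hM
    have h2 : Real.sin ((n + 1 + 1) * θ) =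
        2 * Real.cos θ * Real.sin ((n + 1) * θ) - Real.sin (n * θ) := by
      rw [show ((n : ℝ) + 1 + 1) * θ = (n + 1) * θ + θ by ring,
        show (n : ℝ) * θ = (n + 1) * θ - θ by ring, Real.sin_add, Real.sin_sub]
      ring
    rw [pow_succ, ← smul_mul_assoc, ih, sub_mul, smul_mul_assoc, smul_mul_assoc, h1, one_mul, hθ]
    push_cast
    rw [h2]
    module

lemma pow_eq_smul_one (M : Matrix (Fin 2) (Fin 2) ℝ) (hM : M.det = 1) {θ : ℝ}
    (hθ : M.trace = 2 * Real.cos θ) (hs : Real.sin θ ≠ 0) {q : ℕ} (k : ℕ)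
    (hk : ((q : ℝ) + 1) * θ = k * Real.pi) : ∃ η : ℝ, |η| = 1 ∧ M ^ (q + 1) = η • 1 := by
  refine ⟨Real.cos (k * Real.pi), by simp [Real.cos_nat_mul_pi], ?_⟩
  have h1 := sin_smul_pow M hM hθ q
  have h2 : Real.sin (q * θ) = -Real.cos (k * Real.pi) * Real.sin θ := by
    rw [show (q : ℝ) * θ = k * Real.pi - θ by linarith, Real.sin_sub, Real.sin_nat_mul_pi]
    ring
  rw [hk, Real.sin_nat_mul_pi, h2, zero_smul, zero_sub] at h1
  have h3 : Real.sin θ • M ^ (q + 1) = Real.sin θ • (Real.cos (k * Real.pi) • 1) := by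
    rw [h1]
    module
  exact smul_right_injective _ hs h3

/-- Perturbation of two adjacent sites opens a gap where the monodromy matrix is `±1`. -/
lemma exists_perturbation_of_transfer_eq (v : ℤ → ℝ) {N : ℕ} (hN : 2 ≤ N)
    (hv : ∀ k, v (k + N) = v k) (E η : ℝ) (hη : |η| = 1)
    (hM : transfer (fun j => E - v j) 0 N = η • 1) {t : ℝ} (ht : 0 < t) :
    ∃ v' : ℤ → ℝ, (∀ k, v' (k + N) = v' k) ∧ (∀ k, |v' k - v k| ≤ t) ∧
      2 < |(discriminant v' N).eval E| := by
  classical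
  set v' : ℤ → ℝ := fun k => v k +
    (if (N : ℤ) ∣ k then t else if (N : ℤ) ∣ k - 1 then -t else 0) with hv'
  refine ⟨v', fun k => ?_, fun k => ?_, ?_⟩
  · simp only [hv', hv, add_sub_right_comm, dvd_add_self_right]
  · simp only [hv', add_sub_cancel_left]
    split_ifs <;> simp [abs_of_pos ht, ht.le]
  · rw [eval_discriminant]
    obtain ⟨n, rfl⟩ := Nat.exists_eq_add_of_le hN
    have e : ∀ u : ℤ → ℝ, transfer u 0 (2 + n) =
        transfer u 2 n * (stepMatrix (u 1) * stepMatrix (u 0)) := fun u => by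
      rw [transfer_add]
      congr 1
      change transfer u 0 (1 + 1) = _
      rw [transfer_succ, transfer_succ]
      simp
    have hnd : ∀ j : ℤ, 0 < j → j < 2 + n → ¬ ((2 + n : ℕ) : ℤ) ∣ j := fun j h0 h1 h => by
      have := Int.le_of_dvd h0 h
      push_cast at this
      omega
    have hrest : transfer (fun j => E - v' j) 2 n = transfer (fun j => E - v j) 2 n :=
      transfer_congr fun k hk => by
        simp only [hv']
        rw [if_neg (hnd _ (by omega) (by omega)), if_neg (hnd _ (by omega) (by omega)), add_zero]
    have h0 : v' 0 = v 0 + t := by simp [hv']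
    have h1 : v' 1 = v 1 - t := by
      simp only [hv']
      rw [if_neg (hnd 1 (by omega) (by omega)), if_pos (by simp)]
      ring
    rw [e] at hM
    rw [e, hrest, h0, h1]
    generalize transfer (fun j => E - v j) 2 n = A at *
    -- The unperturbed sites carry `η` times the inverse of the two original steps. In the perturbed
    -- trace the terms linear in `t` cancel, and the opposite signs of the two changes make the
    -- quadratic term push `|Δ|` beyond `2`.
    have hA : A = η • ((stepMatrix (E - v 0)).adjugate * (stepMatrix (E - v 1)).adjugate) := by
      calc A = A * (stepMatrix (E - v 1) * stepMatrix (E - v 0)) *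
            (stepMatrix (E - v 1) * stepMatrix (E - v 0)).adjugate := by
              rw [mul_assoc, Matrix.mul_adjugate, Matrix.det_mul, det_stepMatrix, det_stepMatrix,
                mul_one, one_smul, mul_one]
        _ = _ := by rw [hM, Matrix.adjugate_mul_distrib, smul_mul_assoc, one_mul]
    have htr : (A * (stepMatrix (E - (v 1 - t)) * stepMatrix (E - (v 0 + t)))).trace =
        η * (2 + t ^ 2) := by
      rw [hA]
      simp only [Matrix.trace_fin_two, stepMatrix, Matrix.adjugate_fin_two, Matrix.mul_apply,
        Fin.sum_univ_two, Matrix.smul_apply, smul_eq_mul]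
      simp
      ring
    rw [htr, abs_mul, hη, one_mul]
    have := pow_pos ht 2
    rw [abs_of_pos (by linarith)]
    linarith

/-- Near any energy a gap can be opened by arbitrarily small perturbations of a fixed large
period. -/
lemma exists_gap_perturbation (v : ℤ → ℝ) {p : ℕ} (hp : 0 < p) (hv : ∀ k, v (k + p) = v k)
    (E₀ : ℝ) {ε : ℝ} (hε : 0 < ε) :
    ∃ Q : ℕ, ∀ q : ℕ, Q ≤ q → ∃ E₁, |E₁ - E₀| < ε ∧ ∀ δ > 0, ∃ v' : ℤ → ℝ,
      (∀ k, v' (k + (p * q : ℕ)) = v' k) ∧ (∀ k, |v' k - v k| ≤ δ) ∧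
      ∃ r : ℕ, 0 < r ∧ (∀ k, v' (k + r) = v' k) ∧ 2 < |(discriminant v' r).eval E₁| := by
  have hvq : ∀ q : ℕ, ∀ k, v (k + (p * q : ℕ)) = v k := by
    intro q
    induction q with
    | zero => simp
    | succ q ih =>
      intro k
      have := hv (k + (p * q : ℕ))
      rw [ih] at this
      rw [← this]
      congr 1
      push_cast
      ring
  set D := fun E => (discriminant v p).eval E with hD
  have hDc : Continuous D := (discriminant v p).continuous
  -- If a gap is already within reach, nothing is perturbed and the original period `p` witnesses
  -- it. This is why the witnessing period `r` is separate from `p * q`.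
  by_cases hex : ∃ E₁, |E₁ - E₀| < ε ∧ 2 < |D E₁|
  · obtain ⟨E₁, h1, h2⟩ := hex
    exact ⟨0, fun q _ => ⟨E₁, h1, fun δ hδ => ⟨v, hvq q, fun k => by simpa using hδ.le,
      p, hp, hv, h2⟩⟩⟩
  push Not at hex
  have hIoo : ∀ a b : ℝ, a < b → (Set.Ioo a b).Infinite := fun a b h => Set.Ioo_infinite h
  obtain ⟨E₂, hE₂, hE₂2⟩ : ∃ E₂ ∈ Set.Ioo (E₀ - ε) (E₀ + ε), |D E₂| ≠ 2 := by
    by_contra hcon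
    push Not at hcon
    exact hIoo (E₀ - ε) (E₀ + ε) (by linarith)
      ((finite_abs_eval_discriminant_eq_two v hp).subset hcon)
  have hne : discriminant v p - C (D E₂) ≠ 0 := fun h => by
    have h1 := natDegree_discriminant v hp
    rw [sub_eq_zero.1 h, natDegree_C] at h1
    omega
  have hopen : IsOpen ({E | |E - E₀| < ε} ∩ {E | |D E| < 2}) :=
    (isOpen_lt (by fun_prop) continuous_const).inter (isOpen_lt hDc.abs continuous_const)
  have hmem : E₂ ∈ {E | |E - E₀| < ε} ∩ {E | |D E| < 2} := by
    have h1 : |E₂ - E₀| < ε := abs_lt.2 ⟨by linarith [hE₂.1], by linarith [hE₂.2]⟩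
    exact ⟨h1, lt_of_le_of_ne (hex E₂ h1) hE₂2⟩
  obtain ⟨r, hr, hball⟩ := Metric.isOpen_iff.1 hopen E₂ hmem
  obtain ⟨E₃, hE₃, hE₃ne⟩ : ∃ E₃ ∈ Set.Ioo E₂ (E₂ + r), D E₃ ≠ D E₂ := by
    by_contra hcon
    push Not at hcon
    refine hIoo E₂ (E₂ + r) (by linarith)
      ((discriminant v p - C (D E₂)).roots.toFinset.finite_toSet.subset fun E hE => ?_)
    rw [Finset.mem_coe, Multiset.mem_toFinset, mem_roots hne, IsRoot.def, eval_sub, eval_C,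
      sub_eq_zero]
    exact hcon E hE
  have hIcc : ∀ E ∈ Set.Icc E₂ E₃, |E - E₀| < ε ∧ |D E| < 2 := fun E hE =>
    hball (by
      rw [Metric.mem_ball, Real.dist_eq, abs_of_nonneg (by linarith [hE.1])]
      linarith [hE.2, hE₃.2])
  set θ := fun E => Real.arccos (D E / 2) with hθ
  -- On `[E₂, E₃]`, inside a band, the angle `θ` sweeps an interval of length at least `d`. Once the
  -- mesh `π / (q + 1)` is below `d`, a multiple of it is attained.
  have hθc : Continuous θ := Real.continuous_arccos.comp (by fun_prop)
  have hθne : θ E₂ ≠ θ E₃ := fun h => by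
    have h2 := abs_lt.1 (hIcc E₂ ⟨le_rfl, hE₃.1.le⟩).2
    have h3 := abs_lt.1 (hIcc E₃ ⟨hE₃.1.le, le_rfl⟩).2
    have := Real.arccos_injOn ⟨by linarith, by linarith⟩ ⟨by linarith, by linarith⟩ h
    exact hE₃ne (by linarith)
  set d := |θ E₂ - θ E₃| with hd
  have hdpos : 0 < d := abs_pos.2 (sub_ne_zero.2 hθne)
  obtain ⟨Q, hQ⟩ := exists_nat_gt (Real.pi / d)
  refine ⟨Q + 2, fun q hq => ?_⟩
  obtain ⟨q, rfl⟩ : ∃ q', q = q' + 1 := ⟨q - 1, by omega⟩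
  have hqpos : (0 : ℝ) < q + 1 := by positivity
  have hqd : Real.pi < d * (q + 1) := by
    rw [div_lt_iff₀ hdpos] at hQ
    have : (Q : ℝ) ≤ q + 1 := by exact_mod_cast (by omega : Q ≤ q + 1)
    nlinarith
  have hmin : 0 ≤ min (θ E₂) (θ E₃) := le_min (Real.arccos_nonneg _) (Real.arccos_nonneg _)
  have hmaxmin : max (θ E₂) (θ E₃) = min (θ E₂) (θ E₃) + d := by
    have := max_sub_min_eq_abs' (θ E₂) (θ E₃)
    linarith
  -- The first multiple strictly above the minimum. Strictness keeps `θ` in the open interval `(0,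
  -- π)`, so `sin θ ≠ 0`.
  set k := ⌊min (θ E₂) (θ E₃) * (q + 1) / Real.pi⌋₊ + 1 with hk
  have hk1 : min (θ E₂) (θ E₃) < k * Real.pi / (q + 1) := by
    have h1 := Nat.lt_floor_add_one (min (θ E₂) (θ E₃) * (q + 1) / Real.pi)
    rw [div_lt_iff₀ Real.pi_pos] at h1
    rw [lt_div_iff₀ hqpos, hk]
    push_cast
    exact h1
  have hk2 : k * Real.pi / (q + 1) < max (θ E₂) (θ E₃) := by
    have h1 := Nat.floor_le (a := min (θ E₂) (θ E₃) * (q + 1) / Real.pi) (by positivity)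
    rw [le_div_iff₀ Real.pi_pos] at h1
    rw [div_lt_iff₀ hqpos, hmaxmin, hk]
    push_cast
    nlinarith
  obtain ⟨E₁, hE₁, hE₁θ⟩ : ∃ E₁ ∈ Set.Icc E₂ E₃, θ E₁ = k * Real.pi / (q + 1) := by
    have h1 := intermediate_value_uIcc (a := E₂) (b := E₃) hθc.continuousOn
    rw [Set.uIcc_of_le hE₃.1.le] at h1
    have h2 : (k * Real.pi / (q + 1) : ℝ) ∈ Set.uIcc (θ E₂) (θ E₃) := ⟨hk1.le, hk2.le⟩
    exact h1 h2
  obtain ⟨h1, h2⟩ := hIcc E₁ hE₁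
  -- The energy and the period are fixed before the size `δ` of the perturbation; part (a) depends
  -- on this order.
  refine ⟨E₁, h1, fun δ hδ => ?_⟩
  have h2' := abs_lt.1 h2
  have htr : (transfer (fun j => E₁ - v j) 0 p).trace = 2 * Real.cos (θ E₁) := by
    rw [hθ, ← eval_discriminant, Real.cos_arccos (by linarith) (by linarith)]
    ring
  have hsin : Real.sin (θ E₁) ≠ 0 := by
    refine (Real.sin_pos_of_pos_of_lt_pi ?_ ?_).ne'
    · rw [hE₁θ]
      exact hmin.trans_lt hk1
    · rw [hE₁θ]
      exact hk2.trans_le (max_le (Real.arccos_le_pi _) (Real.arccos_le_pi _))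
  obtain ⟨η, hη, hpow⟩ := pow_eq_smul_one _ (det_transfer _ 0 p) htr hsin (q := q) k (by
    rw [hE₁θ]
    field_simp)
  rw [← transfer_mul_period 0 (fun k => by simp only [hv])] at hpow
  have hN2 : 2 ≤ p * (q + 1) := by nlinarith
  obtain ⟨v', hv'1, hv'2, hv'3⟩ :=
    exists_perturbation_of_transfer_eq v hN2 (hvq (q + 1)) E₁ η hη hpow hδ
  exact ⟨v', hv'1, hv'2, p * (q + 1), by omega, hv'1, hv'3⟩

/-- Squaring gives `tr(M²) = (tr M)² - 2`, and `(2 + x)² - 2 ≥ 2 + 4x` for `x ≥ 0`. -/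
lemma two_add_le_abs_trace_pow (M : Matrix (Fin 2) (Fin 2) ℝ) (hM : M.det = 1) {η : ℝ}
    (hη : 0 ≤ η) (h : 2 + η ≤ |M.trace|) (s : ℕ) : 2 + 4 ^ s * η ≤ |(M ^ 2 ^ s).trace| := by
  induction s with
  | zero => simpa using h
  | succ s ih =>
    rw [pow_succ 2, pow_mul, sq, sq_eq_of_det_eq_one _ (by rw [Matrix.det_pow, hM, one_pow]),
      Matrix.trace_sub, Matrix.trace_smul, Matrix.trace_one, smul_eq_mul, Fintype.card_fin]
    have h1 : 0 ≤ 4 ^ s * η := by positivity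
    have h2 : (2 + 4 ^ s * η) ^ 2 ≤ (M ^ 2 ^ s).trace ^ 2 := by
      rw [← sq_abs (Matrix.trace _)]
      exact pow_le_pow_left₀ (by positivity) ih 2
    refine le_trans ?_ (le_abs_self _)
    rw [pow_succ (4 : ℝ)]
    push_cast
    nlinarith

end Gaps

/-! ### Periodic perturbations with short bands. -/

section SmallSpectrum

open Polynomial Matrix

lemma periodic_mul {v : ℤ → ℝ} {p : ℕ} (hv : ∀ k, v (k + p) = v k) (q : ℕ) :
    ∀ k, v (k + (p * q : ℕ)) = v k := by
  intro k
  have h : Function.Periodic v (p : ℤ) := hv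
  have := h.int_mul q k
  push_cast at this ⊢
  rw [mul_comm]
  exact this

lemma periodic_emod {v : ℤ → ℝ} {p : ℕ} (hv : ∀ k, v (k + p) = v k) (q : ℕ) (k : ℤ) :
    v (k % (p * q : ℕ)) = v k := by
  have h : Function.Periodic v ((p * q : ℕ) : ℤ) := periodic_mul hv q
  have := h.int_mul (k / (p * q : ℕ)) (k % (p * q : ℕ))
  rw [← this]
  congr 1
  have h2 := Int.emod_add_mul_ediv k ((p * q : ℕ) : ℤ)
  rw [Int.cast_id, mul_comm (k / _)]
  exact h2

/-- The potential equal to `w i` on the `i`-th block of length `l` in each period of length `N`. -/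
def concatPotential (v : ℤ → ℝ) (N l m : ℕ) (w : Fin m → ℤ → ℝ) (n : ℤ) : ℝ :=
  if h : (n % N).toNat / l < m then w ⟨(n % N).toNat / l, h⟩ (n % N) else v (n % N)

lemma concatPotential_apply (v : ℤ → ℝ) {N l m : ℕ} (hN : m * l ≤ N) (w : Fin m → ℤ → ℝ)
    (i : Fin m) {k : ℕ} (h1 : i * l ≤ k) (h2 : k < i * l + l) :
    concatPotential v N l m w k = w i k := by
  have hl : 0 < l := by omega
  have hi : ((i : ℕ) + 1) * l ≤ m * l := Nat.mul_le_mul_right _ i.2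
  have hk : k < N := by
    rw [add_mul, one_mul] at hi
    omega
  have e : (k : ℤ) % N = k := Int.emod_eq_of_lt (by omega) (by omega)
  have e2 : k / l = i := by
    rw [Nat.div_eq_iff hl]
    omega
  unfold concatPotential
  rw [e, Int.toNat_natCast]
  simp only [e2]
  simp

/-- Periodic perturbations with small spectrum, in terms of the discriminant. -/
lemma exists_small_bands (v : ℤ → ℝ) {p : ℕ} (hp : 0 < p) (hv : ∀ k, v (k + p) = v k)
    {δ ε : ℝ} (hδ : 0 < δ) (hε : 0 < ε) (c : ℝ) :
    ∃ Q : ℕ, ∀ q : ℕ, Q ≤ q → ∃ v' : ℤ → ℝ, (∀ k, v' (k + (p * q : ℕ)) = v' k) ∧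
      (∀ k, |v' k - v k| ≤ δ) ∧
      volume {E ∈ Set.Icc (-c) c | |(discriminant v' (p * q)).eval E| ≤ 2} ≤ ENNReal.ofReal ε := by
  have hloc : ∀ E₀ : ℝ, ∃ (w : ℤ → ℝ) (r : ℕ) (η : ℝ), 0 < η ∧ (∀ k, |w k - v k| ≤ δ) ∧
      (∀ k, w (k + r) = w k) ∧ 2 + η < |(discriminant w r).eval E₀| := by
    intro E₀
    obtain ⟨Q, hQ⟩ := exists_gap_perturbation v hp hv E₀ (half_pos hδ)
    obtain ⟨E₁, hE₁, h⟩ := hQ Q le_rfl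
    obtain ⟨v', -, h2, r, -, h4, h5⟩ := h (δ / 2) (half_pos hδ)
    -- Adding the constant `E₀ - E₁` moves the gap from `E₁` onto `E₀`, at the cost of the other
    -- half of `δ`.
    refine ⟨fun k => v' k + (E₀ - E₁), r, (|(discriminant v' r).eval E₁| - 2) / 2, by linarith,
      fun k => ?_, fun k => by simp only [h4], ?_⟩
    · rw [add_sub_right_comm]
      refine (abs_add_le _ _).trans ?_
      rw [abs_sub_comm E₀]
      linarith [h2 k]
    · have : (discriminant (fun k => v' k + (E₀ - E₁)) r).eval E₀ =
          (discriminant v' r).eval E₁ := by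
        rw [eval_discriminant, eval_discriminant]
        congr 2
        ext k
        ring
      rw [this]
      linarith
  choose w r η hη hwv hwp hgap using hloc
  obtain ⟨t, ht⟩ := (isCompact_Icc (a := -c) (b := c)).elim_finite_subcover
    (fun E₀ : ℝ => {E | 2 + η E₀ < |(discriminant (w E₀) (r E₀)).eval E|})
    (fun E₀ => isOpen_lt continuous_const (Polynomial.continuous _).abs)
    (fun E _ => Set.mem_iUnion.2 ⟨E, hgap E⟩)
  -- The extra `1` keeps the number of blocks positive when the subcover is empty.
  set M : ℕ := t.card + 1 with hM
  have hMpos : (0 : ℝ) < M := by positivity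
  set e := t.equivFin
  -- Makes `8πN / (K · N/(4M))` equal to `ε`.
  set K : ℝ := 32 * Real.pi * M / ε with hK
  have hKpos : 0 < K := by have := Real.pi_pos; positivity
  have hs : ∀ E₀, ∃ s : ℕ, K ≤ 2 + 4 ^ s * η E₀ := fun E₀ => by
    obtain ⟨s, hs⟩ := pow_unbounded_of_one_lt (K / η E₀) (show (1 : ℝ) < 4 by norm_num)
    rw [div_lt_iff₀ (hη E₀)] at hs
    exact ⟨s, by linarith⟩
  choose s hs using hs
  set R : ℕ := ∑ E₀ ∈ t, r E₀ * 2 ^ s E₀ with hR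
  -- With `N ≥ 4M(R + 1)`, a block, of length greater than `N/M - 1`, still has at least `N/(4M)`
  -- starting points after giving up the `R` sites that the longest growth window may need.
  refine ⟨4 * M * R + 4 * M, fun q hq => ?_⟩
  set N := p * q with hN
  have hNq : q ≤ N := Nat.le_mul_of_pos_left q hp
  have hNpos : 0 < N := by omega
  set l := N / M with hl
  have hMl : t.card * l ≤ N := by
    have : M * l ≤ N := Nat.mul_div_le N M
    rw [hM, add_mul] at this
    omega
  set v' := concatPotential v N l t.card fun i => w (e.symm i) with hv'
  have hv'p : ∀ k, v' (k + N) = v' k := fun k => by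
    simp only [hv', concatPotential, Int.add_emod_right]
  refine ⟨v', hv'p, fun k => ?_, ?_⟩
  · rw [← periodic_emod hv q k, ← hN]
    simp only [hv', concatPotential]
    split_ifs with h
    · exact hwv _ _
    · simp only [sub_self, abs_zero]
      exact hδ.le
  · have hL : (0 : ℝ) < N / (4 * M) := by positivity
    refine (volume_bands_le v' hNpos hv'p measurableSet_Icc hKpos hL fun E hE => ?_).trans
      (ENNReal.ofReal_le_ofReal (le_of_eq ?_))
    · obtain ⟨E₀, hE₀, hEE₀⟩ := Set.mem_iUnion₂.1 (ht hE)
      set i : Fin t.card := e ⟨E₀, hE₀⟩ with hi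
      have hei : (e.symm i : ℝ) = E₀ := by simp [hi]
      set r' := r E₀ * 2 ^ s E₀ with hr'
      have hrR : r' ≤ R :=
        Finset.single_le_sum (f := fun E₀ => r E₀ * 2 ^ s E₀) (fun _ _ => Nat.zero_le _) hE₀
      have hlR : (N : ℝ) / (4 * M) ≤ (l : ℝ) - R := by
        have h1 : (N : ℝ) / M < l + 1 := by
          rw [div_lt_iff₀ hMpos]
          have := Nat.lt_div_mul_add (a := N) (show 0 < M by omega)
          have : N < (l + 1) * M := by rw [add_mul, one_mul]; exact this
          exact_mod_cast this
        have h2 : (4 * M * R + 4 * M : ℝ) ≤ N := by exact_mod_cast hq.trans hNq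
        have h3 : (R : ℝ) + 1 ≤ N / (4 * M) := by
          rw [le_div_iff₀ (by positivity)]
          linarith
        have h4 : (N : ℝ) / M = 4 * (N / (4 * M)) := by
          field_simp
        linarith
      have hlR' : R ≤ l := by
        have : (R : ℝ) ≤ l := by linarith
        exact_mod_cast this
      have hil : (i : ℕ) * l + l ≤ N := by
        have : ((i : ℕ) + 1) * l ≤ t.card * l := Nat.mul_le_mul_right _ i.2
        rw [add_mul, one_mul] at this
        omega
      refine ⟨i * l, r', l - r', ?_, by omega, fun k hk1 hk2 => ?_⟩
      · rw [Nat.cast_sub (hrR.trans hlR')]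
        have : (r' : ℝ) ≤ R := by exact_mod_cast hrR
        linarith
      · have htr : transfer (fun j => E - v' j) k r' = transfer (fun j => E - w E₀ j) k r' := by
          refine transfer_congr fun j hj => ?_
          have h1 := concatPotential_apply v hMl (fun i => w (e.symm i)) i (k := k + j) (by omega)
            (by omega)
          rw [hei] at h1
          push_cast at h1
          simp only [hv', h1]
        have hwE : ∀ k, (fun j => E - w E₀ j) (k + r E₀) = (fun j => E - w E₀ j) k := fun k => by
          simp only [hwp]
        rw [htr, hr', transfer_mul_period _ hwE]
        refine (hs E₀).trans (two_add_le_abs_trace_pow _ (det_transfer _ _ _) (hη E₀).le ?_ _)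
        rw [trace_transfer _ hwE, ← eval_discriminant]
        exact le_of_lt hEE₀
    · rw [hK]
      have := Real.pi_pos
      have : (0 : ℝ) < N := by exact_mod_cast hNpos
      field_simp
      norm_num

end SmallSpectrum

/-! ### The diagonal Green function of a periodic operator. -/

section GreenFunction

open Polynomial Filter Topology

/-- The quadratic form is conserved by the recursion and tends to zero along the sequence. -/
lemma sq_add_sq_eq_of_tendsto_zero {b : ℕ → ℂ} {ζ : ℂ} (hb : Tendsto b atTop (𝓝 0))
    (hrec : ∀ k, b (k + 2) = ζ * b (k + 1) - b k) :
    b 1 ^ 2 + b 0 ^ 2 - ζ * b 0 * b 1 = 0 := by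
  have hconst : ∀ k, b (k + 1) ^ 2 + b k ^ 2 - ζ * b k * b (k + 1) =
      b 1 ^ 2 + b 0 ^ 2 - ζ * b 0 * b 1 := by
    intro k
    induction k with
    | zero => rfl
    | succ k ih =>
      rw [← ih, show k + 1 + 1 = k + 2 from rfl, hrec]
      ring
  have hb1 : Tendsto (fun k => b (k + 1)) atTop (𝓝 0) := (tendsto_add_atTop_iff_nat 1).2 hb
  have hlim : Tendsto (fun k => b (k + 1) ^ 2 + b k ^ 2 - ζ * b k * b (k + 1)) atTop
      (𝓝 (0 ^ 2 + 0 ^ 2 - ζ * 0 * 0)) :=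
    ((hb1.pow 2).add (hb.pow 2)).sub ((hb.const_mul ζ).mul hb1)
  simp only [hconst] at hlim
  simpa using tendsto_nhds_unique tendsto_const_nhds hlim

/-- A decaying solution of the free equation with a source at the origin. -/
lemma sq_source_eq {a : ℤ → ℂ} {ζ D : ℂ} (ha : Tendsto (fun k => ‖a k‖) cofinite (𝓝 0))
    (h0 : ζ * a 0 - a 1 - a (-1) = D) (hk : ∀ k ≠ 0, ζ * a k - a (k + 1) - a (k - 1) = 0) :
    a 0 ^ 2 * (ζ ^ 2 - 4) = D ^ 2 := by
  rw [← tendsto_zero_iff_norm_tendsto_zero] at ha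
  have hpos : Tendsto (fun k : ℕ => a k) atTop (𝓝 0) :=
    (ha.comp (Nat.cast_injective.tendsto_cofinite)).mono_left Nat.cofinite_eq_atTop.ge
  have hneg : Tendsto (fun k : ℕ => a (-k)) atTop (𝓝 0) :=
    (ha.comp ((neg_injective.comp Nat.cast_injective).tendsto_cofinite)).mono_left
      Nat.cofinite_eq_atTop.ge
  have hr1 : ∀ k : ℕ, a ((k + 2 : ℕ) : ℤ) = ζ * a ((k + 1 : ℕ) : ℤ) - a k := fun k => by
    have := hk (k + 1) (by omega)
    rw [add_sub_cancel_right, add_assoc] at this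
    push_cast
    rw [eq_comm, ← sub_eq_zero, ← this]
    ring_nf
  have hr2 : ∀ k : ℕ, a (-((k + 2 : ℕ) : ℤ)) = ζ * a (-((k + 1 : ℕ) : ℤ)) - a (-k) := fun k => by
    have := hk (-(k + 1)) (by omega)
    rw [show -((k : ℤ) + 1) + 1 = -k by ring, show -((k : ℤ) + 1) - 1 = -(k + 2) by ring] at this
    push_cast
    rw [eq_comm, ← sub_eq_zero, ← this]
  have e1 := sq_add_sq_eq_of_tendsto_zero hpos hr1
  -- The odd part vanishes at `0`, so its conserved quantity forces it to vanish at `1` too: `a 1 =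
  -- a (-1)`.
  have e2 := sq_add_sq_eq_of_tendsto_zero (b := fun k : ℕ => a k - a (-k)) (ζ := ζ)
    (by simpa using hpos.sub hneg) fun k => by
      simp only [hr1, hr2]
      ring
  simp only [Nat.cast_zero, Nat.cast_one, neg_zero, sub_self, mul_zero, zero_mul, sub_zero] at e1 e2
  have e3 : a 1 = a (-1) := by
    have : (a 1 - a (-1)) ^ 2 = 0 := by linear_combination e2
    exact sub_eq_zero.1 (pow_eq_zero_iff (two_ne_zero) |>.1 this)
  rw [← h0, ← e3]
  linear_combination (-4) * e1

/-- The unit vector at the origin. -/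
noncomputable def siteVector : ℓ^2(ℤ, ℂ) := lp.single 2 (0 : ℤ) (1 : ℂ)

lemma siteVector_apply_ne {n : ℤ} (hn : n ≠ 0) : siteVector n = 0 := by
  rw [siteVector, lp.single_apply_ne _ _ _ hn]

lemma siteVector_apply_zero : siteVector 0 = 1 := by
  rw [siteVector, lp.single_apply_self]

/-- Finite propagation: each application of the operator spreads the support by one site. -/
lemma schrodinger_pow_apply_eq_zero (V : ℓ^∞(ℤ, ℝ)) (j : ℕ) {n : ℤ} (hn : j < n.natAbs) :
    ((schrodinger V ^ j) siteVector) n = 0 := by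
  induction j generalizing n with
  | zero =>
    change siteVector n = 0
    exact siteVector_apply_ne (by omega)
  | succ j ih =>
    rw [pow_succ']
    change schrodinger V ((schrodinger V ^ j) siteVector) n = 0
    rw [schrodinger_apply, ih (by omega), ih (by omega), ih (by omega)]
    simp

/-- The diagonal element at the origin of `(Δ(z) - Δ(H)) / (z - H)`. -/
noncomputable def greenNumerator (V : ℓ^∞(ℤ, ℝ)) (N : ℕ) (z : ℂ) : ℂ :=
  ∑ k ∈ Finset.range (N + 1), ((discriminant V N).coeff k : ℂ) *
    ∑ i ∈ Finset.range k, z ^ i * ((schrodinger V ^ (k - 1 - i)) siteVector) 0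

/-- The discriminant at a complex energy. -/
noncomputable def complexDiscriminant (V : ℤ → ℝ) (N : ℕ) (z : ℂ) : ℂ :=
  ∑ k ∈ Finset.range (N + 1), ((discriminant V N).coeff k : ℂ) * z ^ k

lemma complexDiscriminant_ofReal (V : ℤ → ℝ) {N : ℕ} (hN : 0 < N) (E : ℝ) :
    complexDiscriminant V N E = ((discriminant V N).eval E : ℝ) := by
  rw [complexDiscriminant, eval_eq_sum_range, natDegree_discriminant V hN]
  push_cast
  rfl

/-- Let `W = (Δ(z) - Δ(H)) / (z - H)`, a polynomial in `H` of degree below `N`. Since `Δ(H)` is a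
sum of two shifts by `N`, the samples `u (k N)` solve the free equation at energy `Δ(z)` with source
`W δ₀`. Finite propagation confines that source to `k = 0`, and `sq_source_eq` applies. -/
lemma sq_green_mul (V : ℓ^∞(ℤ, ℝ)) {N : ℕ} (hN : 0 < N) (hV : ∀ k, V (k + N) = V k) {z : ℂ}
    {u : ℓ^2(ℤ, ℂ)} (hu : z • u - schrodinger V u = siteVector) :
    u 0 ^ 2 * (complexDiscriminant V N z ^ 2 - 4) = greenNumerator V N z ^ 2 := by
  set A : ℓ^2(ℤ, ℂ) →L[ℂ] ℓ^2(ℤ, ℂ) := schrodinger V with hA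
  set W : ℓ^2(ℤ, ℂ) →L[ℂ] ℓ^2(ℤ, ℂ) := ∑ k ∈ Finset.range (N + 1),
    ((discriminant V N).coeff k : ℂ) •
      ∑ i ∈ Finset.range k, (z • (1 : ℓ^2(ℤ, ℂ) →L[ℂ] ℓ^2(ℤ, ℂ))) ^ i * A ^ (k - 1 - i) with hW
  have hfac : W * (z • 1 - A) = complexDiscriminant V N z • 1 - (lpShift N + lpShift (-N)) := by
    rw [← aeval_discriminant V hV, hW, Finset.sum_mul, complexDiscriminant, Finset.sum_smul,
      aeval_eq_sum_range, natDegree_discriminant V hN, ← Finset.sum_sub_distrib]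
    refine Finset.sum_congr rfl fun k _ => ?_
    have hcomm : Commute (z • (1 : ℓ^2(ℤ, ℂ) →L[ℂ] ℓ^2(ℤ, ℂ))) A :=
      (Commute.one_left A).smul_left z
    rw [smul_mul_assoc, hcomm.geom_sum₂_mul, smul_sub, _root_.smul_pow, one_pow, smul_smul]
    congr 1
  have hWu : complexDiscriminant V N z • u - (lpShift N u + lpShift (-N) u) = W siteVector := by
    rw [← hu]
    exact (congrArg (fun B : ℓ^2(ℤ, ℂ) →L[ℂ] ℓ^2(ℤ, ℂ) => B u) hfac).symm
  have hWapp : ∀ n : ℤ, W siteVector n = ∑ k ∈ Finset.range (N + 1),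
      ((discriminant V N).coeff k : ℂ) *
        ∑ i ∈ Finset.range k, z ^ i * ((A ^ (k - 1 - i)) siteVector) n := fun n => by
    simp only [hW, _root_.sum_apply, lp.coeFn_sum, Finset.sum_apply, _root_.smul_pow, one_pow,
      smul_mul_assoc, one_mul, _root_.smul_apply, lp.coeFn_smul, Pi.smul_apply, smul_eq_mul]
  have hWne : ∀ k : ℤ, k ≠ 0 → W siteVector (k * N) = 0 := fun k hk => by
    rw [hWapp]
    refine Finset.sum_eq_zero fun j hj => ?_
    rw [Finset.sum_eq_zero, mul_zero]
    intro i hi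
    rw [Finset.mem_range] at hi hj
    rw [schrodinger_pow_apply_eq_zero, mul_zero]
    rw [Int.natAbs_mul, Int.natAbs_natCast]
    have : N ≤ k.natAbs * N := Nat.le_mul_of_pos_left N (by omega)
    omega
  have hpt : ∀ k : ℤ, complexDiscriminant V N z * u (k * N) - u ((k + 1) * N) - u ((k - 1) * N) =
      W siteVector (k * N) := fun k => by
    rw [← hWu, add_mul, sub_mul, one_mul]
    change _ = complexDiscriminant V N z * u (k * N) - (u (k * N + N) + u (k * N + -N))
    rw [← sub_eq_add_neg]
    ring
  have hNz : (N : ℤ) ≠ 0 := by exact_mod_cast hN.ne'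
  have key := sq_source_eq (a := fun k => u (k * N)) (ζ := complexDiscriminant V N z)
    (D := greenNumerator V N z)
    ((tendsto_lp_cofinite u).comp (mul_left_injective₀ hNz).tendsto_cofinite)
    (by
      have h1 : W siteVector 0 = greenNumerator V N z := hWapp 0
      have := hpt 0
      rw [zero_mul, h1] at this
      simp only [zero_mul]
      simpa using this)
    (fun k hk => by rw [hpt, hWne k hk])
  simpa using key

/-- With `B = E - A` and `G = (B² + ε²)⁻¹`, the vector `(B - iε) G ψ` is the resolvent applied to
`ψ`. Only real functional calculus is involved, and self-adjointness of `B G` and `G` isolates the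
imaginary part. -/
lemma exists_green_vector {H : Type*} [NormedAddCommGroup H] [InnerProductSpace ℂ H]
    [CompleteSpace H] (A : H →L[ℂ] H) (hA : IsSelfAdjoint A) (ψ : H) (E : ℝ) {ε : ℝ} (hε : 0 < ε) :
    ∃ u : H, ((E : ℂ) + ε * Complex.I) • u - A u = ψ ∧
      (⟪ψ, u⟫_ℂ).im = -∫ x, ε / ((x - E) ^ 2 + ε ^ 2) ∂(spectralMeasure A hA ψ) := by
  set g : ℝ → ℝ := fun x => ((x - E) ^ 2 + ε ^ 2)⁻¹ with hg
  have hpos : ∀ x : ℝ, (x - E) ^ 2 + ε ^ 2 ≠ 0 := fun x => by positivity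
  have hgc : Continuous g := Continuous.inv₀ (by fun_prop) hpos
  have hB : cfc (fun x : ℝ => E - x) A = (E : ℂ) • 1 - A := by
    rw [cfc_sub (fun _ => E) (fun x : ℝ => x) A, cfc_id' ℝ A, cfc_const E A]
    congr 1
  set G := cfc g A with hG
  set B := (E : ℂ) • (1 : H →L[ℂ] H) - A with hBdef
  have hBB : (B * B + ((ε : ℂ) ^ 2) • 1) * G = 1 := by
    have h1 : B * B + ((ε : ℂ) ^ 2) • 1 = cfc (fun x : ℝ => (E - x) * (E - x) + ε ^ 2) A := by
      rw [cfc_add (a := A) (fun x : ℝ => (E - x) * (E - x)) (fun _ => ε ^ 2),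
        cfc_mul (fun x : ℝ => E - x) (fun x : ℝ => E - x) A, hB, cfc_const (ε ^ 2) A]
      congr 1
      rw [Algebra.algebraMap_eq_smul_one]
      ext φ
      simp only [_root_.smul_apply]
      rw [← Complex.ofReal_pow]
      rfl
    rw [h1, hG, ← cfc_mul _ _ A (by fun_prop) hgc.continuousOn, ← cfc_const_one ℝ A]
    refine cfc_congr fun x _ => ?_
    have : (E - x) * (E - x) + ε ^ 2 = (x - E) ^ 2 + ε ^ 2 := by ring
    rw [this]
    exact mul_inv_cancel₀ (hpos x)
  refine ⟨B (G ψ) - (ε * Complex.I : ℂ) • G ψ, ?_, ?_⟩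
  · have h1 := congrArg (fun C : H →L[ℂ] H => C ψ) hBB
    simp only [mul_apply_eq_comp, _root_.add_apply, _root_.smul_apply, one_apply_eq_self] at h1
    have h2 : ∀ φ : H, B φ = (E : ℂ) • φ - A φ := fun φ => rfl
    have h3 : ∀ φ : H, A φ = (E : ℂ) • φ - B φ := fun φ => by rw [h2]; abel
    have h4 : ∀ φ : H, (ε * Complex.I : ℂ) • ((ε * Complex.I : ℂ) • φ) = -(ε ^ 2 : ℂ) • φ := by
      intro φ
      rw [smul_smul, mul_mul_mul_comm, Complex.I_mul_I]
      ring_nf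
    refine Eq.trans ?_ h1
    generalize G ψ = φ
    rw [h3, map_sub, map_smul, add_smul, smul_sub (ε * Complex.I : ℂ), h4]
    module
  · have hreal : ∀ C : H →L[ℂ] H, IsSelfAdjoint C → (⟪ψ, C ψ⟫_ℂ).im = 0 := fun C hC => by
      rw [ContinuousLinearMap.isSelfAdjoint_iff_isSymmetric] at hC
      have h := hC ψ ψ
      have h2 := inner_conj_symm (𝕜 := ℂ) ψ (C ψ)
      change ⟪C ψ, ψ⟫_ℂ = ⟪ψ, C ψ⟫_ℂ at h
      rw [h] at h2
      exact Complex.conj_eq_iff_im.1 h2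
    have hBG : B * G = cfc (fun x => (E - x) * g x) A := by
      rw [cfc_mul (fun x : ℝ => E - x) g A (by fun_prop) hgc.continuousOn, hB]
    have h1 : (⟪ψ, B (G ψ)⟫_ℂ).im = 0 := by
      have := hreal (B * G) (hBG ▸ cfc_predicate _ A)
      exact this
    have h2 := hreal G (cfc_predicate g A)
    have h3 := integral_spectralMeasure_of_continuous A hA ψ hgc
    rw [inner_sub_right, inner_smul_right, Complex.sub_im, h1, Complex.mul_im, h2]
    simp only [div_eq_mul_inv, integral_const_mul]
    rw [h3]
    simp only [hG]
    simp

end GreenFunction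

/-! ### Boundary values of Poisson integrals. -/

section PoissonKernel

open Filter Topology

lemma tendsto_poisson_apply (g : C_c(ℝ, ℝ)) (x : ℝ) {c : ℝ} (hc : ∀ y, |g y| ≤ c) :
    Tendsto (fun ε : ℝ => ∫ t, g (x + ε * t) * (1 + t ^ 2)⁻¹) (𝓝[>] 0) (𝓝 (g x * Real.pi)) := by
  have h1 : ∫ t : ℝ, g x * (1 + t ^ 2)⁻¹ = g x * Real.pi := by
    rw [integral_const_mul, integral_univ_inv_one_add_sq]
  rw [← h1]
  have hpos : ∀ t : ℝ, 1 + t ^ 2 ≠ 0 := fun t => by positivity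
  refine tendsto_integral_filter_of_dominated_convergence (fun t => c * (1 + t ^ 2)⁻¹) ?_ ?_ ?_ ?_
  · refine Eventually.of_forall fun ε => Continuous.aestronglyMeasurable ?_
    exact (g.continuous.comp (by fun_prop)).mul (Continuous.inv₀ (by fun_prop) hpos)
  · refine Eventually.of_forall fun ε => Eventually.of_forall fun t => ?_
    rw [norm_mul, Real.norm_eq_abs, Real.norm_of_nonneg (by positivity : 0 ≤ (1 + t ^ 2)⁻¹)]
    exact mul_le_mul_of_nonneg_right (hc _) (by positivity)
  · exact integrable_inv_one_add_sq.const_mul c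
  · refine Eventually.of_forall fun t => Tendsto.mul_const _ ?_
    have h2 : Continuous fun ε : ℝ => g (x + ε * t) := g.continuous.comp (by fun_prop)
    have h3 := (h2.tendsto 0).mono_left (nhdsWithin_le_nhds (s := Set.Ioi 0))
    simpa using h3

lemma integral_mul_poisson (g : C_c(ℝ, ℝ)) (x : ℝ) {ε : ℝ} (hε : 0 < ε) :
    ∫ E, g E * (ε / ((x - E) ^ 2 + ε ^ 2)) = ∫ t, g (x + ε * t) * (1 + t ^ 2)⁻¹ := by
  have h1 := integral_add_left_eq_self (μ := (volume : Measure ℝ))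
    (fun E => g E * (ε / ((x - E) ^ 2 + ε ^ 2))) x
  have h2 := Measure.integral_comp_mul_left
    (fun y => g (x + y) * (ε / ((x - (x + y)) ^ 2 + ε ^ 2))) ε
  rw [← h1]
  rw [abs_of_pos (inv_pos.2 hε), smul_eq_mul, eq_comm, inv_mul_eq_iff_eq_mul₀ hε.ne'] at h2
  rw [h2, ← integral_const_mul]
  refine integral_congr_ae (Eventually.of_forall fun t => ?_)
  simp only
  have : (1 + t ^ 2) ≠ 0 := by positivity
  have h3 : (x - (x + ε * t)) ^ 2 + ε ^ 2 = ε ^ 2 * (1 + t ^ 2) := by ring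
  rw [h3]
  field_simp

lemma exists_abs_le_compactlySupported (g : C_c(ℝ, ℝ)) : ∃ c, ∀ y, |g y| ≤ c :=
  g.hasCompactSupport.exists_bound_of_continuous g.continuous

/-- Poisson integrals of a finite measure converge to the measure. -/
lemma tendsto_integral_poisson (μ : Measure ℝ) [IsFiniteMeasure μ] (g : C_c(ℝ, ℝ)) :
    Tendsto (fun ε : ℝ => ∫ E, g E * ∫ x, ε / ((x - E) ^ 2 + ε ^ 2) ∂μ) (𝓝[>] 0)
      (𝓝 (Real.pi * ∫ x, g x ∂μ)) := by
  obtain ⟨c, hc⟩ := exists_abs_le_compactlySupported g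
  -- Fubini and the substitution `E = x + ε t` move the kernel onto `g`, where dominated convergence
  -- applies.
  have hswap : ∀ ε : ℝ, 0 < ε → ∫ E, g E * ∫ x, ε / ((x - E) ^ 2 + ε ^ 2) ∂μ =
      ∫ x, (∫ t, g (x + ε * t) * (1 + t ^ 2)⁻¹) ∂μ := by
    intro ε hε
    simp only [← integral_const_mul]
    rw [integral_integral_swap]
    · exact integral_congr_ae (Eventually.of_forall fun x => integral_mul_poisson g x hε)
    · have hpos : ∀ q : ℝ × ℝ, (q.2 - q.1) ^ 2 + ε ^ 2 ≠ 0 := fun q => by positivity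
      have hcont : Continuous fun q : ℝ × ℝ => g q.1 * (ε / ((q.2 - q.1) ^ 2 + ε ^ 2)) :=
        (g.continuous.comp continuous_fst).mul (Continuous.div (by fun_prop) (by fun_prop) hpos)
      have hint : Integrable (fun q : ℝ × ℝ => |g q.1| * ε⁻¹) (volume.prod μ) :=
        ((g.continuous.integrable_of_hasCompactSupport g.hasCompactSupport).abs.comp_fst μ).mul_const _
      refine hint.mono' hcont.aestronglyMeasurable (Eventually.of_forall fun q => ?_)
      simp only [Function.uncurry]
      rw [norm_mul, Real.norm_eq_abs, Real.norm_of_nonneg (by positivity)]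
      refine mul_le_mul_of_nonneg_left ?_ (abs_nonneg _)
      rw [div_le_iff₀ (by positivity), inv_mul_eq_div, le_div_iff₀ hε]
      nlinarith [sq_nonneg (q.2 - q.1)]
  have hlim : Tendsto (fun ε : ℝ => ∫ x, (∫ t, g (x + ε * t) * (1 + t ^ 2)⁻¹) ∂μ) (𝓝[>] 0)
      (𝓝 (∫ x, g x * Real.pi ∂μ)) := by
    refine tendsto_integral_filter_of_dominated_convergence (fun _ => c * Real.pi) ?_ ?_
      (integrable_const _) (Eventually.of_forall fun x => tendsto_poisson_apply g x hc)
    · refine Eventually.of_forall fun ε => ?_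
      have hm : StronglyMeasurable (Function.uncurry fun x t : ℝ => g (x + ε * t) * (1 + t ^ 2)⁻¹) := by
        refine Continuous.stronglyMeasurable ?_
        simp only [Function.uncurry_def]
        exact (g.continuous.comp (by fun_prop)).mul
          (Continuous.inv₀ (by fun_prop) fun q => by positivity)
      exact hm.integral_prod_right.aestronglyMeasurable
    · refine Eventually.of_forall fun ε => Eventually.of_forall fun x => ?_
      rw [← integral_univ_inv_one_add_sq, ← integral_const_mul]
      refine norm_integral_le_of_norm_le (integrable_inv_one_add_sq.const_mul c)
        (Eventually.of_forall fun t => ?_)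
      rw [norm_mul, Real.norm_eq_abs, Real.norm_of_nonneg (by positivity : 0 ≤ (1 + t ^ 2)⁻¹)]
      exact mul_le_mul_of_nonneg_right (hc _) (by positivity)
  rw [integral_mul_const, mul_comm] at hlim
  refine hlim.congr' ?_
  filter_upwards [self_mem_nhdsWithin] with ε hε using (hswap ε hε).symm

end PoissonKernel

/-! ### The density of the spectral measure at the origin. -/

section DensityOfStates

open Polynomial Filter Topology

/-- The square of the diagonal Green function at the origin. -/
noncomputable def greenSq (V : ℓ^∞(ℤ, ℝ)) (N : ℕ) (z : ℂ) : ℂ :=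
  greenNumerator V N z ^ 2 / (complexDiscriminant V N z ^ 2 - 4)

/-- The absolute value of the imaginary part of the diagonal Green function at the origin. -/
noncomputable def absImGreen (V : ℓ^∞(ℤ, ℝ)) (N : ℕ) (z : ℂ) : ℝ :=
  √((‖greenSq V N z‖ - (greenSq V N z).re) / 2)

/-- The size of the imaginary part can be read off from the square alone, so the formula for the
squared Green function suffices and no branch of a root is chosen. -/
lemma sqrt_norm_sub_re (w : ℂ) : √((‖w ^ 2‖ - (w ^ 2).re) / 2) = |w.im| := by
  rw [norm_pow, ← Complex.normSq_eq_norm_sq, Complex.normSq_apply, sq, Complex.mul_re,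
    ← Real.sqrt_sq_eq_abs]
  congr 1
  ring

lemma continuous_greenNumerator (V : ℓ^∞(ℤ, ℝ)) (N : ℕ) : Continuous (greenNumerator V N) := by
  unfold greenNumerator
  fun_prop

lemma continuous_complexDiscriminant (V : ℤ → ℝ) (N : ℕ) :
    Continuous (complexDiscriminant V N) := by
  unfold complexDiscriminant
  fun_prop

lemma measurable_absImGreen (V : ℓ^∞(ℤ, ℝ)) (N : ℕ) : Measurable (absImGreen V N) := by
  have h1 : Measurable (greenSq V N) :=
    ((continuous_greenNumerator V N).measurable.pow_const 2).div
      (((continuous_complexDiscriminant V N).measurable.pow_const 2).sub_const 4)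
  unfold absImGreen
  exact ((h1.norm.sub (Complex.measurable_re.comp h1)).div_const 2).sqrt

lemma continuousOn_absImGreen (V : ℓ^∞(ℤ, ℝ)) (N : ℕ) :
    ContinuousOn (absImGreen V N) {z | complexDiscriminant V N z ^ 2 - 4 ≠ 0} := by
  have h1 : ContinuousOn (greenSq V N) {z | complexDiscriminant V N z ^ 2 - 4 ≠ 0} :=
    ((continuous_greenNumerator V N).pow 2).continuousOn.div
      (((continuous_complexDiscriminant V N).pow 2).sub continuous_const).continuousOn fun _ h => h
  unfold absImGreen
  exact ((h1.norm.sub (Complex.continuous_re.comp_continuousOn h1)).div_const 2).sqrt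

lemma inner_siteVector (u : ℓ^2(ℤ, ℂ)) : ⟪siteVector, u⟫_ℂ = u 0 := by
  rw [siteVector, lp.inner_single_left]
  simp

/-- The spectral measure at the origin. -/
noncomputable abbrev siteMeasure (V : ℓ^∞(ℤ, ℝ)) : Measure ℝ :=
  spectralMeasure (schrodinger V) (isSelfAdjoint_schrodinger V) siteVector

variable {V : ℓ^∞(ℤ, ℝ)} {N : ℕ}

lemma poisson_siteMeasure (hN : 0 < N) (hV : ∀ k, V (k + N) = V k) (E : ℝ) {ε : ℝ} (hε : 0 < ε)
    (hd : complexDiscriminant V N (E + ε * Complex.I) ^ 2 - 4 ≠ 0) :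
    ∫ x, ε / ((x - E) ^ 2 + ε ^ 2) ∂(siteMeasure V) = absImGreen V N (E + ε * Complex.I) := by
  obtain ⟨u, hu, him⟩ := exists_green_vector (schrodinger V) (isSelfAdjoint_schrodinger V)
    siteVector E hε
  rw [inner_siteVector] at him
  have h1 := sq_green_mul V hN hV hu
  have h2 : greenSq V N (E + ε * Complex.I) = u 0 ^ 2 := by
    rw [greenSq, ← h1]
    field_simp
  rw [absImGreen, h2, sqrt_norm_sub_re, him, abs_neg, abs_of_nonneg]
  exact integral_nonneg fun x => by positivity

/-- The energies at which the discriminant differs from `±2`. -/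
def regularEnergies (V : ℓ^∞(ℤ, ℝ)) (N : ℕ) : Set ℝ :=
  {E : ℝ | complexDiscriminant V N E ^ 2 - 4 ≠ 0}

lemma isOpen_regularEnergies : IsOpen (regularEnergies V N) :=
  isOpen_ne_fun ((((continuous_complexDiscriminant V N).comp Complex.continuous_ofReal).pow 2).sub
    continuous_const) continuous_const

lemma finite_compl_regularEnergies (hN : 0 < N) : (regularEnergies V N)ᶜ.Finite := by
  refine (finite_abs_eval_discriminant_eq_two V hN).subset fun E hE => ?_
  rw [regularEnergies, Set.mem_compl_iff, Set.mem_ofPred_eq, not_not,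
    complexDiscriminant_ofReal _ hN] at hE
  have h1 : ((discriminant V N).eval E) ^ 2 = 2 ^ 2 := by
    have : ((((discriminant V N).eval E) ^ 2 - 4 : ℝ) : ℂ) = 0 := by
      push_cast
      exact hE
    have := Complex.ofReal_eq_zero.1 this
    linarith
  have := sq_eq_sq_iff_abs_eq_abs _ _ |>.1 h1
  rwa [abs_two] at this

/-- Tube lemma: `Δ² ≠ 4` on the compact set `K` extends to a strip of uniform height. -/
lemma exists_uniform_regular {K : Set ℝ} (hK : IsCompact K) (hKr : K ⊆ regularEnergies V N) :
    ∃ r > 0, ∀ E ∈ K, ∀ ε : ℝ, |ε| ≤ r →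
      complexDiscriminant V N (E + ε * Complex.I) ^ 2 - 4 ≠ 0 := by
  set F : ℝ × ℝ → ℂ := fun q => complexDiscriminant V N (q.1 + q.2 * Complex.I) ^ 2 - 4 with hF
  have hFc : Continuous F := by
    have h1 : Continuous fun q : ℝ × ℝ => (q.1 : ℂ) + q.2 * Complex.I := by fun_prop
    exact (((continuous_complexDiscriminant V N).comp h1).pow 2).sub continuous_const
  have hO : IsOpen {q | F q ≠ 0} := isOpen_ne_fun hFc continuous_const
  have hsub : K ×ˢ {(0 : ℝ)} ⊆ {q | F q ≠ 0} := by
    rintro ⟨E, ε⟩ ⟨hE, hε⟩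
    have hε0 : ε = 0 := hε
    have h1 : complexDiscriminant V N E ^ 2 - 4 ≠ 0 := hKr hE
    have h2 : F (E, ε) = complexDiscriminant V N E ^ 2 - 4 := by simp [hF, hε0]
    rw [← h2] at h1
    exact h1
  obtain ⟨u, v, -, hv, hKu, h0v, huv⟩ := generalized_tube_lemma hK isCompact_singleton hO hsub
  obtain ⟨r, hr, hrv⟩ := Metric.isOpen_iff.1 hv 0 (h0v rfl)
  have hFne : ∀ E ∈ K, ∀ ε : ℝ, |ε| ≤ r / 2 → F (E, ε) ≠ 0 := by
    intro E hE ε hε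
    have h3 : ε ∈ v := by
      apply hrv
      rw [Metric.mem_ball, Real.dist_eq, sub_zero]
      linarith
    have h4 : (E, ε) ∈ u ×ˢ v := ⟨hKu hE, h3⟩
    exact huv h4
  exact ⟨r / 2, half_pos hr, hFne⟩

lemma tendsto_integral_absImGreen (g : C_c(ℝ, ℝ)) (hg : tsupport g ⊆ regularEnergies V N) :
    Tendsto (fun ε : ℝ => ∫ E : ℝ, g E * absImGreen V N (E + ε * Complex.I)) (𝓝[>] 0)
      (𝓝 (∫ E : ℝ, g E * absImGreen V N E)) := by
  obtain ⟨r, hr, hreg⟩ := exists_uniform_regular g.hasCompactSupport hg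
  have hcont : ContinuousOn (fun q : ℝ × ℝ => absImGreen V N (q.1 + q.2 * Complex.I))
      (tsupport g ×ˢ Set.Icc (-r) r) :=
    (continuousOn_absImGreen V N).comp (by fun_prop) fun q hq =>
      hreg q.1 hq.1 q.2 (abs_le.2 hq.2)
  obtain ⟨C, hC⟩ := (g.hasCompactSupport.prod isCompact_Icc).exists_bound_of_continuousOn hcont
  refine tendsto_integral_filter_of_dominated_convergence (fun E => |g E| * C) ?_ ?_
    ((g.continuous.integrable_of_hasCompactSupport g.hasCompactSupport).abs.mul_const C) ?_
  · refine Eventually.of_forall fun ε => Measurable.aestronglyMeasurable ?_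
    exact g.continuous.measurable.mul ((measurable_absImGreen V N).comp (by fun_prop))
  · filter_upwards [Ioc_mem_nhdsGT hr] with ε hε
    refine Eventually.of_forall fun E => ?_
    by_cases hE : E ∈ tsupport g
    · rw [norm_mul, Real.norm_eq_abs]
      exact mul_le_mul_of_nonneg_left (hC (E, ε) ⟨hE, by linarith [hε.1], hε.2⟩) (abs_nonneg _)
    · simp [image_eq_zero_of_notMem_tsupport hE]
  · refine Eventually.of_forall fun E => ?_
    by_cases hE : E ∈ tsupport g
    · refine Tendsto.const_mul _ ?_
      have h1 : ContinuousOn (fun ε : ℝ => absImGreen V N (E + ε * Complex.I)) (Set.Icc (-r) r) :=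
        (continuousOn_absImGreen V N).comp (by fun_prop) fun ε hε => hreg E hE ε (abs_le.2 hε)
      have h2 : ContinuousAt (fun ε : ℝ => absImGreen V N (E + ε * Complex.I)) 0 :=
        h1.continuousAt (Icc_mem_nhds (by linarith) hr)
      have h3 := h2.tendsto.mono_left (nhdsWithin_le_nhds (s := Set.Ioi 0))
      simpa using h3
    · simp [image_eq_zero_of_notMem_tsupport hE]

/-- The two sides are limits, as the energy approaches the real axis, of the same Poisson integral,
identified by `poisson_siteMeasure`. -/
lemma integral_siteMeasure (hN : 0 < N) (hV : ∀ k, V (k + N) = V k) (g : C_c(ℝ, ℝ))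
    (hg : tsupport g ⊆ regularEnergies V N) :
    Real.pi * ∫ E, g E ∂(siteMeasure V) = ∫ E : ℝ, g E * absImGreen V N E := by
  obtain ⟨r, hr, hreg⟩ := exists_uniform_regular g.hasCompactSupport hg
  refine tendsto_nhds_unique (tendsto_integral_poisson (siteMeasure V) g)
    ((tendsto_integral_absImGreen g hg).congr' ?_)
  filter_upwards [Ioc_mem_nhdsGT hr] with ε hε
  refine integral_congr_ae (Eventually.of_forall fun E => ?_)
  by_cases hE : E ∈ tsupport g
  · simp only
    rw [poisson_siteMeasure hN hV E hε.1 (hreg E hE ε (by rw [abs_of_pos hε.1]; exact hε.2))]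
  · simp [image_eq_zero_of_notMem_tsupport hE]

/-- The density of the spectral measure at the origin. -/
noncomputable def siteDensity (V : ℓ^∞(ℤ, ℝ)) (N : ℕ) (E : ℝ) : ℝ := absImGreen V N E / Real.pi

lemma siteDensity_nonneg (E : ℝ) : 0 ≤ siteDensity V N E :=
  div_nonneg (Real.sqrt_nonneg _) Real.pi_pos.le

lemma measurable_siteDensity (V : ℓ^∞(ℤ, ℝ)) (N : ℕ) : Measurable (siteDensity V N) :=
  ((measurable_absImGreen V N).comp Complex.measurable_ofReal).div_const _

lemma lintegral_siteMeasure (hN : 0 < N) (hV : ∀ k, V (k + N) = V k) (g : C_c(ℝ, ℝ))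
    (hg0 : ∀ x, 0 ≤ g x) (hg : tsupport g ⊆ regularEnergies V N) :
    ∫⁻ E, ENNReal.ofReal (g E) ∂(siteMeasure V) = ∫⁻ E, ENNReal.ofReal (g E)
      ∂(volume.withDensity fun E => ENNReal.ofReal (siteDensity V N E)) := by
  have hm : Measurable fun E => ENNReal.ofReal (siteDensity V N E) :=
    (measurable_siteDensity V N).ennreal_ofReal
  rw [lintegral_compactlySupported _ g hg0, lintegral_withDensity_eq_lintegral_mul _ hm
    (g := fun E => ENNReal.ofReal (g E)) g.continuous.measurable.ennreal_ofReal]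
  have h1 : ∫ E, g E ∂(siteMeasure V) = ∫ E, g E * siteDensity V N E := by
    simp only [siteDensity, mul_div_assoc', integral_div]
    rw [← integral_siteMeasure hN hV g hg, mul_div_cancel_left₀ _ Real.pi_ne_zero]
  rw [h1, ofReal_integral_eq_lintegral_ofReal]
  · refine lintegral_congr fun E => ?_
    rw [Pi.mul_apply, mul_comm, ENNReal.ofReal_mul (siteDensity_nonneg E), mul_comm]
  · have hc : ContinuousOn (fun E => g E * siteDensity V N E) (tsupport g) := by
      refine g.continuous.continuousOn.mul (ContinuousOn.div_const ?_ _)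
      exact (continuousOn_absImGreen V N).comp Complex.continuous_ofReal.continuousOn
        fun E hE => hg hE
    refine (hc.integrableOn_compact g.hasCompactSupport).integrable_of_forall_notMem_eq_zero
      fun E hE => ?_
    rw [image_eq_zero_of_notMem_tsupport hE, zero_mul]
  · exact Eventually.of_forall fun E => mul_nonneg (hg0 E) (siteDensity_nonneg E)

lemma IsGordon.of_periodic {v : ℤ → ℝ} (hN : 0 < N) (hv : ∀ k, v (k + N) = v k) : IsGordon v :=
  fun k => ⟨N * k, Nat.le_mul_of_pos_left k hN, fun n => by
    rw [periodic_mul hv, sub_self, abs_zero]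
    positivity⟩

lemma IsGordon.spectralMeasure_singleton (hV : IsGordon V) (ψ : ℓ^2(ℤ, ℂ)) (E : ℝ) :
    spectralMeasure (schrodinger V) (isSelfAdjoint_schrodinger V) ψ {E} = 0 :=
  spectralMeasure_singleton_eq_zero _ _ E (fun φ hφ => hV.eq_zero_of_eigenvector E φ hφ) ψ

/-- Test functions supported where `Δ² ≠ 4` identify the measures there. The finitely many remaining
energies carry no atom, since periodic potentials satisfy Gordon's condition. -/
lemma siteMeasure_eq_withDensity (hN : 0 < N) (hV : ∀ k, V (k + N) = V k) :
    siteMeasure V = volume.withDensity fun E => ENNReal.ofReal (siteDensity V N E) := by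
  set m := volume.withDensity fun E => ENNReal.ofReal (siteDensity V N E) with hm
  have hfin := finite_compl_regularEnergies (V := V) hN
  have h1 : siteMeasure V (regularEnergies V N)ᶜ = 0 := by
    rw [← Set.biUnion_of_singleton (regularEnergies V N)ᶜ]
    exact (measure_biUnion_null_iff hfin.countable).2 fun E _ =>
      (IsGordon.of_periodic hN hV).spectralMeasure_singleton _ E
  have h2 : m (regularEnergies V N)ᶜ = 0 :=
    withDensity_absolutelyContinuous _ _ (hfin.measure_zero _)
  have hdiff : ∀ (ν : Measure ℝ), ν (regularEnergies V N)ᶜ = 0 → ∀ O, ν O = ν (O ∩ regularEnergies V N) :=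
    fun ν hν O => by
      rw [← Set.sdiff_compl, measure_sdiff_null hν]
  have hopen : ∀ O, IsOpen O → siteMeasure V O = m O := fun O hO => by
    rw [hdiff _ h1, hdiff _ h2]
    have hO' := hO.inter (isOpen_regularEnergies (V := V) (N := N))
    refine le_antisymm (measure_open_le_of_forall_lintegral_le hO' fun g h0 _ hs => ?_)
      (measure_open_le_of_forall_lintegral_le hO' fun g h0 _ hs => ?_)
    · exact (lintegral_siteMeasure hN hV g h0 (hs.trans Set.inter_subset_right)).le
    · exact (lintegral_siteMeasure hN hV g h0 (hs.trans Set.inter_subset_right)).ge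
  have : IsFiniteMeasure m := ⟨by
    rw [← hopen _ isOpen_univ]
    exact measure_lt_top _ _⟩
  exact le_antisymm (measure_le_of_forall_isOpen fun O hO => (hopen O hO).le)
    (measure_le_of_forall_isOpen fun O hO => (hopen O hO).ge)

lemma siteMeasure_absolutelyContinuous (hN : 0 < N) (hV : ∀ k, V (k + N) = V k) :
    siteMeasure V ≪ volume := by
  rw [siteMeasure_eq_withDensity hN hV]
  exact withDensity_absolutelyContinuous _ _

end DensityOfStates

/-! ### Continuity of the spectral measure at a fixed period. -/

section TotalVariation

open Polynomial Filter Topology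

lemma continuous_eval_lp (k : ℤ) : Continuous fun V : ℓ^∞(ℤ, ℝ) => V k :=
  (continuous_apply k).comp lp.uniformContinuous_coe.continuous

lemma continuous_coeff_transfer (m : ℤ) (n : ℕ) (i j : Fin 2) (k : ℕ) :
    Continuous fun V : ℓ^∞(ℤ, ℝ) =>
      (transfer (fun l => (X : ℝ[X]) - C (V l)) m n i j).coeff k := by
  induction n generalizing i j k with
  | zero => exact continuous_const
  | succ n ih =>
    simp only [transfer_succ, stepMatrix, Matrix.mul_apply, Fin.sum_univ_two]
    fin_cases i
    · simp only [Fin.zero_eta, Matrix.of_apply, Matrix.cons_val', Matrix.cons_val_zero,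
        Matrix.cons_val_one, sub_mul, neg_mul, one_mul, coeff_add, coeff_sub, coeff_neg, coeff_C_mul]
      have h1 : Continuous fun V : ℓ^∞(ℤ, ℝ) =>
          (X * transfer (fun l => (X : ℝ[X]) - C (V l)) m n 0 j).coeff k := by
        cases k with
        | zero => simp only [coeff_X_mul_zero, continuous_const]
        | succ k => simpa only [coeff_X_mul] using ih 0 j k
      exact (h1.sub ((continuous_eval_lp _).mul (ih 0 j k))).add (ih 1 j k).neg
    · simpa using ih 0 j k

lemma continuous_coeff_discriminant (N k : ℕ) :
    Continuous fun V : ℓ^∞(ℤ, ℝ) => (discriminant V N).coeff k := by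
  simp only [discriminant, Matrix.trace_fin_two, coeff_add]
  exact (continuous_coeff_transfer 0 N 0 0 k).add (continuous_coeff_transfer 0 N 1 1 k)

lemma norm_schrodinger_sub_le (V W : ℓ^∞(ℤ, ℝ)) : ‖schrodinger V - schrodinger W‖ ≤ ‖V - W‖ := by
  have h : schrodinger V - schrodinger W = lpMultiplication (V - W) := by
    ext ψ n
    change (ψ (n + 1) + ψ (n - 1) + (V n : ℂ) * ψ n) - (ψ (n + 1) + ψ (n - 1) + (W n : ℂ) * ψ n) =
      ((V n - W n : ℝ) : ℂ) * ψ n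
    push_cast
    ring
  rw [h]
  exact LinearMap.mkContinuous_norm_le _ (norm_nonneg _) _

lemma continuous_schrodinger : Continuous schrodinger := by
  refine LipschitzWith.continuous (K := 1) (LipschitzWith.of_dist_le_mul fun V W => ?_)
  rw [dist_eq_norm, dist_eq_norm, NNReal.coe_one, one_mul]
  exact norm_schrodinger_sub_le V W

lemma continuous_greenNumerator_potential (N : ℕ) (z : ℂ) :
    Continuous fun V : ℓ^∞(ℤ, ℝ) => greenNumerator V N z := by
  unfold greenNumerator
  refine continuous_finsetSum _ fun k _ =>
    (Complex.continuous_ofReal.comp (continuous_coeff_discriminant N k)).mul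
      (continuous_finsetSum _ fun i _ => continuous_const.mul ?_)
  have h1 : Continuous fun V : ℓ^∞(ℤ, ℝ) => (schrodinger V ^ (k - 1 - i)) siteVector :=
    (continuous_schrodinger.pow _).clm_apply continuous_const
  simp only [← inner_siteVector]
  exact continuous_const.inner h1

lemma continuous_complexDiscriminant_potential (N : ℕ) (z : ℂ) :
    Continuous fun V : ℓ^∞(ℤ, ℝ) => complexDiscriminant V N z := by
  unfold complexDiscriminant
  exact continuous_finsetSum _ fun k _ =>
    (Complex.continuous_ofReal.comp (continuous_coeff_discriminant N k)).mul continuous_const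

variable {V : ℓ^∞(ℤ, ℝ)} {N : ℕ}

lemma continuousAt_siteDensity {E : ℝ} (hE : E ∈ regularEnergies V N) :
    ContinuousAt (fun W : ℓ^∞(ℤ, ℝ) => siteDensity W N E) V := by
  have h1 : ContinuousAt (fun W : ℓ^∞(ℤ, ℝ) => greenSq W N E) V :=
    ((continuous_greenNumerator_potential N E).pow 2).continuousAt.div
      (((continuous_complexDiscriminant_potential N E).pow 2).sub continuous_const).continuousAt hE
  unfold siteDensity absImGreen
  exact ((h1.norm.sub (Complex.continuous_re.continuousAt.comp h1)).div_const 2).sqrt.div_const _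

lemma siteMeasure_univ (V : ℓ^∞(ℤ, ℝ)) : siteMeasure V Set.univ = 1 := by
  have h := spectralMeasure_real_univ (schrodinger V) (isSelfAdjoint_schrodinger V) siteVector
  have h1 : ‖siteVector‖ = 1 := by
    rw [siteVector, lp.norm_single (by norm_num), norm_one]
  rw [h1, one_pow] at h
  rw [← ofReal_measureReal (measure_ne_top _ _)]
  exact (congrArg ENNReal.ofReal h).trans ENNReal.ofReal_one

/-- Among potentials of a fixed period, the spectral measure depends continuously on the potential
with respect to total variation. -/
lemma exists_siteMeasure_le_add (hN : 0 < N) (hV : ∀ k, V (k + N) = V k) {η : ℝ≥0∞} (hη : 0 < η) :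
    ∃ δ > 0, ∀ W : ℓ^∞(ℤ, ℝ), (∀ k, W (k + N) = W k) → ‖W - V‖ < δ → ∀ S : Set ℝ,
      MeasurableSet S → siteMeasure W S ≤ siteMeasure V S + η := by
  -- Scheffé's argument: the positive part of the difference of densities is dominated by the
  -- density of `V`, which is integrable, so pointwise convergence suffices.
  set J : ℓ^∞(ℤ, ℝ) → ℝ≥0∞ := fun W =>
    ∫⁻ E, ENNReal.ofReal (siteDensity V N E - siteDensity W N E) with hJ
  have hJlim : Tendsto J (𝓝 V) (𝓝 0) := by
    have h0 : (0 : ℝ≥0∞) = ∫⁻ _ : ℝ, 0 := by simp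
    rw [h0]
    refine tendsto_lintegral_filter_of_dominated_convergence
      (fun E => ENNReal.ofReal (siteDensity V N E)) ?_ ?_ ?_ ?_
    · exact Eventually.of_forall fun W =>
        ((measurable_siteDensity V N).sub (measurable_siteDensity W N)).ennreal_ofReal
    · exact Eventually.of_forall fun W => Eventually.of_forall fun E =>
        ENNReal.ofReal_le_ofReal (by linarith [siteDensity_nonneg (V := W) (N := N) E])
    · have h1 := siteMeasure_univ V
      rw [siteMeasure_eq_withDensity hN hV, withDensity_apply _ MeasurableSet.univ,
        Measure.restrict_univ] at h1
      rw [h1]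
      exact ENNReal.one_ne_top
    · have h1 : ∀ᵐ E : ℝ, E ∈ regularEnergies V N :=
        mem_ae_iff.2 ((finite_compl_regularEnergies hN).measure_zero _)
      filter_upwards [h1] with E hE
      have h2 : ContinuousAt (fun W : ℓ^∞(ℤ, ℝ) =>
          ENNReal.ofReal (siteDensity V N E - siteDensity W N E)) V :=
        ENNReal.continuous_ofReal.continuousAt.comp
          (continuousAt_const.sub (continuousAt_siteDensity hE))
      simpa using h2.tendsto
  obtain ⟨δ, hδ, hball⟩ := Metric.eventually_nhds_iff.1 (hJlim.eventually (gt_mem_nhds hη))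
  refine ⟨δ, hδ, fun W hW hWV S hS => ?_⟩
  have hJη : J W ≤ η := (hball (by rwa [dist_eq_norm])).le
  -- The bound on `J` controls loss of mass on the complement; as both measures have mass one, it
  -- controls gain of mass on `S`.
  have hcompl : siteMeasure V Sᶜ ≤ siteMeasure W Sᶜ + η := by
    rw [siteMeasure_eq_withDensity hN hV, siteMeasure_eq_withDensity hN hW,
      withDensity_apply _ hS.compl, withDensity_apply _ hS.compl]
    calc ∫⁻ E in Sᶜ, ENNReal.ofReal (siteDensity V N E)
        ≤ ∫⁻ E in Sᶜ, (ENNReal.ofReal (siteDensity W N E) +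
            ENNReal.ofReal (siteDensity V N E - siteDensity W N E)) := by
          refine lintegral_mono fun E => ?_
          refine (ENNReal.ofReal_le_ofReal ?_).trans ENNReal.ofReal_add_le
          linarith
      _ = (∫⁻ E in Sᶜ, ENNReal.ofReal (siteDensity W N E)) +
            ∫⁻ E in Sᶜ, ENNReal.ofReal (siteDensity V N E - siteDensity W N E) :=
          lintegral_add_left (measurable_siteDensity W N).ennreal_ofReal _
      _ ≤ _ := by
          gcongr
          exact (setLIntegral_le_lintegral _ _).trans hJη
  have hW1 := measure_add_measure_compl (μ := siteMeasure W) hS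
  have hV1 := measure_add_measure_compl (μ := siteMeasure V) hS
  rw [siteMeasure_univ] at hW1 hV1
  have hne : siteMeasure W Sᶜ ≠ ∞ := measure_ne_top _ _
  refine (ENNReal.add_le_add_iff_right hne).1 ?_
  rw [hW1, ← hV1, add_assoc, add_comm η]
  gcongr

end TotalVariation

/-! ### Shifts and reduction to the site vector at the origin. -/

section ShiftCovariance

lemma spectralMeasure_unitary_conj {H : Type*} [NormedAddCommGroup H] [InnerProductSpace ℂ H]
    [CompleteSpace H] (A B : H →L[ℂ] H) (hA : IsSelfAdjoint A) (hB : IsSelfAdjoint B)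
    (u : unitary (H →L[ℂ] H)) (h : (u : H →L[ℂ] H) * A * (star u : H →L[ℂ] H) = B) (ψ : H) :
    spectralMeasure B hB ((u : H →L[ℂ] H) ψ) = spectralMeasure A hA ψ := by
  refine Measure.ext_of_integral_eq_on_compactlySupported fun g => ?_
  rw [integral_spectralMeasure, integral_spectralMeasure]
  have hc : Continuous (Unitary.conjStarAlgAut ℂ (H →L[ℂ] H) u) := by
    change Continuous fun x : H →L[ℂ] H => (u : H →L[ℂ] H) * x * (star u : H →L[ℂ] H)
    fun_prop
  have h1 := StarAlgHomClass.map_cfc (S := ℂ) (Unitary.conjStarAlgAut ℂ (H →L[ℂ] H) u)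
    (g : ℝ → ℝ) A g.continuous.continuousOn hc hA (by
      rw [Unitary.conjStarAlgAut_apply, h]
      exact hB)
  rw [Unitary.conjStarAlgAut_apply, Unitary.conjStarAlgAut_apply, h] at h1
  have hu : ∀ φ : H, (star u : H →L[ℂ] H) ((u : H →L[ℂ] H) φ) = φ := fun φ => by
    have := Unitary.coe_star_mul_self u
    exact congrArg (fun C : H →L[ℂ] H => C φ) this
  rw [← h1]
  change (⟪(u : H →L[ℂ] H) ψ, (u : H →L[ℂ] H) (cfc (g : ℝ → ℝ) A
    ((star u : H →L[ℂ] H) ((u : H →L[ℂ] H) ψ)))⟫_ℂ).re = _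
  rw [hu, ← ContinuousLinearMap.adjoint_inner_right, ← ContinuousLinearMap.star_eq_adjoint, hu]

lemma lpShift_mul (a b : ℤ) : lpShift a * lpShift b = lpShift (a + b) := by
  ext ψ n
  change ψ (n + a + b) = ψ (n + (a + b))
  rw [add_assoc]

lemma lpShift_zero : lpShift 0 = 1 := by
  ext ψ n
  change ψ (n + 0) = ψ n
  rw [add_zero]

lemma star_lpShift (m : ℤ) : star (lpShift m) = lpShift (-m) := by
  rw [ContinuousLinearMap.star_eq_adjoint, eq_comm, ContinuousLinearMap.eq_adjoint_iff]
  intro φ ψ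
  rw [inner_lpShift_left, neg_neg]

/-- The shift as a unitary operator. -/
noncomputable def unitaryShift (m : ℤ) : unitary (ℓ^2(ℤ, ℂ) →L[ℂ] ℓ^2(ℤ, ℂ)) :=
  ⟨lpShift m, by
    rw [Unitary.mem_iff, star_lpShift, lpShift_mul, lpShift_mul, neg_add_cancel, add_neg_cancel,
      lpShift_zero]
    exact ⟨rfl, rfl⟩⟩

lemma spectralMeasure_single (V W : ℓ^∞(ℤ, ℝ)) (m : ℤ) (hVW : ∀ n, W n = V (n + m)) :
    spectralMeasure (schrodinger V) (isSelfAdjoint_schrodinger V) (lp.single 2 m (1 : ℂ)) =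
      siteMeasure W := by
  have h : (unitaryShift m : ℓ^2(ℤ, ℂ) →L[ℂ] ℓ^2(ℤ, ℂ)) * schrodinger V *
      (star (unitaryShift m) : ℓ^2(ℤ, ℂ) →L[ℂ] ℓ^2(ℤ, ℂ)) = schrodinger W := by
    change lpShift m * schrodinger V * star (lpShift m) = _
    rw [star_lpShift]
    ext ψ n
    change ψ (n + m + 1 + -m) + ψ (n + m - 1 + -m) + (V (n + m) : ℂ) * ψ (n + m + -m) =
      ψ (n + 1) + ψ (n - 1) + (W n : ℂ) * ψ n
    rw [hVW, add_neg_cancel_right, show n + m + 1 + -m = n + 1 by ring,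
      show n + m - 1 + -m = n - 1 by ring]
  rw [← spectralMeasure_unitary_conj _ _ (isSelfAdjoint_schrodinger V) (isSelfAdjoint_schrodinger W)
    (unitaryShift m) h]
  congr 1
  change lpShift m (lp.single 2 m (1 : ℂ)) = siteVector
  ext n
  change (lp.single 2 m (1 : ℂ) : ℓ^2(ℤ, ℂ)) (n + m) = siteVector n
  by_cases hn : n = 0
  · subst hn
    rw [zero_add, lp.single_apply_self, siteVector_apply_zero]
  · rw [siteVector_apply_ne hn, lp.single_apply_ne _ _ _ (by omega)]

/-- Vectors with absolutely continuous spectral measure form a closed subspace, and the site vectors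
span a dense one. -/
lemma hasPurelyACSpectrum_of_single (V : ℓ^∞(ℤ, ℝ))
    (h : ∀ m : ℤ, spectralMeasure (schrodinger V) (isSelfAdjoint_schrodinger V)
      (lp.single 2 m (1 : ℂ)) ≪ volume) :
    HasPurelyACSpectrum (schrodinger V) (isSelfAdjoint_schrodinger V) := by
  intro ψ
  set S := acSubmodule (schrodinger V) (isSelfAdjoint_schrodinger V) with hS
  have hmem : ∀ m : ℤ, lp.single 2 m (ψ m) ∈ S := fun m => by
    have h1 : (lp.single 2 m (ψ m) : ℓ^2(ℤ, ℂ)) = ψ m • lp.single 2 m (1 : ℂ) := by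
      rw [← lp.single_smul, smul_eq_mul, mul_one]
    rw [h1]
    exact S.smul_mem _ (h m)
  have hsum := lp.hasSum_single (by norm_num) ψ
  exact (isClosed_acSubmodule _ _).mem_of_tendsto hsum
    (Filter.Eventually.of_forall fun s => S.sum_mem fun m _ => hmem m)

end ShiftCovariance

/-! ### Periodic functions along minimal orbits. -/

section PeriodicSampling

open Filter Topology

variable {Ω : Type*} [TopologicalSpace Ω]

lemma homeomorph_zpow_add (T : Ω ≃ₜ Ω) (m n : ℤ) (ω : Ω) :
    (T ^ (m + n)) ω = (T ^ m) ((T ^ n) ω) := by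
  rw [zpow_add]
  rfl

/-- The function `f` is invariant under the `N`-th iterate of `T`. -/
def HasPeriod (T : Ω ≃ₜ Ω) (N : ℕ) (f : C(Ω, ℝ)) : Prop := ∀ ω, f ((T ^ (N : ℤ)) ω) = f ω

lemma HasPeriod.zpow_mul {T : Ω ≃ₜ Ω} {N : ℕ} {f : C(Ω, ℝ)} (hf : HasPeriod T N f) (j : ℤ)
    (ω : Ω) : f ((T ^ (N * j : ℤ)) ω) = f ω := by
  induction j using Int.induction_on with
  | zero => simp
  | succ j ih => rw [mul_add, mul_one, add_comm, homeomorph_zpow_add, hf, ih]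
  | pred j ih =>
    rw [← ih, ← hf ((T ^ (N * (-j - 1 : ℤ) : ℤ)) ω), ← homeomorph_zpow_add]
    congr 3
    ring

lemma HasPeriod.mul {T : Ω ≃ₜ Ω} {N : ℕ} {f : C(Ω, ℝ)} (hf : HasPeriod T N f) (q : ℕ) :
    HasPeriod T (N * q) f := fun ω => by
  rw [Nat.cast_mul]
  exact hf.zpow_mul q ω

section Compact

variable [CompactSpace Ω] {T : Ω ≃ₜ Ω}

lemma dynPotential_apply (f : C(Ω, ℝ)) (ω : Ω) (n : ℤ) :
    dynPotential T f ω n = f ((T ^ n) ω) := rfl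

lemma norm_dynPotential_sub_le (f g : C(Ω, ℝ)) (ω : Ω) :
    ‖dynPotential T f ω - dynPotential T g ω‖ ≤ ‖f - g‖ :=
  lp.norm_le_of_forall_le (norm_nonneg _) fun n => (f - g).norm_coe_le_norm ((T ^ n) ω)

lemma HasPeriod.dynPotential_add {N : ℕ} {f : C(Ω, ℝ)} (hf : HasPeriod T N f) (ω : Ω) (k : ℤ) :
    dynPotential T f ω (k + N) = dynPotential T f ω k := by
  rw [dynPotential_apply, dynPotential_apply, add_comm, homeomorph_zpow_add, hf]

lemma dynPotential_zpow (f : C(Ω, ℝ)) (ω : Ω) (m n : ℤ) :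
    dynPotential T f ((T ^ m) ω) n = dynPotential T f ω (n + m) := by
  rw [dynPotential_apply, dynPotential_apply, homeomorph_zpow_add]

/-- The closed sets `C k` cover a dense orbit, hence `Ω`. Only finitely many potentials occur, which
makes estimates uniform in `ω`. -/
lemma HasPeriod.exists_dynPotential_eq (hmin : IsMinimalHomeo T) {N : ℕ} (hN : 0 < N)
    {f : C(Ω, ℝ)} (hf : HasPeriod T N f) (ω₀ ω : Ω) :
    ∃ k < N, dynPotential T f ω = dynPotential T f ((T ^ (k : ℤ)) ω₀) := by
  set C : ℕ → Set Ω := fun k =>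
    {x | ∀ m : ℤ, f ((T ^ m) x) = f ((T ^ m) ((T ^ (k : ℤ)) ω₀))} with hC
  have hclosed : ∀ k, IsClosed (C k) := fun k => by
    simp only [hC, Set.ofPred_forall]
    exact isClosed_iInter fun m => isClosed_eq (f.continuous.comp (T ^ m).continuous)
      continuous_const
  have hU : IsClosed (⋃ k ∈ Finset.range N, C k) :=
    isClosed_biUnion_finset fun k _ => hclosed k
  have hsub : Set.range (fun n : ℤ => (T ^ n) ω₀) ⊆ ⋃ k ∈ Finset.range N, C k := by
    rintro _ ⟨n, rfl⟩
    have hN' : (0 : ℤ) < N := by exact_mod_cast hN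
    have h1 := Int.emod_nonneg n hN'.ne'
    have h2 := Int.emod_lt_of_pos n hN'
    simp only [Set.mem_iUnion, Finset.mem_range]
    refine ⟨(n % N).toNat, by omega, fun m => ?_⟩
    rw [Int.toNat_of_nonneg h1, ← homeomorph_zpow_add, ← homeomorph_zpow_add,
      ← hf.zpow_mul (n / N) ((T ^ (m + n % N)) ω₀), ← homeomorph_zpow_add]
    congr 3
    rw [add_left_comm, Int.mul_ediv_add_emod]
  have hall := (hmin ω₀).closure_eq ▸ hU.closure_subset_iff.2 hsub
  obtain ⟨k, hk, hkC⟩ := by simpa only [Set.mem_iUnion, Finset.mem_range] using hall (Set.mem_univ ω)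
  exact ⟨k, hk, lp.ext (funext hkC)⟩

lemma norm_sub_le_of_orbit (hmin : IsMinimalHomeo T) (ω₀ : Ω) {f g : C(Ω, ℝ)} {c : ℝ}
    (h : ∀ n : ℤ, |f ((T ^ n) ω₀) - g ((T ^ n) ω₀)| ≤ c) : ‖f - g‖ ≤ c := by
  refine (ContinuousMap.norm_le _ ((abs_nonneg _).trans (h 0))).2 fun ω => ?_
  have hcl : IsClosed {x | ‖(f - g) x‖ ≤ c} :=
    isClosed_le (f - g).continuous.norm continuous_const
  have hsub : Set.range (fun n : ℤ => (T ^ n) ω₀) ⊆ {x | ‖(f - g) x‖ ≤ c} := by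
    rintro _ ⟨n, rfl⟩
    exact h n
  exact ((hmin ω₀).closure_eq ▸ hcl.closure_subset_iff.2 hsub) (Set.mem_univ ω)

end Compact

end PeriodicSampling

/-! ### Periods coming from open subgroups. -/

section CantorGroup

open Filter Topology

variable {Ω : Type*} [AddCommGroup Ω] [TopologicalSpace Ω]

/-- The natural numbers `N` such that some open subgroup contains exactly the multiples
of `N • α` among the multiples of `α`. -/
def subgroupPeriods (α : Ω) : Set ℕ :=
  {N | 0 < N ∧ ∃ U : AddSubgroup Ω, IsOpen (U : Set Ω) ∧ ∀ n : ℤ, n • α ∈ U ↔ (N : ℤ) ∣ n}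

variable {T : Ω ≃ₜ Ω} {α : Ω}

lemma zpow_apply_of_translation (hα : ∀ ω, T ω = ω + α) (n : ℤ) (ω : Ω) :
    (T ^ n) ω = ω + n • α := by
  induction n using Int.induction_on generalizing ω with
  | zero => simp
  | succ n ih =>
    rw [homeomorph_zpow_add, ih, zpow_one, hα]
    module
  | pred n ih =>
    have h : (T ^ (-1 : ℤ)) ω = ω - α := by
      rw [zpow_neg_one]
      change T.symm ω = ω - α
      rw [Homeomorph.symm_apply_eq, hα, sub_add_cancel]
    rw [sub_eq_add_neg, homeomorph_zpow_add, h, ih]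
    module

variable [IsCantorGroup Ω]

lemma exists_zsmul_sub_mem (hα : ∀ ω, T ω = ω + α) (hmin : IsMinimalHomeo T) {U : AddSubgroup Ω}
    (hU : IsOpen (U : Set Ω)) (ω : Ω) : ∃ n : ℤ, ω - n • α ∈ U := by
  have hO : IsOpen {x : Ω | ω - x ∈ U} := hU.preimage (continuous_const.sub continuous_id)
  obtain ⟨_, hx, n, rfl⟩ := (hmin 0).inter_open_nonempty _ hO ⟨ω, by simp⟩
  refine ⟨n, ?_⟩
  have := zpow_apply_of_translation hα n 0
  rw [zero_add] at this
  rw [← this]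
  exact hx

/-- The integers `n` with `n • α ∈ U` form a subgroup of `ℤ`, nonzero because `Ω ⧸ U` is finite. -/
lemma exists_subgroupPeriod (α : Ω) {U : AddSubgroup Ω} (hU : IsOpen (U : Set Ω)) :
    ∃ N : ℕ, 0 < N ∧ ∀ n : ℤ, n • α ∈ U ↔ (N : ℤ) ∣ n := by
  obtain ⟨a, ha⟩ := Int.subgroup_cyclic (U.comap (zmultiplesHom Ω α))
  have h1 : ∀ n : ℤ, n • α ∈ U ↔ (a.natAbs : ℤ) ∣ n := fun n => by
    have h2 : n ∈ U.comap (zmultiplesHom Ω α) ↔ n • α ∈ U := Iff.rfl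
    rw [← h2, ha, ← AddSubgroup.zmultiples_eq_closure, Int.mem_zmultiples_iff, Int.natAbs_dvd]
  refine ⟨a.natAbs, ?_, h1⟩
  have hfin : Finite (Ω ⧸ U) := AddSubgroup.quotient_finite_of_isOpen U hU
  obtain ⟨m, n, hmn, h⟩ := Finite.exists_ne_map_eq_of_infinite
    fun n : ℤ => ((n • α : Ω) : Ω ⧸ U)
  rw [QuotientAddGroup.eq, ← neg_zsmul, ← add_zsmul, h1] at h
  rcases Nat.eq_zero_or_pos a.natAbs with h0 | h0
  · rw [h0, Nat.cast_zero, zero_dvd_iff] at h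
    omega
  · exact h0

lemma exists_openSubgroup_subset {O : Set Ω} (hO : IsOpen O) (h0 : (0 : Ω) ∈ O) :
    ∃ U : AddSubgroup Ω, IsOpen (U : Set Ω) ∧ (U : Set Ω) ⊆ O := by
  obtain ⟨H, hH⟩ := ProfiniteGrp.exist_openNormalAddSubgroup_sub_open_nhds_of_zero hO h0
  exact ⟨H.toAddSubgroup, H.isOpen', hH⟩

/-- Otherwise the dense orbit of `0` would be finite, making `Ω` finite and discrete, with isolated
points. -/
lemma zsmul_ne_zero_of_minimal (hα : ∀ ω, T ω = ω + α) (hmin : IsMinimalHomeo T) {n : ℤ}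
    (hn : 0 < n) : n • α ≠ 0 := by
  classical
  intro h
  have hfin : (Set.range fun n : ℤ => (T ^ n) (0 : Ω)).Finite := by
    refine ((Finset.Ico (0 : ℤ) n).image fun k => k • α).finite_toSet.subset ?_
    rintro _ ⟨k, rfl⟩
    simp only [Finset.coe_image, Set.mem_image, Finset.coe_Ico, Set.mem_Ico]
    refine ⟨k % n, ⟨Int.emod_nonneg _ hn.ne', Int.emod_lt_of_pos _ hn⟩, ?_⟩
    rw [zpow_apply_of_translation hα, zero_add]
    conv_rhs => rw [← Int.mul_ediv_add_emod k n]
    rw [add_zsmul, mul_comm, mul_zsmul, h, smul_zero, zero_add]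
  have huniv : (Set.univ : Set Ω).Finite := by
    rw [← (hmin 0).closure_eq, hfin.isClosed.closure_eq]
    exact hfin
  have : Finite Ω := Set.finite_univ_iff.1 huniv
  have h1 := PerfectSpace.univ_preperfect (α := Ω) 0 (Set.mem_univ 0)
  have hdisc : DiscreteTopology Ω := inferInstance
  refine h1.ne ?_
  rw [Filter.principal_univ, inf_top_eq, nhdsWithin, Filter.inf_principal_eq_bot, compl_compl]
  exact (isOpen_discrete _).mem_nhds rfl

/-- Intersect with an open subgroup that avoids the finitely many nonzero elements `(p j) • α`, `1 ≤
j ≤ L`. -/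
lemma exists_mul_mem_subgroupPeriods (hα : ∀ ω, T ω = ω + α) (hmin : IsMinimalHomeo T) {p : ℕ}
    (hp : p ∈ subgroupPeriods α) (L : ℕ) : ∃ q, L ≤ q ∧ p * q ∈ subgroupPeriods α := by
  classical
  obtain ⟨hp0, U, hU, hUp⟩ := hp
  set F : Finset Ω := (Finset.Icc 1 L).image fun j : ℕ => ((p * j : ℕ) : ℤ) • α with hF
  obtain ⟨U', hU', hU'F⟩ := exists_openSubgroup_subset (O := (F : Set Ω)ᶜ)
    F.finite_toSet.isClosed.isOpen_compl (by
      simp only [hF, Set.mem_compl_iff, Finset.mem_coe, Finset.mem_image, Finset.mem_Icc, not_exists,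
        not_and]
      intro j hj
      refine zsmul_ne_zero_of_minimal hα hmin ?_
      exact_mod_cast Nat.mul_pos hp0 hj.1)
  have hUU : IsOpen ((U ⊓ U' : AddSubgroup Ω) : Set Ω) := hU.inter hU'
  obtain ⟨N, hN0, hN⟩ := exists_subgroupPeriod α hUU
  obtain ⟨q, rfl⟩ : p ∣ N := by
    have := (hN N).2 dvd_rfl
    exact_mod_cast (hUp N).1 this.1
  refine ⟨q, ?_, hN0, _, hUU, hN⟩
  by_contra! hq
  have h1 := hU'F ((hN _).2 dvd_rfl).2
  refine h1 ?_
  rw [hF, Finset.mem_coe, Finset.mem_image]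
  exact ⟨q, Finset.mem_Icc.2 ⟨Nat.pos_of_mul_pos_left hN0, hq.le⟩, rfl⟩

/-- By density every `ω` lies in a coset `n • α + U`, with `n` unique modulo `N`. Assigning `v n` to
that coset is locally constant, hence continuous. -/
lemma exists_hasPeriod_orbit (hα : ∀ ω, T ω = ω + α) (hmin : IsMinimalHomeo T) {N : ℕ}
    (hN : N ∈ subgroupPeriods α) {v : ℤ → ℝ} (hv : ∀ k, v (k + N) = v k) :
    ∃ f : C(Ω, ℝ), HasPeriod T N f ∧ ∀ n : ℤ, f ((T ^ n) 0) = v n := by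
  obtain ⟨hN0, U, hU, hUN⟩ := hN
  choose r hr using exists_zsmul_sub_mem hα hmin hU
  have hvr : ∀ ω : Ω, ∀ n : ℤ, ω - n • α ∈ U → v (r ω) = v n := fun ω n h => by
    have h1 : (r ω - n) • α ∈ U := by
      have := U.sub_mem h (hr ω)
      rwa [sub_sub_sub_cancel_left, sub_eq_add_neg, ← _root_.sub_zsmul] at this
    obtain ⟨j, hj⟩ := (hUN _).1 h1
    have h2 : r ω = n + N * j := by omega
    rw [h2]
    clear h2 hj
    induction j using Int.induction_on with
    | zero => simp
    | succ j ih => rw [mul_add, mul_one, ← add_assoc, hv, ih]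
    | pred j ih => rw [← ih, ← hv]; congr 1; ring
  have hlc : IsLocallyConstant fun ω => v (r ω) := by
    rw [IsLocallyConstant.iff_exists_open]
    intro ω
    refine ⟨{x | x - ω ∈ U}, hU.preimage (continuous_id.sub continuous_const), by simp,
      fun x hx => hvr x _ ?_⟩
    have := U.add_mem hx (hr ω)
    rwa [sub_add_sub_cancel] at this
  refine ⟨⟨fun ω => v (r ω), hlc.continuous⟩, fun ω => ?_, fun n => ?_⟩
  · change v (r _) = v (r ω)
    refine hvr _ _ ?_
    have := U.add_mem (hr ω) ((hUN N).2 dvd_rfl)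
    rwa [zpow_apply_of_translation hα, add_sub_right_comm]
  · refine hvr _ _ ?_
    rw [zpow_apply_of_translation hα, zero_add, sub_self]
    exact U.zero_mem

/-- Take an open subgroup of translations that move `g` by less than `ε`. Reducing `n` modulo the
period shifts `n • α` by an element of that subgroup. -/
lemma exists_hasPeriod_near (hα : ∀ ω, T ω = ω + α) (hmin : IsMinimalHomeo T) (g : C(Ω, ℝ)) {ε : ℝ}
    (hε : 0 < ε) : ∃ p ∈ subgroupPeriods α, ∃ f, HasPeriod T p f ∧ ‖f - g‖ ≤ ε := by
  have hO : IsOpen {x : Ω | ‖g.comp (Homeomorph.addRight x : C(Ω, Ω)) - g‖ < ε} := by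
    refine isOpen_lt (Continuous.norm (Continuous.sub ?_ continuous_const)) continuous_const
    refine ContinuousMap.continuous_of_continuous_uncurry _ ?_
    exact g.continuous.comp (continuous_snd.add continuous_fst)
  obtain ⟨U, hU, hUO⟩ := exists_openSubgroup_subset hO (by
    have : g.comp (Homeomorph.addRight (0 : Ω) : C(Ω, Ω)) = g := by ext x; simp
    simpa [this] using hε)
  obtain ⟨N, hN0, hN⟩ := exists_subgroupPeriod α hU
  have hmem : N ∈ subgroupPeriods α := ⟨hN0, U, hU, hN⟩
  obtain ⟨f, hf, hfn⟩ := exists_hasPeriod_orbit hα hmin hmem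
    (v := fun k => g ((k % N) • α)) (fun k => by simp)
  refine ⟨N, hmem, f, hf, norm_sub_le_of_orbit hmin 0 fun n => ?_⟩
  have h1 : (n % N - n) • α ∈ U := (hN _).2 (Int.dvd_of_emod_eq_zero (by simp [Int.sub_emod]))
  have h2 := ((g.comp (Homeomorph.addRight ((n % N - n) • α) : C(Ω, Ω)) - g).norm_coe_le_norm
    (n • α)).trans (hUO h1).le
  rw [hfn, zpow_apply_of_translation hα, zero_add]
  refine le_trans (le_of_eq ?_) h2
  change _ = ‖g (n • α + (n % N - n) • α) - g (n • α)‖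
  rw [← add_zsmul, add_sub_cancel, Real.norm_eq_abs]

end CantorGroup

/-! ### From spectral types to Cantor spectrum. -/

section SpectralTypes

open Filter Topology

variable {H : Type*} [NormedAddCommGroup H] [InnerProductSpace ℂ H] [CompleteSpace H]

lemma isCantorSet_spectrum (A : H →L[ℂ] H) (hA : IsSelfAdjoint A)
    (hne : ∀ (E : ℝ) (φ : H), A φ = (E : ℂ) • φ → φ = 0) (hint : interior (spectrum ℝ A) = ∅) :
    IsCantorSet (spectrum ℝ A) := by
  refine ⟨⟨spectrum.isClosed A, fun E hE => ?_⟩, hint⟩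
  by_contra h
  obtain ⟨φ, hφ, hφE⟩ := exists_eigenvector_of_not_accPt A hA E hE h
  exact hφ (hne E φ hφE)

/-- For an eigenvector, `∫ (x - E)² dμ = ‖(A - E) φ‖² = 0` concentrates `μ` on the Lebesgue-null set
`{E}`. -/
lemma HasPurelyACSpectrum.eq_zero_of_eigenvector {A : H →L[ℂ] H} {hA : IsSelfAdjoint A}
    (h : HasPurelyACSpectrum A hA) (E : ℝ) (φ : H) (hφ : A φ = (E : ℂ) • φ) : φ = 0 := by
  set μ := spectralMeasure A hA φ with hμ
  have hg : Continuous fun x : ℝ => x - E := continuous_id.sub continuous_const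
  have h1 : cfc (fun x : ℝ => x - E) A φ = 0 := by
    have h2 : cfc (fun x : ℝ => x - E) A = A - algebraMap ℝ (H →L[ℂ] H) E := by
      rw [cfc_sub (fun x : ℝ => x) (fun _ => E) A, cfc_id' ℝ A, cfc_const E A]
    rw [h2, sub_apply, hφ]
    change (E : ℂ) • φ - (E : ℝ) • φ = 0
    rw [Complex.coe_smul, sub_self]
  have h3 := norm_sq_cfc_apply A hA φ hg
  have hint : Integrable (fun x : ℝ => (x - E) ^ 2) μ := by
    obtain ⟨C, hC⟩ := ((isCompact_spectrum_real A).image (hg.pow 2)).isBounded.exists_norm_le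
    refine Integrable.of_bound (hg.pow 2).aestronglyMeasurable C ?_
    have : ∀ᵐ x ∂μ, x ∈ spectrum ℝ A := mem_ae_iff.2 (spectralMeasure_compl_spectrum A hA φ)
    filter_upwards [this] with x hx using hC _ ⟨x, hx, rfl⟩
  rw [h1, norm_zero, zero_pow two_ne_zero, eq_comm,
    integral_eq_zero_iff_of_nonneg (fun x => sq_nonneg _) hint] at h3
  have h4 : ∀ᵐ x ∂μ, x ≠ E := mem_ae_iff.2 (h φ (by simp))
  have h5 : μ = 0 := by
    rw [← ae_eq_bot, ← eventually_false_iff_eq_bot]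
    filter_upwards [h3, h4] with x hx hxE
    exact hxE (sub_eq_zero.1 (pow_eq_zero_iff two_ne_zero |>.1 hx))
  have h6 := spectralMeasure_real_univ A hA φ
  rw [← hμ, h5] at h6
  simpa using h6.symm

lemma spectralMeasure_mutuallySingular (A : H →L[ℂ] H) (hA : IsSelfAdjoint A) (ψ : H)
    (h : volume (spectrum ℝ A) = 0) : spectralMeasure A hA ψ ⟂ₘ volume :=
  ⟨(spectrum ℝ A)ᶜ, (spectrum.isClosed A).measurableSet.compl, spectralMeasure_compl_spectrum A hA ψ,
    by rwa [compl_compl]⟩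

lemma abs_le_of_mem_spectrum_schrodinger (V : ℓ^∞(ℤ, ℝ)) {E : ℝ}
    (hE : E ∈ spectrum ℝ (schrodinger V)) : |E| ≤ 2 + ‖V‖ := by
  have h2 := spectrum.subset_closedBall_norm_mul _ hE
  rw [mem_closedBall_zero_iff, Real.norm_eq_abs] at h2
  have h3 : ‖schrodinger V‖ ≤ 2 + ‖V‖ := by
    refine (norm_add_le _ _).trans (add_le_add ((norm_add_le _ _).trans ?_)
      (LinearMap.mkContinuous_norm_le _ (norm_nonneg _) _))
    linarith [norm_lpShift_le 1, norm_lpShift_le (-1)]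
  have h4 : ‖(1 : ℓ^2(ℤ, ℂ) →L[ℂ] ℓ^2(ℤ, ℂ))‖ ≤ 1 := ContinuousLinearMap.norm_id_le
  exact h2.trans ((mul_le_of_le_one_right (norm_nonneg _) h4).trans h3)

end SpectralTypes

/-! ### Spectra of periodic elements of the family. -/

section PeriodicSpectrum

open Filter Topology

lemma eval_discriminant_comp_add {v w : ℤ → ℝ} {N : ℕ} (hv : ∀ k, v (k + N) = v k) {m : ℤ}
    (hw : ∀ n, w n = v (n + m)) (E : ℝ) :
    (discriminant w N).eval E = (discriminant v N).eval E := by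
  rw [eval_discriminant, eval_discriminant, ← trace_transfer (w := fun k => E - v k) (m := m)
    (fun k => by rw [hv])]
  congr 1
  refine transfer_congr fun k _ => ?_
  rw [hw, zero_add, add_comm]

variable {Ω : Type*} [TopologicalSpace Ω] [CompactSpace Ω] {T : Ω ≃ₜ Ω}

lemma HasPeriod.of_orbit (hmin : IsMinimalHomeo T) {N : ℕ} {f : C(Ω, ℝ)} (ω₀ : Ω)
    (h : ∀ n : ℤ, f ((T ^ (n + N)) ω₀) = f ((T ^ n) ω₀)) : HasPeriod T N f := by
  have h1 : f.comp ((T ^ (N : ℤ) : Ω ≃ₜ Ω) : C(Ω, Ω)) = f := by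
    rw [← sub_eq_zero, ← norm_le_zero_iff]
    refine norm_sub_le_of_orbit hmin ω₀ fun n => ?_
    change |f ((T ^ (N : ℤ)) ((T ^ n) ω₀)) - _| ≤ 0
    rw [← homeomorph_zpow_add, add_comm, h, sub_self, abs_zero]
  exact fun ω => DFunLike.congr_fun h1 ω

/-- The potential at `ω` is a translate of the one at `ω₀`, and discriminants are translation
invariant. One polynomial thus serves all `ω`. -/
lemma HasPeriod.abs_eval_discriminant_le (hmin : IsMinimalHomeo T) {N : ℕ} (hN : 0 < N)
    {f : C(Ω, ℝ)} (hf : HasPeriod T N f) (ω₀ : Ω) {ω : Ω} {E : ℝ}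
    (hE : E ∈ spectrum ℝ (dynSchrodinger T f ω)) :
    |(discriminant (dynPotential T f ω₀) N).eval E| ≤ 2 := by
  have h1 := _root_.abs_eval_discriminant_le _ (hf.dynPotential_add ω) hE
  obtain ⟨k, -, hk⟩ := hf.exists_dynPotential_eq hmin hN ω₀ ω
  rwa [eval_discriminant_comp_add (hf.dynPotential_add ω₀) (m := k)
    fun n => by rw [hk, dynPotential_zpow]] at h1

lemma exists_dynSpectrum_near (f g : C(Ω, ℝ)) (ω : Ω) {E : ℝ}
    (hE : E ∈ spectrum ℝ (dynSchrodinger T f ω)) :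
    ∃ E' ∈ spectrum ℝ (dynSchrodinger T g ω), |E - E'| ≤ ‖f - g‖ := by
  obtain ⟨E', hE', h⟩ := exists_spectrum_near (dynSchrodinger T f ω) (dynSchrodinger T g ω)
    (isSelfAdjoint_dynSchrodinger T g ω) hE
  exact ⟨E', hE', h.trans ((norm_schrodinger_sub_le _ _).trans (norm_dynPotential_sub_le f g ω))⟩

lemma norm_dynPotential_le (f : C(Ω, ℝ)) (ω : Ω) : ‖dynPotential T f ω‖ ≤ ‖f‖ :=
  lp.norm_le_of_forall_le (norm_nonneg _) fun n => f.norm_coe_le_norm ((T ^ n) ω)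

end PeriodicSpectrum

/-! ### Part (b): the generic set. -/

section SingularContinuous

open Filter Topology

lemma dense_interior_of_forall_exists_ball {X : Type*} [SeminormedAddCommGroup X] {S : Set X}
    (h : ∀ g : X, ∀ r > 0, ∃ f, ‖f - g‖ < r ∧ ∃ δ > 0, ∀ f', ‖f' - f‖ < δ → f' ∈ S) :
    Dense (interior S) := by
  refine Metric.dense_iff.2 fun g r hr => ?_
  obtain ⟨f, hfg, δ, hδ, hf⟩ := h g r hr
  refine ⟨f, mem_ball_iff_norm.2 hfg, mem_interior_iff_mem_nhds.2 ?_⟩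
  exact Metric.mem_nhds_iff.2 ⟨δ, hδ, fun f' hf' => hf f' (mem_ball_iff_norm.1 hf')⟩

variable {Ω : Type*} [AddCommGroup Ω] [TopologicalSpace Ω] [IsCantorGroup Ω] {T : Ω ≃ₜ Ω} {α : Ω}

lemma dense_interior_small_spectrum (hα : ∀ ω, T ω = ω + α) (hmin : IsMinimalHomeo T) {ε : ℝ}
    (hε : 0 < ε) : Dense (interior {f : C(Ω, ℝ) |
      ∀ ω, volume (spectrum ℝ (dynSchrodinger T f ω)) ≤ ENNReal.ofReal ε}) := by
  refine dense_interior_of_forall_exists_ball fun g r hr => ?_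
  obtain ⟨p, hp, f₁, hf₁, hf₁g⟩ := exists_hasPeriod_near hα hmin g (half_pos hr)
  -- The window `2 + ‖f₁‖ + r` contains the spectra of all potentials generated by functions within
  -- `r` of `f₁`.
  obtain ⟨Q, hQ⟩ := exists_small_bands (dynPotential T f₁ 0) hp.1 (hf₁.dynPotential_add 0)
    (by positivity : 0 < r / 4) (half_pos hε) (2 + ‖f₁‖ + r)
  obtain ⟨q, hq, hpq⟩ := exists_mul_mem_subgroupPeriods hα hmin hp Q
  obtain ⟨v, hv, hvf₁, hvol⟩ := hQ q hq
  obtain ⟨f, hf, hfv⟩ := exists_hasPeriod_orbit hα hmin hpq hv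
  have hff₁ : ‖f - f₁‖ ≤ r / 4 := norm_sub_le_of_orbit hmin 0 fun n => by
    rw [hfv]
    exact hvf₁ n
  refine ⟨f, ?_, ?_⟩
  · have := norm_sub_le_norm_sub_add_norm_sub f f₁ g
    linarith
  have hfv' : (dynPotential T f 0 : ℤ → ℝ) = v := funext hfv
  set B := {E ∈ Set.Icc (-(2 + ‖f₁‖ + r)) (2 + ‖f₁‖ + r) |
    |(discriminant v (p * q)).eval E| ≤ 2} with hB
  have hBc : IsCompact B := isCompact_Icc.inter_right
    (isClosed_le (discriminant v (p * q)).continuous.abs continuous_const)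
  have hlt : volume B < ENNReal.ofReal ε :=
    hvol.trans_lt ((ENNReal.ofReal_lt_ofReal_iff hε).2 (half_lt_self hε))
  -- Spectra of functions near `f` lie in a thickening of the compact set `B`, whose measure tends
  -- to that of `B`.
  obtain ⟨s, hs, hball⟩ := Metric.eventually_nhds_iff.1
    ((tendsto_measure_cthickening_of_isCompact hBc).eventually (gt_mem_nhds hlt))
  refine ⟨s / 2, half_pos hs, fun f' hf' ω => ?_⟩
  refine (measure_mono ?_).trans (hball (y := s / 2) (by
    rw [Real.dist_eq, sub_zero, abs_of_pos (half_pos hs)]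
    exact half_lt_self hs)).le
  intro E hE
  obtain ⟨E', hE', hEE'⟩ := exists_dynSpectrum_near f' f ω hE
  refine Metric.mem_cthickening_of_dist_le E E' _ _ ⟨?_, ?_⟩ (hEE'.trans hf'.le)
  · rw [Set.mem_Icc, ← abs_le]
    have h1 := abs_le_of_mem_spectrum_schrodinger _ hE'
    have h2 := norm_dynPotential_le (T := T) f ω
    have h3 : ‖f‖ ≤ ‖f₁‖ + ‖f - f₁‖ := by
      simpa using norm_add_le f₁ (f - f₁)
    linarith
  · have h1 := hf.abs_eval_discriminant_le hmin hpq.1 0 hE'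
    rwa [hfv'] at h1

lemma dense_interior_gordon (hα : ∀ ω, T ω = ω + α) (hmin : IsMinimalHomeo T) (k : ℕ) :
    Dense (interior {f : C(Ω, ℝ) |
      ∃ q, k ≤ q ∧ ∀ ω, |f ((T ^ (q : ℤ)) ω) - f ω| ≤ ((k : ℝ) + 1)⁻¹ ^ q}) := by
  refine dense_interior_of_forall_exists_ball fun g r hr => ?_
  obtain ⟨p, hp, f, hf, hfg⟩ := exists_hasPeriod_near hα hmin g (half_pos hr)
  -- Since `f` has exact period `p * k`, the error for `f'` comes from two evaluations, each allowed
  -- half the tolerance.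
  refine ⟨f, by linarith, ((k : ℝ) + 1)⁻¹ ^ (p * k) / 2, by positivity, fun f' hf' =>
    ⟨p * k, Nat.le_mul_of_pos_left k hp.1, fun ω => ?_⟩⟩
  have h1 := (f' - f).norm_coe_le_norm ω
  have h2 := (f' - f).norm_coe_le_norm ((T ^ ((p * k : ℕ) : ℤ)) ω)
  rw [ContinuousMap.sub_apply, Real.norm_eq_abs, abs_le] at h1 h2
  rw [hf.mul k ω] at h2
  rw [abs_le]
  constructor <;> linarith [h1.1, h1.2, h2.1, h2.2]

theorem exists_dense_isGδ_sc (hα : ∀ ω, T ω = ω + α) (hmin : IsMinimalHomeo T) :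
    ∃ G : Set C(Ω, ℝ), IsGδ G ∧ Dense G ∧ ∀ f ∈ G, ∀ ω : Ω,
      IsCantorSet (spectrum ℝ (dynSchrodinger T f ω)) ∧
      volume (spectrum ℝ (dynSchrodinger T f ω)) = 0 ∧
      HasPurelySCSpectrum (dynSchrodinger T f ω) (isSelfAdjoint_dynSchrodinger T f ω) := by
  set S : ℕ → Set C(Ω, ℝ) := fun k => {f : C(Ω, ℝ) |
      ∀ ω, volume (spectrum ℝ (dynSchrodinger T f ω)) ≤ ENNReal.ofReal (1 / ((k : ℝ) + 1))} with hS
  set P : ℕ → Set C(Ω, ℝ) := fun k => {f : C(Ω, ℝ) |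
      ∃ q, k ≤ q ∧ ∀ ω, |f ((T ^ (q : ℤ)) ω) - f ω| ≤ ((k : ℝ) + 1)⁻¹ ^ q} with hP
  have hSd : Dense (⋂ k, interior (S k)) := dense_iInter_of_isOpen (fun k => isOpen_interior)
    fun k => dense_interior_small_spectrum hα hmin (by positivity)
  have hPd : Dense (⋂ k, interior (P k)) := dense_iInter_of_isOpen (fun k => isOpen_interior)
    fun k => dense_interior_gordon hα hmin k
  have hSG : IsGδ (⋂ k, interior (S k)) := .iInter_of_isOpen fun k => isOpen_interior
  have hPG : IsGδ (⋂ k, interior (P k)) := .iInter_of_isOpen fun k => isOpen_interior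
  refine ⟨_, hSG.inter hPG, hSd.inter_of_Gδ hSG hPG hPd, fun f hf ω => ?_⟩
  have hfS : ∀ k, f ∈ S k := fun k => interior_subset (Set.mem_iInter.1 hf.1 k)
  have hfP : ∀ k, f ∈ P k := fun k => interior_subset (Set.mem_iInter.1 hf.2 k)
  have hvol : volume (spectrum ℝ (dynSchrodinger T f ω)) = 0 := by
    have h1 : Tendsto (fun k : ℕ => ENNReal.ofReal (1 / ((k : ℝ) + 1))) atTop (𝓝 0) := by
      simpa using ENNReal.tendsto_ofReal (tendsto_one_div_add_atTop_nhds_zero_nat (𝕜 := ℝ))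
    exact le_antisymm (ge_of_tendsto' h1 fun k => hfS k ω) zero_le
  have hG : IsGordon (dynPotential T f ω) := fun k => by
    obtain ⟨q, hkq, hq⟩ := hfP k
    refine ⟨q, hkq, fun n => ?_⟩
    rw [dynPotential_apply, dynPotential_apply, add_comm, homeomorph_zpow_add]
    exact hq _
  refine ⟨isCantorSet_spectrum _ (isSelfAdjoint_dynSchrodinger T f ω)
    (fun E φ hφ => hG.eq_zero_of_eigenvector E φ hφ) (volume.interior_eq_empty_of_null hvol), hvol,
    fun ψ => ⟨spectralMeasure_mutuallySingular _ _ _ hvol, fun E => hG.spectralMeasure_singleton ψ E⟩⟩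

end SingularContinuous

/-! ### Part (a): limits of periodic operators. -/

section AbsolutelyContinuous

open Filter Topology

variable {Ω : Type*} [AddCommGroup Ω] [TopologicalSpace Ω] [IsCantorGroup Ω] {T : Ω ≃ₜ Ω} {α : Ω}

/-- A ball in `C(Ω, ℝ)` centred at a periodic function. -/
structure PeriodicBall (T : Ω ≃ₜ Ω) (α : Ω) where
  period : ℕ
  center : C(Ω, ℝ)
  radius : ℝ
  period_mem : period ∈ subgroupPeriods α
  hasPeriod : HasPeriod T period center
  radius_pos : 0 < radius

/-- One step of the construction. The period `p * q` and the gap energy are fixed first; continuity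
in total variation at that period then dictates the size of the perturbation opening the gap; the
new radius is small enough to preserve the gap. -/
lemma PeriodicBall.exists_refinement (hα : ∀ ω, T ω = ω + α) (hmin : IsMinimalHomeo T)
    (b : PeriodicBall T α) (e : ℝ) {ε : ℝ} (hε : 0 < ε) {η : ℝ≥0∞} (hη : 0 < η) :
    ∃ b' : PeriodicBall T α, ‖b'.center - b.center‖ + b'.radius ≤ b.radius ∧ b'.radius ≤ ε ∧
      (∀ ω, ∀ S : Set ℝ, MeasurableSet S → siteMeasure (dynPotential T b'.center ω) S ≤
        siteMeasure (dynPotential T b.center ω) S + η) ∧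
      ∀ g, ‖g - b'.center‖ ≤ b'.radius →
        ∃ E, |E - e| < ε ∧ ∀ ω, E ∉ spectrum ℝ (dynSchrodinger T g ω) := by
  obtain ⟨p, f, ρ, hp, hf, hρ⟩ := b
  obtain ⟨Q, hQ⟩ := exists_gap_perturbation (dynPotential T f 0) hp.1 (hf.dynPotential_add 0) e hε
  obtain ⟨q, hq, hpq⟩ := exists_mul_mem_subgroupPeriods hα hmin hp Q
  obtain ⟨E, hEe, hE⟩ := hQ q hq
  have hfN := hf.mul q
  -- One `δ` for each of the finitely many potentials that occur, so that a single `s` serves every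
  -- `ω`.
  choose δ hδ hδS using fun k : ℕ => exists_siteMeasure_le_add hpq.1
    (hfN.dynPotential_add ((T ^ (k : ℤ)) 0)) hη
  have hmem : ∀ᶠ s : ℝ in 𝓝[>] 0, ∀ k ∈ Finset.range (p * q), s < δ k :=
    (Filter.eventually_all_finset _).2 fun k _ =>
      mem_nhdsWithin_of_mem_nhds (gt_mem_nhds (hδ k))
  have hmem2 : ∀ᶠ s : ℝ in 𝓝[>] 0, s < ρ := mem_nhdsWithin_of_mem_nhds (gt_mem_nhds hρ)
  obtain ⟨s, ⟨hsδ, hsρ⟩, hs0⟩ := ((hmem.and hmem2).and self_mem_nhdsWithin).exists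
  obtain ⟨v, hv, hvf, r, hr, hvr, hgap⟩ := hE s hs0
  obtain ⟨f', hf', hfv⟩ := exists_hasPeriod_orbit hα hmin hpq hv
  have hff' : ‖f' - f‖ ≤ s := norm_sub_le_of_orbit hmin 0 fun n => by
    rw [hfv]
    exact hvf n
  have hfr : HasPeriod T r f' := HasPeriod.of_orbit hmin 0 fun n => by rw [hfv, hfv, hvr]
  have hfv' : (dynPotential T f' 0 : ℤ → ℝ) = v := funext hfv
  have hopen : IsOpen {x : ℝ | 2 < |(discriminant v r).eval x|} :=
    isOpen_lt continuous_const (discriminant v r).continuous.abs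
  obtain ⟨t, ht, hball⟩ := Metric.isOpen_iff.1 hopen E hgap
  refine ⟨⟨p * q, f', min (min ε (ρ - s)) (t / 2), hpq, hf', ?_⟩, ?_, ?_, ?_, ?_⟩
  · exact lt_min (lt_min hε (sub_pos.2 hsρ)) (half_pos ht)
  · have : min (min ε (ρ - s)) (t / 2) ≤ ρ - s := (min_le_left _ _).trans (min_le_right _ _)
    change ‖f' - f‖ + min (min ε (ρ - s)) (t / 2) ≤ ρ
    linarith
  · exact (min_le_left _ _).trans (min_le_left _ _)
  · intro ω S hS
    obtain ⟨k, hk, hkf⟩ := hfN.exists_dynPotential_eq hmin hpq.1 0 ω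
    change siteMeasure (dynPotential T f' ω) S ≤ siteMeasure (dynPotential T f ω) S + η
    rw [hkf]
    refine hδS k _ (hf'.dynPotential_add ω) ?_ S hS
    rw [← hkf]
    exact (norm_dynPotential_sub_le f' f ω).trans_lt
      (hff'.trans_lt (hsδ k (Finset.mem_range.2 hk)))
  · intro g hg
    refine ⟨E, hEe, fun ω hEω => ?_⟩
    obtain ⟨E', hE', hEE'⟩ := exists_dynSpectrum_near g f' ω hEω
    have h1 := hfr.abs_eval_discriminant_le hmin hr 0 hE'
    rw [hfv'] at h1
    refine h1.not_gt (hball (Metric.mem_ball'.2 ?_))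
    have h2 : ‖g - f'‖ ≤ t / 2 := hg.trans (min_le_right _ _)
    rw [Real.dist_eq]
    linarith

/-- Setwise increments are summable, so a null set has an open neighbourhood whose mass is small for
all late indices simultaneously. Semicontinuity on open sets carries this to the limit. -/
lemma absolutelyContinuous_of_tendsto {V : ℕ → ℓ^∞(ℤ, ℝ)} {W : ℓ^∞(ℤ, ℝ)}
    (hlim : Tendsto V atTop (𝓝 W)) (hac : ∀ j, siteMeasure (V j) ≪ volume)
    (hstep : ∀ j, ∀ S : Set ℝ, MeasurableSet S →
      siteMeasure (V (j + 1)) S ≤ siteMeasure (V j) S + 2⁻¹ ^ (j + 1)) :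
    siteMeasure W ≪ volume := by
  -- Adding the remaining budget `2⁻¹ ^ j` makes the sequence nonincreasing in the index.
  have htel : ∀ j k, ∀ S : Set ℝ, MeasurableSet S →
      siteMeasure (V (j + k)) S + 2⁻¹ ^ (j + k) ≤ siteMeasure (V j) S + 2⁻¹ ^ j := by
    intro j k S hS
    induction k with
    | zero => exact le_rfl
    | succ k ih =>
      refine le_trans ?_ ih
      calc _ ≤ siteMeasure (V (j + k)) S + 2⁻¹ ^ (j + k + 1) + 2⁻¹ ^ (j + k + 1) :=
            add_le_add_left (hstep (j + k) S hS) _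
        _ = _ := by
            rw [add_assoc, pow_succ, ← mul_add, ENNReal.inv_two_add_inv_two, mul_one]
  intro A hA
  have hbound : ∀ j : ℕ, siteMeasure W A ≤ 2⁻¹ ^ j + 2⁻¹ ^ j := fun j => by
    have hpos : siteMeasure (V j) A < 2⁻¹ ^ j := by
      rw [hac j hA]
      exact ENNReal.pow_pos (by simp) j
    obtain ⟨O, hAO, hO, hOlt⟩ := A.exists_isOpen_lt_of_lt _ hpos
    refine (measure_mono hAO).trans (spectralMeasure_open_le_of_tendsto
      (fun i => isSelfAdjoint_schrodinger (V i)) (isSelfAdjoint_schrodinger W)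
      ((continuous_schrodinger.tendsto W).comp hlim) siteVector hO ?_)
    filter_upwards [eventually_ge_atTop j] with i hi
    obtain ⟨k, rfl⟩ := Nat.exists_eq_add_of_le hi
    exact (le_self_add.trans (htel j k O hO.measurableSet)).trans (add_le_add_left hOlt.le _)
  have hlim0 : Tendsto (fun j : ℕ => (2⁻¹ : ℝ≥0∞) ^ j + 2⁻¹ ^ j) atTop (𝓝 0) := by
    have h1 := ENNReal.tendsto_pow_atTop_nhds_zero_of_lt_one (r := (2⁻¹ : ℝ≥0∞)) (by simp)
    simpa using h1.add h1
  exact le_antisymm (ge_of_tendsto' hlim0 hbound) zero_le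

lemma volume_spectrum_pos_of_absolutelyContinuous {V : ℓ^∞(ℤ, ℝ)} (h : siteMeasure V ≪ volume) :
    0 < volume (spectrum ℝ (schrodinger V)) := by
  refine pos_iff_ne_zero.2 fun h0 => ?_
  have h1 := siteMeasure_univ V
  rw [← Set.union_compl_self (spectrum ℝ (schrodinger V))] at h1
  have h2 := measure_union_le (μ := siteMeasure V) (spectrum ℝ (schrodinger V))
    (spectrum ℝ (schrodinger V))ᶜ
  have h3 : siteMeasure V (spectrum ℝ (schrodinger V))ᶜ = 0 :=
    spectralMeasure_compl_spectrum _ (isSelfAdjoint_schrodinger V) _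
  rw [h1, h h0, h3, add_zero] at h2
  exact one_ne_zero (le_antisymm h2 zero_le)

theorem exists_dense_ac (hα : ∀ ω, T ω = ω + α) (hmin : IsMinimalHomeo T) :
    ∃ D : Set C(Ω, ℝ), Dense D ∧ ∀ f ∈ D, ∀ ω : Ω,
      IsCantorSet (spectrum ℝ (dynSchrodinger T f ω)) ∧
      0 < volume (spectrum ℝ (dynSchrodinger T f ω)) ∧
      HasPurelyACSpectrum (dynSchrodinger T f ω) (isSelfAdjoint_dynSchrodinger T f ω) := by
  refine ⟨{f | ∀ ω : Ω, IsCantorSet (spectrum ℝ (dynSchrodinger T f ω)) ∧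
      0 < volume (spectrum ℝ (dynSchrodinger T f ω)) ∧
      HasPurelyACSpectrum (dynSchrodinger T f ω) (isSelfAdjoint_dynSchrodinger T f ω)},
    Metric.dense_iff.2 fun g r hr => ?_, fun f hf => hf⟩
  obtain ⟨p, hp, f₀, hf₀, hf₀g⟩ := exists_hasPeriod_near hα hmin g (by positivity : 0 < r / 3)
  -- Each rational is paired with every precision `1 / (n + 1)`, so a gap energy eventually appears
  -- arbitrarily close to each rational. The factor `(1 / 2) ^ j` in `ε` makes the centers Cauchy.
  obtain ⟨u, hu⟩ := exists_surjective_nat (ℚ × ℕ)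
  set ε : ℕ → ℝ := fun j => min (1 / (((u j).2 : ℝ) + 1)) ((1 / 2) ^ j) with hεdef
  have hε : ∀ j, 0 < ε j := fun j => lt_min (by positivity) (by positivity)
  choose next hnear hsmall hmeas hgap using fun (j : ℕ) (b : PeriodicBall T α) =>
    b.exists_refinement hα hmin (u j).1 (hε j) (η := 2⁻¹ ^ (j + 1))
      (ENNReal.pow_pos (by simp) _)
  let b : ℕ → PeriodicBall T α := fun j =>
    Nat.rec ⟨p, f₀, r / 3, hp, hf₀, by positivity⟩ (fun j b => next j b) j
  have hb : ∀ j, b (j + 1) = next j (b j) := fun j => rfl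
  have hnest : ∀ j k, ‖(b (j + k)).center - (b j).center‖ + (b (j + k)).radius ≤ (b j).radius := by
    intro j k
    induction k with
    | zero => simp
    | succ k ih =>
      have h1 := hnear (j + k) (b (j + k))
      rw [← hb] at h1
      have h2 := norm_sub_le_norm_sub_add_norm_sub (b (j + k + 1)).center (b (j + k)).center
        (b j).center
      rw [← add_assoc]
      linarith
  have hdist : ∀ j k, j ≤ k → ‖(b k).center - (b j).center‖ ≤ (b j).radius := fun j k hjk => by
    obtain ⟨i, rfl⟩ := Nat.exists_eq_add_of_le hjk
    linarith [hnest j i, (b (j + i)).radius_pos]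
  have hcauchy : CauchySeq fun j => (b (j + 1)).center := by
    refine cauchySeq_of_le_geometric (1 / 2) 1 (by norm_num) fun j => ?_
    rw [dist_comm, dist_eq_norm, one_mul]
    refine (hdist (j + 1) (j + 2) (Nat.le_succ _)).trans ?_
    rw [hb]
    exact (hsmall j _).trans (min_le_right _ _)
  obtain ⟨f, hf⟩ := cauchySeq_tendsto_of_complete hcauchy
  have hlim : Tendsto (fun j => (b j).center) atTop (𝓝 f) := (tendsto_add_atTop_iff_nat 1).1 hf
  have hfball : ∀ j, ‖f - (b j).center‖ ≤ (b j).radius := fun j =>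
    le_of_tendsto (hlim.sub_const _).norm (eventually_atTop.2 ⟨j, hdist j⟩)
  have hsite : ∀ ω, siteMeasure (dynPotential T f ω) ≪ volume := fun ω => by
    refine absolutelyContinuous_of_tendsto (V := fun j => dynPotential T (b j).center ω) ?_ ?_ ?_
    · rw [tendsto_iff_norm_sub_tendsto_zero] at hlim ⊢
      exact squeeze_zero (fun _ => norm_nonneg _) (fun j => norm_dynPotential_sub_le _ _ ω) hlim
    · exact fun j => siteMeasure_absolutelyContinuous (b j).period_mem.1
        ((b j).hasPeriod.dynPotential_add ω)
    · exact fun j S hS => hmeas j (b j) ω S hS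
  refine ⟨f, ?_, fun ω => ?_⟩
  · rw [mem_ball_iff_norm]
    have h1 : ‖f - f₀‖ ≤ r / 3 := hfball 0
    have h2 := norm_sub_le_norm_sub_add_norm_sub f f₀ g
    linarith
  have hac : HasPurelyACSpectrum (dynSchrodinger T f ω) (isSelfAdjoint_dynSchrodinger T f ω) :=
    hasPurelyACSpectrum_of_single _ fun m => by
      rw [spectralMeasure_single _ (dynPotential T f ((T ^ m) ω)) m
        fun n => dynPotential_zpow f ω m n]
      exact hsite _
  refine ⟨isCantorSet_spectrum _ (isSelfAdjoint_dynSchrodinger T f ω) hac.eq_zero_of_eigenvector ?_,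
    volume_spectrum_pos_of_absolutelyContinuous (hsite ω), hac⟩
  rw [Set.eq_empty_iff_forall_notMem]
  intro x hx
  obtain ⟨t, ht, hball⟩ := Metric.mem_nhds_iff.1 (mem_interior_iff_mem_nhds.1 hx)
  obtain ⟨e, hxe, het⟩ := exists_rat_btwn (by linarith : x < x + t / 2)
  obtain ⟨n, hn⟩ := exists_nat_one_div_lt (half_pos ht)
  obtain ⟨j, hj⟩ := hu (e, n)
  -- The limit lies in every ball, so each gap survives and puts a resolvent energy inside the
  -- supposed interval of spectrum.
  obtain ⟨E, hEe, hE⟩ := hgap j (b j) f (hfball (j + 1))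
  refine hE ω (hball ?_)
  have h1 : ε j ≤ 1 / ((n : ℝ) + 1) := by
    refine (min_le_left _ _).trans (le_of_eq ?_)
    rw [hj]
  rw [hj] at hEe
  rw [Metric.mem_ball, Real.dist_eq]
  have h2 := abs_lt.1 hEe
  rw [abs_lt]
  constructor <;> linarith [h2.1, h2.2]

end AbsolutelyContinuous
theorem theorem1 {Ω : Type*} [AddCommGroup Ω] [TopologicalSpace Ω] [IsCantorGroup Ω]
    (T : Ω ≃ₜ Ω) (hT : IsTranslation T) (hmin : IsMinimalHomeo T) :
    (∃ D : Set C(Ω, ℝ), Dense D ∧ ∀ f ∈ D, ∀ ω : Ω,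
      IsCantorSet (spectrum ℝ (dynSchrodinger T f ω)) ∧
      0 < volume (spectrum ℝ (dynSchrodinger T f ω)) ∧
      HasPurelyACSpectrum (dynSchrodinger T f ω) (isSelfAdjoint_dynSchrodinger T f ω)) ∧
    (∃ G : Set C(Ω, ℝ), IsGδ G ∧ Dense G ∧ ∀ f ∈ G, ∀ ω : Ω,
      IsCantorSet (spectrum ℝ (dynSchrodinger T f ω)) ∧
      volume (spectrum ℝ (dynSchrodinger T f ω)) = 0 ∧
      HasPurelySCSpectrum (dynSchrodinger T f ω) (isSelfAdjoint_dynSchrodinger T f ω)) := by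
  obtain ⟨α, hα⟩ := hT
  exact ⟨exists_dense_ac hα hmin, exists_dense_isGδ_sc hα hmin⟩
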